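/- Let $Q=[-1,1]^2$, let $U=\{y\in\mathbb R^3:|y|=1,\ y_3\ge 0\}$, and let $h$ be a bilipschitz map from $Q$ onto $U$. Let $F:\mathbb R^3\to\mathbb R^3$ be the corresponding Zorich map: $F(x_1,x_2,x_3)=e^{x_3}h(x_1,x_2)$ for $(x_1,x_2)\in Q$, and $F$ is extended to $\mathbb R^3$ by repeated reflection, so that reflecting $x$ in a side $x_1=\pm1$ or $x_2=\pm1$ of the beam $Q\times\mathbb R$ (and in the sides of its reflected copies) corresponds to reflecting $F(x)$ in the plane $\{y_3=0\}$. Let $0<\alpha<1$ and $m<M$ be real numbers such that $|DF(x)|\le\alpha$ for almost every $x$ with $x_3\le m$, and $|DF(x)v|\ge 1/\alpha$ for all unit vectors $v$, for almost every $x$ with $x_3\ge M$. Let $a\ge e^M-m$ and $f(x)=f_a(x)=F(x)-(0,0,a)$. Call $H\subset\mathbb R^3$ a (Devaney) hair if there is a homeomorphism $\gamma:[0,\infty)\to H$ with $\gamma(t)\to\infty$ as $t\to\infty$; the point $\gamma(0)$ is its endpoint. Let $S=\{(r_1,r_2)\in\mathbb Z^2: r_1+r_2 \text{ even}\}$ and,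 for $r\in S$, $T(r)=\{x\in\mathbb R^3:|x_1-2r_1|<1,\ |x_2-2r_2|<1,\ x_3>M\}$. Call a sequence $\underline s=(s_k)_{k\ge0}$ in $S$ admissible if there is $t>0$ with $\limsup_{k\to\infty}|s_k|/E^k(t)<\infty$, where $E(t)=e^t-1$ and $E^k$ denotes its $k$-th iterate. Then $f$ has a unique fixed point $\xi=(\xi_1,\xi_2,\xi_3)$ with $\xi_3\le m$. Let $J=\{x\in\mathbb R^3: f^k(x)\not\to\xi\}$ and, for a sequence $\underline s$ in $S$, let $J_{\underline s}=\{x\in J: f^k(x)\in T(s_k)\text{ for all }k\ge0\}$. Then $J_{\underline s}$ is a hair for every admissible $\underline s$, the sets $J_{\underline s}$ for different admissible $\underline s$ are disjoint, there are uncountably many of these hairs, and $J$ is the union of the $J_{\underline s}$ over all admissible $\underline s$. The set $C$ of endpoints of these hairs has Hausdorff dimension $3$, while $J\setminus C$ has Hausdorff dimension $1$. -/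

import Mathlib

open Filter Topology MeasureTheory
open scoped NNReal

namespace Zorich

/-- Euclidean three-space. -/
abbrev E3 : Type := EuclideanSpace ℝ (Fin 3)

/-- The Euclidean plane. -/
abbrev E2 : Type := EuclideanSpace ℝ (Fin 2)

/-- The closed square `[-1, 1] × [-1, 1]`. -/
def Q : Set E2 := {p | |p 0| ≤ 1 ∧ |p 1| ≤ 1}

/-- The closed upper unit hemisphere. -/
def U : Set E3 := {y | ‖y‖ = 1 ∧ 0 ≤ y 2}

/-- `h` restricts to a bilipschitz map of the square `Q` onto the hemisphere `U`
(the values of `h` outside `Q` play no role). -/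
def IsBilipschitzOntoU (h : E2 → E3) : Prop :=
  h '' Q = U ∧
    ∃ L : ℝ, 1 ≤ L ∧ ∀ p ∈ Q, ∀ q ∈ Q,
      L⁻¹ * dist p q ≤ dist (h p) (h q) ∧ dist (h p) (h q) ≤ L * dist p q

/-- Reflection in the plane `{y₃ = 0}`. -/
def reflectPlane (y : E3) : E3 := !₂[y 0, y 1, -(y 2)]

/-- `F` is a Zorich map: on the square beam `Q × ℝ` it is `e^{x₃} h(x₁, x₂)` with `h` bilipschitz
from `Q` onto `U`, and it is extended to the whole space by repeated reflection, that is, the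
reflections in the four sides `x₁ = ±1`, `x₂ = ±1` of the beam (which generate the group of all
reflections in sides of the square beams) correspond to the reflection in the plane `{y₃ = 0}`. -/
def IsZorichMap (F : E3 → E3) : Prop :=
  (∃ h : E2 → E3, IsBilipschitzOntoU h ∧
    ∀ x : E3, !₂[x 0, x 1] ∈ Q → F x = Real.exp (x 2) • h !₂[x 0, x 1]) ∧
  (∀ x : E3, F !₂[2 - x 0, x 1, x 2] = reflectPlane (F x)) ∧
  (∀ x : E3, F !₂[-2 - x 0, x 1, x 2] = reflectPlane (F x)) ∧
  (∀ x : E3, F !₂[x 0, 2 - x 1, x 2] = reflectPlane (F x)) ∧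
  (∀ x : E3, F !₂[x 0, -2 - x 1, x 2] = reflectPlane (F x))

/-- The map `f_a = F - (0, 0, a)`. -/
def shiftedMap (F : E3 → E3) (a : ℝ) (x : E3) : E3 := F x - !₂[0, 0, a]

/-- The set of points whose orbit under `f` does not converge to `ξ`. -/
def nonConvergenceSet (f : E3 → E3) (ξ : E3) : Set E3 :=
  {x | ¬ Tendsto (fun k : ℕ => f^[k] x) atTop (𝓝 ξ)}

/-- The half-beam `T(r) = P(r) × (M, ∞)` over the open square `P(r)` of side length two
centred at `2 r`. -/
def T (M : ℝ) (r : ℤ × ℤ) : Set E3 :=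
  {x | |x 0 - 2 * (r.1 : ℝ)| < 1 ∧ |x 1 - 2 * (r.2 : ℝ)| < 1 ∧ M < x 2}

/-- The index set of all `(r₁, r₂) ∈ ℤ²` with `r₁ + r₂` even. -/
def S : Set (ℤ × ℤ) := {r | Even (r.1 + r.2)}

/-- The function `E(t) = e^t - 1`. -/
noncomputable def E (t : ℝ) : ℝ := Real.exp t - 1

/-- A sequence in `S` is admissible (exponentially bounded) if for some `t > 0` the upper limit
of `|s_k| / E^k(t)` is finite. -/
def Admissible (s : ℕ → ℤ × ℤ) : Prop :=
  (∀ k, s k ∈ S) ∧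
    ∃ t : ℝ, 0 < t ∧ IsBoundedUnder (· ≤ ·) atTop
      (fun k : ℕ => Real.sqrt (((s k).1 : ℝ) ^ 2 + ((s k).2 : ℝ) ^ 2) / E^[k] t)

/-- The set of all points of the non-convergence set whose itinerary is `s`. -/
def itinerarySet (f : E3 → E3) (ξ : E3) (M : ℝ) (s : ℕ → ℤ × ℤ) : Set E3 :=
  {x | x ∈ nonConvergenceSet f ξ ∧ ∀ k : ℕ, f^[k] x ∈ T M (s k)}

/-- `γ` is a homeomorphism from `[0, ∞)` onto `H` with `γ(t) → ∞` as `t → ∞`. -/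
def IsHairParam (H : Set E3) (γ : ℝ≥0 ≃ₜ H) : Prop :=
  Tendsto (fun t : ℝ≥0 => ‖(γ t : E3)‖) atTop atTop

/-- `H` is a Devaney hair. -/
def IsHair (H : Set E3) : Prop := ∃ γ : ℝ≥0 ≃ₜ H, IsHairParam H γ

/-- `p` is the endpoint `γ(0)` of the hair `H`. -/
def IsEndpoint (H : Set E3) (p : E3) : Prop :=
  ∃ γ : ℝ≥0 ≃ₜ H, IsHairParam H γ ∧ (γ 0 : E3) = p

/-- The set of all endpoints of the hairs that correspond to the admissible sequences. -/
def endpointSet (f : E3 → E3) (ξ : E3) (M : ℝ) : Set E3 :=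
  {p | ∃ s, Admissible s ∧ IsEndpoint (itinerarySet f ξ M s) p}

end Zorich

/-! ### Mean value inequality from an almost everywhere bound on the derivative -/

namespace Zorich

/-! The dynamics uses only the metric facts collected in `BeamMap`. Points of height at most `M` are
sent to height at most `m`, and the half-space below `m` is mapped into itself by a contraction.
This gives `ξ`, and J is the set `high` of points whose orbit stays above `M`. Since F maps the
beams of odd index into the lower half-space, such an orbit visits only open beams with index in
`S`. On these the relevant inverse branches contract by `α`, so every point of J has exactly one
itinerary. The two derivative hypotheses enter through the mean value inequality
`norm_sub_le_of_ae_norm_fderiv_le`, applied to F below and to an inverse branch above.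

Hairs: two points with a common itinerary separate like `α⁻¹ ^ k`, while their horizontal distance
stays bounded, so their height difference diverges. Once one point is far above the other, its
horizontal coordinates are negligible against the norm `exp (x 2)` of `f x + (0, 0, a)`, hence its
height evolves essentially by `E` (`above_step`). The points of a hair are thus ordered by their
speed of escape, measured by `pot`, the limit of the heights pulled back by `E^[k]`. This function
is injective, continuous and proper on an itinerary set. Every value above an attained one is
attained, by a compactness argument producing an orbit within distance one of the heights `E^[k] t`
(`exists_pot_eq`). Therefore `pot` identifies each itinerary set with a closed half-line
(`exists_hairParam`), and the endpoint is the point of least potential.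

Dimension of J minus C: a point that is not an endpoint has a slower companion on its hair, which
controls its horizontal coordinates. Hence its orbit enters a set `steep` where these coordinates
are at most `exp (ε * height)`. A cell at height j is covered there by about `exp ((1 + 2 * ε) * j)`
pieces, each contracted by about `exp (-j)`. For every d > 1 and suitable ε and minimal height, the
supremum B of the d-contents of these cell pieces satisfies B ≤ B/2, so it vanishes. The lower bound
1 comes from connectedness of a hair.

Dimension of C: the image of a unit cube at height j contains about `exp (3 * j)` separated unit
cubes, and `f` is Lipschitz there with a constant of order `exp j`. Iterating gives a nested compact
construction in J with positive d-content for each d < 3 (`le_content_nest`). So J has dimension 3,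
and since J minus C has dimension at most 1, C carries it. -/

theorem norm_sub_le_of_ae_norm_fderiv_le {D : Set E3} (hD : IsOpen D) (hconv : Convex ℝ D)
    {g : E3 → E3} {C : ℝ≥0} (hg : LipschitzOnWith C g D) {K : ℝ}
    (hK : ∀ᵐ x : E3, x ∈ D → ‖fderiv ℝ g x‖ ≤ K) {x y : E3} (hx : x ∈ D) (hy : y ∈ D) :
    ‖g y - g x‖ ≤ K * ‖y - x‖ := by
  obtain ⟨g', hg', heq⟩ := hg.extend_finite_dimension
  set C' := lipschitzExtensionConstant E3 * C
  have hK' : ∀ᵐ z : E3, z ∈ D → ‖fderiv ℝ g' z‖ ≤ K := by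
    filter_upwards [hK] with z hz hzD
    have : g =ᶠ[𝓝 z] g' := by
      filter_upwards [hD.mem_nhds hzD] with w hw using heq hw
    rw [← this.fderiv_eq]
    exact hz hzD
  rw [heq hx, heq hy]
  have hseg : segment ℝ x y ⊆ D := hconv.segment_subset hx hy
  have hcomp : IsCompact (segment ℝ x y) := by
    rw [segment_eq_image_lineMap]
    exact isCompact_Icc.image (AffineMap.lineMap_continuous)
  obtain ⟨δ, hδ, hsub⟩ := hcomp.exists_thickening_subset_open hD hseg
  have key : ∀ ε : ℝ, 0 < ε → ε < δ → ‖g' y - g' x‖ ≤ K * ‖y - x‖ + 2 * C' * ε := by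
    intro ε hε hεδ
    -- The exceptional null set may contain the whole segment from `x` to `y`, so `g'` is averaged
    -- over translations by vectors of length less than `ε`. By Rademacher and dominated convergence
    -- the average is differentiable, with derivative the average of `fderiv ℝ g'`, which obeys the
    -- bound along the segment. The measure is not normalised; its mass cancels at the end.
    set μ : Measure E3 := volume.restrict (Metric.ball 0 ε) with hμ
    have hfin : IsFiniteMeasure μ := ⟨by
      rw [hμ, Measure.restrict_apply_univ]; exact measure_ball_lt_top⟩
    have hpos : 0 < μ.real Set.univ := by
      rw [Measure.real, ENNReal.toReal_pos_iff]
      refine ⟨?_, measure_lt_top _ _⟩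
      rw [hμ, Measure.restrict_apply_univ]; exact Metric.measure_ball_pos _ _ hε
    have hcont : ∀ z : E3, Continuous fun w => g' (z + w) := fun z =>
      hg'.continuous.comp (by fun_prop)
    have hint : ∀ z : E3, Integrable (fun w => g' (z + w)) μ := by
      intro z
      exact ((hcont z).continuousOn.integrableOn_compact
        (isCompact_closedBall (0:E3) ε)).mono_set Metric.ball_subset_closedBall
    have hshift : ∀ z : E3, ∀ p : E3 → Prop, (∀ᵐ u : E3, p u) → ∀ᵐ w ∂μ, p (z + w) := by
      intro z p hp
      refine ae_restrict_of_ae ?_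
      exact (measurePreserving_add_left volume z).quasiMeasurePreserving.ae hp
    have hder : ∀ z ∈ segment ℝ x y, HasFDerivWithinAt (fun z => ∫ w, g' (z + w) ∂μ)
        (∫ w, fderiv ℝ g' (z + w) ∂μ) (segment ℝ x y) z := by
      intro z hz
      have := hasFDerivAt_integral_of_dominated_loc_of_lip (μ := μ) (𝕜 := ℝ) (s := Set.univ)
        (F := fun z w => g' (z + w)) (F' := fun w => fderiv ℝ g' (z + w)) (x₀ := z)
        (bound := fun _ => (C' : ℝ)) univ_mem
        (Eventually.of_forall fun z => (hcont z).aestronglyMeasurable) (hint z)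
        ((measurable_fderiv ℝ g').comp (by fun_prop)).aestronglyMeasurable
        (Eventually.of_forall fun w => by
          simp only [Real.nnabs_coe]
          refine LipschitzWith.lipschitzOnWith ?_
          intro u v
          simpa using hg' (u + w) (v + w))
        (integrable_const _)
        ((hshift z _ hg'.ae_differentiableAt).mono fun w hw => by
          have h1 := hw.hasFDerivAt
          have h2 : HasFDerivAt (fun u => u + w) (ContinuousLinearMap.id ℝ E3) z :=
            (hasFDerivAt_id z).add_const w
          simpa [Function.comp_def] using h1.comp z h2)
      exact this.2.hasFDerivWithinAt
    have hbd : ∀ z ∈ segment ℝ x y, ‖∫ w, fderiv ℝ g' (z + w) ∂μ‖ ≤ K * μ.real Set.univ := by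
      intro z hz
      apply norm_integral_le_of_norm_le_const
      have h1 := hshift z _ hK'
      have h2 : ∀ᵐ w ∂μ, w ∈ Metric.ball (0:E3) ε := ae_restrict_mem measurableSet_ball
      filter_upwards [h1, h2] with w hw1 hw2
      apply hw1
      apply hsub
      rw [Metric.mem_thickening_iff]
      refine ⟨z, hz, ?_⟩
      simp at hw2 ⊢
      linarith
    have h3 := (convex_segment x y).norm_image_sub_le_of_norm_hasFDerivWithin_le hder hbd
      (left_mem_segment ℝ x y) (right_mem_segment ℝ x y)
    have h4 : ‖∫ w, (g' (y + w) - g' y) - (g' (x + w) - g' x) ∂μ‖ ≤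
        2 * C' * ε * μ.real Set.univ := by
      apply norm_integral_le_of_norm_le_const
      filter_upwards [ae_restrict_mem (μ := volume) (measurableSet_ball (x := (0:E3)) (ε := ε))]
        with w hw
      have e : ∀ z, ‖g' (z + w) - g' z‖ ≤ C' * ε := by
        intro z
        refine (hg'.norm_sub_le _ _).trans ?_
        simp at hw ⊢
        gcongr
      calc _ ≤ ‖g' (y + w) - g' y‖ + ‖g' (x + w) - g' x‖ := norm_sub_le _ _
        _ ≤ C' * ε + C' * ε := add_le_add (e y) (e x)
        _ = _ := by ring
    have h6 : ∀ z, ∫ w, (g' (z + w) - g' z) ∂μ = (∫ w, g' (z + w) ∂μ) - μ.real Set.univ • g' z :=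
      fun z => by rw [integral_sub (hint z) (integrable_const _), integral_const]
    have h7 : ∀ z, Integrable (fun w => g' (z + w) - g' z) μ :=
      fun z => (hint z).sub (integrable_const _)
    rw [integral_sub (h7 y) (h7 x), h6, h6] at h4
    have h5 : ‖μ.real Set.univ • (g' y - g' x)‖ ≤ K * μ.real Set.univ * ‖y - x‖ +
        2 * C' * ε * μ.real Set.univ := by
      calc _ = ‖((∫ w, g' (y + w) ∂μ) - ∫ w, g' (x + w) ∂μ) -
          ((∫ w, g' (y + w) ∂μ) - μ.real Set.univ • g' y -
            ((∫ w, g' (x + w) ∂μ) - μ.real Set.univ • g' x))‖ := by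
            congr 1; rw [smul_sub]; abel
        _ ≤ _ := (norm_sub_le _ _).trans (add_le_add h3 h4)
    rw [norm_smul, Real.norm_of_nonneg hpos.le] at h5
    have : μ.real Set.univ * ‖g' y - g' x‖ ≤ μ.real Set.univ * (K * ‖y - x‖ + 2 * C' * ε) := by
      linarith
    exact le_of_mul_le_mul_left this hpos
  have hlim : Tendsto (fun ε : ℝ => K * ‖y - x‖ + 2 * C' * ε) (𝓝[>] 0) (𝓝 (K * ‖y - x‖)) := by
    have : Continuous fun ε : ℝ => K * ‖y - x‖ + 2 * C' * ε := by fun_prop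
    simpa using (this.tendsto 0).mono_left nhdsWithin_le_nhds
  refine ge_of_tendsto hlim ?_
  filter_upwards [Ioo_mem_nhdsGT hδ] with ε hε using key ε hε.1 hε.2

/-! ### Hausdorff content -/

section Content

variable {X Y : Type*} [MetricSpace X] [MetricSpace Y] {d : ℝ}

/-- The `d`-dimensional Hausdorff content. -/
noncomputable def content (X : Type*) [MetricSpace X] (d : ℝ) (hd : 0 < d) : OuterMeasure X :=
  OuterMeasure.ofFunction (fun s => Metric.ediam s ^ d) (by simp [hd])

theorem content_apply (hd : 0 < d) (s : Set X) :
    content X d hd s = ⨅ (t : ℕ → Set X) (_ : s ⊆ ⋃ n, t n), ∑' n, Metric.ediam (t n) ^ d :=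
  OuterMeasure.ofFunction_apply _ _ _

theorem content_le_ediam (hd : 0 < d) (s : Set X) : content X d hd s ≤ Metric.ediam s ^ d :=
  OuterMeasure.ofFunction_le s

/-- Any cover of the image pulls back to a cover of `A`. No smallness of the covering sets is
required, which makes the content scale exactly and lets it be compared across iterates. -/
theorem content_le_of_expanding (hd : 0 < d) {A : Set X} (f : X → Y) {K : ℝ≥0} (hK0 : 0 < K)
    (h : ∀ x ∈ A, ∀ y ∈ A, edist x y ≤ K * edist (f x) (f y)) :
    content X d hd A ≤ (K : ENNReal) ^ d * content Y d hd (f '' A) := by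
  rw [content_apply hd (f '' A)]
  have hK : (K : ENNReal) ^ d ≠ ⊤ := ENNReal.rpow_ne_top_of_nonneg hd.le (by simp)
  have hK' : (K : ENNReal) ^ d ≠ 0 := (ENNReal.rpow_pos (by simpa using hK0) (by simp)).ne'
  rw [ENNReal.mul_iInf_of_ne hK' hK]
  refine le_iInf fun t => ?_
  rw [ENNReal.mul_iInf_of_ne hK' hK]
  refine le_iInf fun ht => ?_
  rw [content_apply]
  refine (iInf₂_le (fun n => A ∩ f ⁻¹' t n) ?_).trans ?_
  · intro x hx
    obtain ⟨n, hn⟩ := Set.mem_iUnion.1 (ht ⟨x, hx, rfl⟩)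
    exact Set.mem_iUnion.2 ⟨n, hx, hn⟩
  · rw [← ENNReal.tsum_mul_left]
    refine ENNReal.tsum_le_tsum fun n => ?_
    rw [← ENNReal.mul_rpow_of_nonneg _ _ hd.le]
    refine ENNReal.rpow_le_rpow ?_ hd.le
    refine Metric.ediam_le fun x hx y hy => (h x hx.1 y hy.1).trans ?_
    gcongr
    exact Metric.edist_le_ediam_of_mem hx.2 hy.2

/-- A cover whose sum is at most `r ^ d` consists of sets of diameter at most `r`, so for null sets
the size restriction costs nothing. -/
theorem hausdorffMeasure_eq_zero_of_content [MeasurableSpace X] [BorelSpace X] (hd : 0 < d)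
    {A : Set X} (h : content X d hd A = 0) : μH[d] A = 0 := by
  rw [Measure.hausdorffMeasure_apply, ENNReal.iSup_eq_zero]
  intro r
  rw [ENNReal.iSup_eq_zero]
  intro hr
  rw [← nonpos_iff_eq_zero]
  refine le_of_forall_gt fun c hc => ?_
  have hpos : 0 < min c (r ^ d) := lt_min hc (ENNReal.rpow_pos_of_nonneg hr hd.le)
  rw [← h, content_apply] at hpos
  simp only [iInf_lt_iff] at hpos
  obtain ⟨t, ht, hlt⟩ := hpos
  refine lt_of_le_of_lt (iInf_le_of_le t (iInf_le_of_le ht (iInf_le_of_le ?_ ?_)))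
    (hlt.trans_le (min_le_left _ _))
  · intro n
    have h1 : Metric.ediam (t n) ^ d ≤ r ^ d :=
      (ENNReal.le_tsum n).trans (hlt.le.trans (min_le_right _ _))
    exact (ENNReal.rpow_le_rpow_iff hd).1 h1
  · exact ENNReal.tsum_le_tsum fun n => iSup_le fun _ => le_rfl

theorem content_le_hausdorffMeasure [MeasurableSpace X] [BorelSpace X] (hd : 0 < d) (A : Set X) :
    content X d hd A ≤ μH[d] A := by
  rw [Measure.hausdorffMeasure_apply]
  refine le_iSup_of_le 1 (le_iSup_of_le one_pos ?_)
  refine le_iInf fun t => le_iInf fun ht => le_iInf fun _ => ?_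
  rw [content_apply]
  refine (iInf₂_le t ht).trans (ENNReal.tsum_le_tsum fun n => ?_)
  rcases (t n).eq_empty_or_nonempty with h | h
  · simp [h, hd]
  · simp [h]

end Content

end Zorich

namespace Zorich

/-! ### Distances in coordinates -/

section Coordinates

theorem sq_norm_eq (x : E3) : ‖x‖ ^ 2 = x 0 ^ 2 + x 1 ^ 2 + x 2 ^ 2 := by
  rw [EuclideanSpace.norm_sq_eq, Fin.sum_univ_three]
  simp

theorem abs_apply_le (x : E3) (i : Fin 3) : |x i| ≤ ‖x‖ := PiLp.norm_apply_le x i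

theorem abs_sub_le_dist (x y : E3) (i : Fin 3) : |x i - y i| ≤ dist x y := by
  rw [dist_eq_norm]; exact abs_apply_le (x - y) i

theorem norm_le_sum (x : E3) : ‖x‖ ≤ |x 0| + |x 1| + |x 2| := by
  refine abs_le_of_sq_le_sq' ?_ (by positivity) |>.2
  rw [sq_norm_eq, ← sq_abs (x 0), ← sq_abs (x 1), ← sq_abs (x 2)]
  nlinarith [abs_nonneg (x 0), abs_nonneg (x 1), abs_nonneg (x 2),
    mul_nonneg (abs_nonneg (x 0)) (abs_nonneg (x 1)),
    mul_nonneg (abs_nonneg (x 0)) (abs_nonneg (x 2)),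
    mul_nonneg (abs_nonneg (x 1)) (abs_nonneg (x 2))]

theorem dist_le_sum (x y : E3) : dist x y ≤ |x 0 - y 0| + |x 1 - y 1| + |x 2 - y 2| := by
  rw [dist_eq_norm]; exact norm_le_sum (x - y)

theorem sq_dist_eq (x y : E3) :
    dist x y ^ 2 = (x 0 - y 0) ^ 2 + (x 1 - y 1) ^ 2 + (x 2 - y 2) ^ 2 := by
  rw [dist_eq_norm, sq_norm_eq]; simp

theorem dist_le_dist_of_coord {x y z w : E3} (h : ∀ i, |x i - y i| ≤ |z i - w i|) :
    dist x y ≤ dist z w := by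
  refine abs_le_of_sq_le_sq' ?_ dist_nonneg |>.2
  rw [sq_dist_eq, sq_dist_eq]
  have := fun i => sq_le_sq.2 (h i)
  linarith [this 0, this 1, this 2]

theorem dist_eq_dist_of_coord {x y z w : E3} (h : ∀ i, |x i - y i| = |z i - w i|) :
    dist x y = dist z w :=
  (dist_le_dist_of_coord fun i => (h i).le).antisymm (dist_le_dist_of_coord fun i => (h i).ge)

theorem dist_plane_le (x y : E3) : dist (!₂[x 0, x 1] : E2) !₂[y 0, y 1] ≤ dist x y := by
  refine abs_le_of_sq_le_sq' ?_ dist_nonneg |>.2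
  rw [sq_dist_eq, EuclideanSpace.dist_eq, Real.sq_sqrt (by positivity), Fin.sum_univ_two]
  simp only [Real.dist_eq, sq_abs]
  simp
  positivity

theorem dist_le_plane_add (x y : E3) :
    dist x y ≤ dist (!₂[x 0, x 1] : E2) !₂[y 0, y 1] + |x 2 - y 2| := by
  have h : dist (!₂[x 0, x 1] : E2) !₂[y 0, y 1] ^ 2 = (x 0 - y 0) ^ 2 + (x 1 - y 1) ^ 2 := by
    rw [EuclideanSpace.dist_eq, Real.sq_sqrt (by positivity), Fin.sum_univ_two]
    simp only [Real.dist_eq, sq_abs]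
    simp
  refine abs_le_of_sq_le_sq' ?_ (by positivity) |>.2
  rw [sq_dist_eq]
  have h0 : 0 ≤ dist (!₂[x 0, x 1] : E2) !₂[y 0, y 1] := dist_nonneg
  nlinarith [sq_abs (x 2 - y 2), mul_nonneg h0 (abs_nonneg (x 2 - y 2))]

end Coordinates

/-- The dynamical consequences of the hypotheses on a Zorich map that are used below. -/
structure BeamMap (f : E3 → E3) (a m M α C : ℝ) : Prop where
  cont : Continuous f
  α_pos : 0 < α
  α_lt : α < 1
  m_lt : m < M
  le_a : Real.exp M - m ≤ a
  C_pos : 0 < C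
  norm_eq : ∀ x, ‖f x + !₂[0, 0, a]‖ = Real.exp (x 2)
  contract : ∀ x y, x 2 ≤ m → y 2 ≤ m → dist (f x) (f y) ≤ α * dist x y
  -- The threshold is `m`, not `M`: this slack later turns closed conditions on an orbit into open
  -- ones.
  mem_beam : ∀ x, m < f x 2 → ∃ r ∈ S, |x 0 - 2 * (r.1 : ℝ)| < 1 ∧ |x 1 - 2 * (r.2 : ℝ)| < 1
  surj : ∀ r ∈ S, ∀ y : E3, M < y 2 → ∃ x ∈ T M r, f x = y
  expand : ∀ r ∈ S, ∀ x ∈ T M r, ∀ y ∈ T M r, M < f x 2 → M < f y 2 →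
    dist x y ≤ α * dist (f x) (f y)
  lower : ∀ r ∈ S, ∀ x ∈ T M r, ∀ y ∈ T M r, ∀ c, c ≤ x 2 → c ≤ y 2 →
    dist x y ≤ C * Real.exp (-c) * dist (f x) (f y)
  upper : ∀ (c : ℝ) (x y : E3), x 2 ≤ c → y 2 ≤ c → dist (f x) (f y) ≤ C * Real.exp c * dist x y

/-! ### Folding all beams onto the base beam -/

section Folding

/-- The sign `(-1)^n`. -/
noncomputable def sgn (n : ℤ) : ℝ := (-1 : ℝ) ^ n

theorem sgn_cases (n : ℤ) : (Even n ∧ sgn n = 1) ∨ (¬ Even n ∧ sgn n = -1) := by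
  rcases Int.even_or_odd n with h | h
  · exact Or.inl ⟨h, h.neg_one_zpow⟩
  · exact Or.inr ⟨by simpa using h, h.neg_one_zpow⟩

theorem sgn_add (m n : ℤ) : sgn (m + n) = sgn m * sgn n := zpow_add₀ (by norm_num) _ _

theorem sgn_mul_self (n : ℤ) : sgn n * sgn n = 1 := by
  rcases sgn_cases n with h | h <;> simp [h.2]

theorem abs_sgn (n : ℤ) : |sgn n| = 1 := by
  rcases sgn_cases n with h | h <;> simp [h.2]

theorem sgn_one : sgn 1 = -1 := by simp [sgn]

theorem sgn_neg_one : sgn (-1) = -1 := by simp [sgn]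

/-- Multiplication of the third coordinate by `(-1)^n`. -/
noncomputable def flip (n : ℤ) (y : E3) : E3 := !₂[y 0, y 1, sgn n * y 2]

/-- The map folding the beam with index `r` onto the beam with index `0`. -/
noncomputable def fold (r : ℤ × ℤ) (x : E3) : E3 :=
  !₂[sgn r.1 * (x 0 - 2 * r.1), sgn r.2 * (x 1 - 2 * r.2), x 2]

/-- The closed beam with index `r`. -/
def Beam (r : ℤ × ℤ) : Set E3 := {x | |x 0 - 2 * (r.1 : ℝ)| ≤ 1 ∧ |x 1 - 2 * (r.2 : ℝ)| ≤ 1}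

theorem exists_mem_beam (x : E3) : ∃ r, x ∈ Beam r := by
  have h : ∀ t : ℝ, |t - 2 * (round (t / 2) : ℝ)| ≤ 1 := by
    intro t
    have h1 := abs_sub_round (t / 2)
    rw [abs_le] at h1 ⊢
    constructor <;> linarith [h1.1, h1.2]
  exact ⟨(round (x 0 / 2), round (x 1 / 2)), h _, h _⟩

/-- Folding the line onto [-1, 1] is a triangle wave, hence does not increase distances. For equal
indices the fold is an isometry, for neighbours it is a reflection of one of the points, and for
indices at least two apart the points are already at distance at least 2, the diameter of the
target. -/
theorem abs_fold_sub_le {s t : ℝ} {n k : ℤ} (hs : |s - 2 * n| ≤ 1) (ht : |t - 2 * k| ≤ 1) :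
    |sgn n * (s - 2 * n) - sgn k * (t - 2 * k)| ≤ |s - t| := by
  wlog hnk : n ≤ k generalizing s t n k
  · rw [abs_sub_comm, abs_sub_comm s t]
    exact this ht hs (by omega)
  rw [abs_le] at hs ht
  obtain rfl | rfl | h : n = k ∨ k = n + 1 ∨ n + 2 ≤ k := by omega
  · rw [← mul_sub, abs_mul, abs_sgn, one_mul]
    apply le_of_eq; congr 1; ring
  · rw [sgn_add, sgn_one]
    push_cast at ht ⊢
    have e : sgn n * (s - 2 * n) - sgn n * -1 * (t - 2 * (n + 1)) =
        sgn n * (s + t - 4 * n - 2) := by ring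
    rw [e, abs_mul, abs_sgn, one_mul, abs_sub_comm s t]
    refine le_trans ?_ (le_abs_self _)
    rw [abs_le]
    constructor <;> linarith [hs.1, hs.2, ht.1, ht.2]
  · have h' : (n : ℝ) + 2 ≤ k := by exact_mod_cast h
    have h2 : |sgn n * (s - 2 * n)| ≤ 1 := by
      rw [abs_mul, abs_sgn, one_mul, abs_le]; exact hs
    have h3 : |sgn k * (t - 2 * k)| ≤ 1 := by
      rw [abs_mul, abs_sgn, one_mul, abs_le]; exact ht
    rw [abs_sub_comm s t]
    refine (abs_sub _ _).trans (le_trans ?_ (le_abs_self _))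
    linarith [hs.1, hs.2, ht.1, ht.2]

theorem fold_mem {r : ℤ × ℤ} {x : E3} (hx : x ∈ Beam r) : fold r x ∈ Beam 0 := by
  simpa [fold, Beam, abs_mul, abs_sgn] using hx

theorem dist_fold_le {r q : ℤ × ℤ} {x y : E3} (hx : x ∈ Beam r) (hy : y ∈ Beam q) :
    dist (fold r x) (fold q y) ≤ dist x y := by
  refine dist_le_dist_of_coord fun i => ?_
  fin_cases i
  · exact abs_fold_sub_le hx.1 hy.1
  · exact abs_fold_sub_le hx.2 hy.2
  · exact le_rfl

theorem dist_fold (r : ℤ × ℤ) (x y : E3) : dist (fold r x) (fold r y) = dist x y := by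
  refine dist_eq_dist_of_coord fun i => ?_
  fin_cases i
  · simp [fold, ← mul_sub, abs_mul, abs_sgn]
  · simp [fold, ← mul_sub, abs_mul, abs_sgn]
  · rfl

theorem dist_flip (n : ℤ) (x y : E3) : dist (flip n x) (flip n y) = dist x y := by
  refine dist_eq_dist_of_coord fun i => ?_
  fin_cases i
  · rfl
  · rfl
  · simp [flip, ← mul_sub, abs_mul, abs_sgn]

theorem flip_congr {n k : ℤ} {y : E3} (h : sgn n = sgn k ∨ y 2 = 0) : flip n y = flip k y := by
  rcases h with h | h <;> simp [flip, h]

theorem norm_flip (n : ℤ) (x : E3) : ‖flip n x‖ = ‖x‖ := by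
  have := dist_flip n x 0
  have h0 : flip n 0 = 0 := by ext i; fin_cases i <;> simp [flip]
  rwa [h0, dist_zero_right, dist_zero_right] at this

theorem flip_add (n k : ℤ) (y : E3) : flip (n + k) y = flip n (flip k y) := by
  simp [flip, sgn_add, mul_assoc]

theorem flip_even {n : ℤ} (hn : Even n) (y : E3) : flip n y = y := by
  have : sgn n = 1 := hn.neg_one_zpow
  ext i; fin_cases i <;> simp [flip, this]

theorem reflectPlane_eq (y : E3) : reflectPlane y = flip 1 y := by
  simp [flip, reflectPlane, sgn_one]

variable {F : E3 → E3}

/-- Only the reflections in the sides of the base beam are given. They generate all foldings: each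
unit change of a beam index applies one of them to the folded point, in one coordinate at a time,
and contributes one sign. -/
theorem eq_flip_fold (hF : IsZorichMap F) (r : ℤ × ℤ) (x : E3) :
    F x = flip (r.1 + r.2) (F (fold r x)) := by
  obtain ⟨-, h1, h2, h3, h4⟩ := hF
  simp only [reflectPlane_eq] at h1 h2 h3 h4
  have step : ∀ (n k : ℤ), (k = 1 ∨ k = -1) → ∀ s : ℝ, sgn (n + k) * (s - 2 * ((n + k : ℤ) : ℝ)) =
      2 - sgn n * (s - 2 * n) ∨ sgn (n + k) * (s - 2 * ((n + k : ℤ) : ℝ)) =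
      -2 - sgn n * (s - 2 * n) := by
    intro n k hk s
    have hk' : sgn k = -1 := by rcases hk with rfl | rfl; exacts [sgn_one, sgn_neg_one]
    rw [sgn_add, hk']
    rcases sgn_cases n with h | h <;> rcases hk with rfl | rfl <;> rw [h.2] <;> push_cast
    · left; ring
    · right; ring
    · right; ring
    · left; ring
  have ff : ∀ n k : ℤ, (k = 1 ∨ k = -1) → ∀ y, flip n y = flip (n + k) (flip 1 y) := by
    intro n k hk y
    rw [← flip_add]
    apply flip_congr
    left
    rcases hk with rfl | rfl <;> simp [sgn_add, sgn_one]
  have A : ∀ n : ℤ, ∀ x : E3, F x = flip n (F !₂[sgn n * (x 0 - 2 * n), x 1, x 2]) := by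
    have up : ∀ n k : ℤ, (k = 1 ∨ k = -1) →
        (∀ x : E3, F x = flip n (F !₂[sgn n * (x 0 - 2 * n), x 1, x 2])) →
        ∀ x : E3, F x = flip (n + k) (F !₂[sgn (n + k) * (x 0 - 2 * ((n + k : ℤ) : ℝ)), x 1, x 2]) := by
      intro n k hk ih x
      rw [ih x, ff n k hk]
      congr 1
      rcases step n k hk (x 0) with e | e <;> rw [e]
      · exact (h1 !₂[sgn n * (x 0 - 2 * n), x 1, x 2]).symm
      · exact (h2 !₂[sgn n * (x 0 - 2 * n), x 1, x 2]).symm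
    intro n
    induction n with
    | zero =>
      intro x
      rw [flip_even (by simp)]
      congr 1
      ext i; fin_cases i <;> simp [sgn]
    | succ n ih => exact up _ 1 (Or.inl rfl) ih
    | pred n ih => exact up _ (-1) (Or.inr rfl) ih
  have B : ∀ n : ℤ, ∀ x : E3, F x = flip n (F !₂[x 0, sgn n * (x 1 - 2 * n), x 2]) := by
    have up : ∀ n k : ℤ, (k = 1 ∨ k = -1) →
        (∀ x : E3, F x = flip n (F !₂[x 0, sgn n * (x 1 - 2 * n), x 2])) →
        ∀ x : E3, F x = flip (n + k) (F !₂[x 0, sgn (n + k) * (x 1 - 2 * ((n + k : ℤ) : ℝ)), x 2]) := by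
      intro n k hk ih x
      rw [ih x, ff n k hk]
      congr 1
      rcases step n k hk (x 1) with e | e <;> rw [e]
      · exact (h3 !₂[x 0, sgn n * (x 1 - 2 * n), x 2]).symm
      · exact (h4 !₂[x 0, sgn n * (x 1 - 2 * n), x 2]).symm
    intro n
    induction n with
    | zero =>
      intro x
      rw [flip_even (by simp)]
      congr 1
      ext i; fin_cases i <;> simp [sgn]
    | succ n ih => exact up _ 1 (Or.inl rfl) ih
    | pred n ih => exact up _ (-1) (Or.inr rfl) ih
  rw [A r.1 x, B r.2, flip_add]
  rfl

theorem eq_fold_of_mem_S (hF : IsZorichMap F) {r : ℤ × ℤ} (hr : r ∈ S) (x : E3) :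
    F x = F (fold r x) := by
  rw [eq_flip_fold hF r x, flip_even hr]

/-- A point on a side of a beam is, after folding, fixed by one of the reflections, so its image is
fixed by the reflection in the plane. -/
theorem apply_two_eq_zero (hF : IsZorichMap F) {r : ℤ × ℤ} {x : E3}
    (h : |x 0 - 2 * (r.1 : ℝ)| = 1 ∨ |x 1 - 2 * (r.2 : ℝ)| = 1) : F x 2 = 0 := by
  suffices H : ∀ z : E3, |z 0| = 1 ∨ |z 1| = 1 → F z 2 = 0 by
    rw [eq_flip_fold hF r x]
    have := H (fold r x) (by simpa [fold, abs_mul, abs_sgn] using h)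
    simp [flip, this]
  obtain ⟨-, h1, h2, h3, h4⟩ := hF
  have key : ∀ w : E3, w = reflectPlane w → w 2 = 0 := by
    intro w hw
    have := congrArg (fun v : E3 => v 2) hw
    simp [reflectPlane] at this
    linarith
  intro z hz
  have ez : z = !₂[z 0, z 1, z 2] := by ext i; fin_cases i <;> rfl
  rcases hz with hz | hz <;> rcases eq_or_eq_neg_of_abs_eq hz with e | e <;> apply key
  · refine Eq.trans ?_ (h1 z); congr 1
    ext i; fin_cases i <;> simp [e]; norm_num
  · refine Eq.trans ?_ (h2 z); congr 1
    ext i; fin_cases i <;> simp [e]; norm_num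
  · refine Eq.trans ?_ (h3 z); congr 1
    ext i; fin_cases i <;> simp [e]; norm_num
  · refine Eq.trans ?_ (h4 z); congr 1
    ext i; fin_cases i <;> simp [e]; norm_num

end Folding

end Zorich

namespace Zorich

/-! ### From the Zorich map to the properties in `BeamMap` -/

section Geometry

variable {F : E3 → E3}

theorem abs_exp_sub_le {s t c : ℝ} (hs : s ≤ c) (ht : t ≤ c) :
    |Real.exp s - Real.exp t| ≤ Real.exp c * |s - t| := by
  wlog h : t ≤ s generalizing s t
  · rw [abs_sub_comm, abs_sub_comm s]; exact this ht hs (by linarith)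
  have h1 : Real.exp t ≤ Real.exp s := Real.exp_le_exp.2 h
  rw [abs_of_nonneg (by linarith), abs_of_nonneg (by linarith)]
  have h2 : Real.exp t = Real.exp s * Real.exp (t - s) := by rw [← Real.exp_add]; congr 1; ring
  have h3 := Real.add_one_le_exp (t - s)
  have h4 : Real.exp s ≤ Real.exp c := Real.exp_le_exp.2 hs
  nlinarith [Real.exp_pos s]

theorem abs_sub_le_exp_neg_mul {s t c : ℝ} (hs : c ≤ s) (ht : c ≤ t) :
    |s - t| ≤ Real.exp (-c) * |Real.exp s - Real.exp t| := by
  wlog h : t ≤ s generalizing s t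
  · rw [abs_sub_comm, abs_sub_comm (Real.exp s)]; exact this ht hs (by linarith)
  have h1 : Real.exp t ≤ Real.exp s := Real.exp_le_exp.2 h
  rw [abs_of_nonneg (by linarith), abs_of_nonneg (by linarith)]
  have h2 : Real.exp s = Real.exp t * Real.exp (s - t) := by rw [← Real.exp_add]; congr 1; ring
  have h3 := Real.add_one_le_exp (s - t)
  have h4 : 1 ≤ Real.exp (-c) * Real.exp t := by
    rw [← Real.exp_add]; exact Real.one_le_exp (by linarith)
  have h5 : Real.exp (-c) * (Real.exp s - Real.exp t) =
      Real.exp (-c) * Real.exp t * (Real.exp (s - t) - 1) := by rw [h2]; ring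
  rw [h5]
  nlinarith

theorem mem_beam_zero {x : E3} : x ∈ Beam 0 ↔ (!₂[x 0, x 1] : E2) ∈ Q := by
  simp [Beam, Q]

/-- The bilipschitz data on the base beam in the form in which they are used. -/
theorem exists_base_bounds (hF : IsZorichMap F) : ∃ L : ℝ, 1 ≤ L ∧
    (∀ x ∈ Beam 0, ‖F x‖ = Real.exp (x 2) ∧ 0 ≤ F x 2) ∧
    (∀ y : E3, y ≠ 0 → 0 ≤ y 2 → ∃ x ∈ Beam 0, F x = y) ∧
    (∀ c : ℝ, ∀ x ∈ Beam 0, ∀ y ∈ Beam 0, x 2 ≤ c → y 2 ≤ c →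
      dist (F x) (F y) ≤ L * Real.exp c * dist x y) ∧
    (∀ c : ℝ, ∀ x ∈ Beam 0, ∀ y ∈ Beam 0, c ≤ x 2 → c ≤ y 2 →
      dist x y ≤ L * Real.exp (-c) * dist (F x) (F y)) := by
  obtain ⟨⟨h, ⟨hU, L, hL1, hL⟩, hFh⟩, -⟩ := hF
  have hFx : ∀ x ∈ Beam 0, F x = Real.exp (x 2) • h !₂[x 0, x 1] := fun x hx =>
    hFh x (mem_beam_zero.1 hx)
  have hmem : ∀ p ∈ Q, ‖h p‖ = 1 ∧ 0 ≤ h p 2 := fun p hp => by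
    have : h p ∈ U := hU ▸ Set.mem_image_of_mem h hp
    exact this
  have hnorm : ∀ x ∈ Beam 0, ‖F x‖ = Real.exp (x 2) := fun x hx => by
    rw [hFx x hx, norm_smul, (hmem _ (mem_beam_zero.1 hx)).1]; simp
  refine ⟨2 * L + 1, by linarith, fun x hx => ⟨hnorm x hx, ?_⟩, ?_, ?_, ?_⟩
  · rw [hFx x hx]
    exact mul_nonneg (Real.exp_pos _).le (hmem _ (mem_beam_zero.1 hx)).2
  · intro y hy hy2
    have hn : 0 < ‖y‖ := norm_pos_iff.2 hy
    have : ‖y‖⁻¹ • y ∈ U := by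
      refine ⟨by rw [norm_smul]; simp [hn.ne'], ?_⟩
      exact mul_nonneg (inv_nonneg.2 hn.le) hy2
    rw [← hU] at this
    obtain ⟨p, hp, hpy⟩ := this
    refine ⟨!₂[p 0, p 1, Real.log ‖y‖], by simpa [Beam, Q] using hp, ?_⟩
    have hp' : (!₂[p 0, p 1] : E2) = p := by ext i; fin_cases i <;> rfl
    rw [hFx _ (by simpa [Beam, Q] using hp)]
    change Real.exp (Real.log ‖y‖) • h !₂[p 0, p 1] = y
    rw [hp', hpy, Real.exp_log hn, smul_smul, mul_inv_cancel₀ hn.ne', one_smul]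
  · intro c x hx y hy hxc hyc
    have hx' := mem_beam_zero.1 hx
    have hy' := mem_beam_zero.1 hy
    -- The difference splits into an angular part, controlled by `h`, and a radial part, controlled
    -- by the exponential. The lower estimate below uses the same splitting, with the radial part
    -- bounded by the difference of the norms.
    have e : F x - F y = Real.exp (x 2) • (h !₂[x 0, x 1] - h !₂[y 0, y 1]) +
        (Real.exp (x 2) - Real.exp (y 2)) • h !₂[y 0, y 1] := by
      rw [hFx x hx, hFx y hy, smul_sub, sub_smul]; abel
    have h1 : dist (h !₂[x 0, x 1]) (h !₂[y 0, y 1]) ≤ L * dist x y :=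
      (hL _ hx' _ hy').2.trans (by gcongr; exact dist_plane_le x y)
    have h2 : |Real.exp (x 2) - Real.exp (y 2)| ≤ Real.exp c * dist x y :=
      (abs_exp_sub_le hxc hyc).trans (by gcongr; exact abs_sub_le_dist x y 2)
    have h3 : Real.exp (x 2) ≤ Real.exp c := Real.exp_le_exp.2 hxc
    rw [dist_eq_norm] at h1
    calc dist (F x) (F y) = ‖F x - F y‖ := dist_eq_norm _ _
      _ ≤ Real.exp (x 2) * ‖h !₂[x 0, x 1] - h !₂[y 0, y 1]‖ +
          |Real.exp (x 2) - Real.exp (y 2)| := by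
          rw [e]
          refine (norm_add_le _ _).trans ?_
          rw [norm_smul, norm_smul, (hmem _ hy').1]
          simp
      _ ≤ Real.exp c * (L * dist x y) + Real.exp c * dist x y := by gcongr
      _ ≤ (2 * L + 1) * Real.exp c * dist x y := by
          have : 0 ≤ Real.exp c * dist x y := by positivity
          nlinarith
  · intro c x hx y hy hxc hyc
    have hx' := mem_beam_zero.1 hx
    have hy' := mem_beam_zero.1 hy
    have hs := hnorm x hx
    have ht := hnorm y hy
    have h0 : |Real.exp (x 2) - Real.exp (y 2)| ≤ dist (F x) (F y) := by
      rw [← hs, ← ht, dist_eq_norm]; exact abs_norm_sub_norm_le _ _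
    have e : Real.exp (x 2) • (h !₂[x 0, x 1] - h !₂[y 0, y 1]) = (F x - F y) -
        (Real.exp (x 2) - Real.exp (y 2)) • h !₂[y 0, y 1] := by
      rw [hFx x hx, hFx y hy, smul_sub, sub_smul]; abel
    have h1 : Real.exp (x 2) * ‖h !₂[x 0, x 1] - h !₂[y 0, y 1]‖ ≤ 2 * dist (F x) (F y) := by
      have := congrArg norm e
      rw [norm_smul, Real.norm_of_nonneg (Real.exp_pos _).le] at this
      rw [this]
      refine (norm_sub_le _ _).trans ?_
      rw [norm_smul, (hmem _ hy').1, ← dist_eq_norm, Real.norm_eq_abs]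
      linarith
    have h2 : ‖h !₂[x 0, x 1] - h !₂[y 0, y 1]‖ ≤ Real.exp (-c) * (2 * dist (F x) (F y)) := by
      have h4 : 1 ≤ Real.exp (-c) * Real.exp (x 2) := by
        rw [← Real.exp_add]; exact Real.one_le_exp (by linarith)
      calc _ ≤ (Real.exp (-c) * Real.exp (x 2)) * ‖h !₂[x 0, x 1] - h !₂[y 0, y 1]‖ :=
            le_mul_of_one_le_left (norm_nonneg _) h4
        _ = Real.exp (-c) * (Real.exp (x 2) * ‖h !₂[x 0, x 1] - h !₂[y 0, y 1]‖) := by ring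
        _ ≤ _ := by gcongr
    have h3 : dist (!₂[x 0, x 1] : E2) !₂[y 0, y 1] ≤ L * (Real.exp (-c) * (2 * dist (F x) (F y))) := by
      have := (hL _ hx' _ hy').1
      rw [inv_mul_le_iff₀ (by linarith), dist_eq_norm (h _)] at this
      exact this.trans (by gcongr)
    have h5 := (abs_sub_le_exp_neg_mul hxc hyc).trans
      (mul_le_mul_of_nonneg_left h0 (Real.exp_pos (-c)).le)
    refine (dist_le_plane_add x y).trans ((add_le_add h3 h5).trans (le_of_eq ?_))
    ring

theorem norm_apply_eq (hF : IsZorichMap F) (x : E3) : ‖F x‖ = Real.exp (x 2) := by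
  obtain ⟨L, -, hb, -⟩ := exists_base_bounds hF
  obtain ⟨r, hr⟩ := exists_mem_beam x
  rw [eq_flip_fold hF r x, norm_flip]
  exact (hb _ (fold_mem hr)).1

/-- A Lipschitz bound on the base beam carries over to the whole space. -/
theorem dist_le_of_base (hF : IsZorichMap F) {K c : ℝ} (hK : 0 ≤ K)
    (hb : ∀ x ∈ Beam 0, ∀ y ∈ Beam 0, x 2 ≤ c → y 2 ≤ c → dist (F x) (F y) ≤ K * dist x y)
    {x y : E3} (hx : x 2 ≤ c) (hy : y 2 ≤ c) : dist (F x) (F y) ≤ K * dist x y := by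
  have sub : ∀ (r q : ℤ × ℤ) (x y : E3), x ∈ Beam r → y ∈ Beam q → x 2 ≤ c → y 2 ≤ c →
      (sgn (r.1 + r.2) = sgn (q.1 + q.2) ∨ F x 2 = 0) → dist (F x) (F y) ≤ K * dist x y := by
    intro r q x y hxr hyq hx hy h
    have e : F x = flip (q.1 + q.2) (F (fold r x)) := by
      rw [eq_flip_fold hF r x]
      apply flip_congr
      refine h.imp_right fun h0 => ?_
      rw [eq_flip_fold hF r x] at h0
      have h0' : sgn (r.1 + r.2) * F (fold r x) 2 = 0 := h0
      rcases mul_eq_zero.1 h0' with h1 | h1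
      · have := abs_sgn (r.1 + r.2)
        rw [h1] at this; simp at this
      · exact h1
    rw [e, eq_flip_fold hF q y, dist_flip]
    exact (hb _ (fold_mem hxr) _ (fold_mem hyq) hx hy).trans
      (by gcongr; exact dist_fold_le hxr hyq)
  obtain ⟨r, hr⟩ := exists_mem_beam x
  obtain ⟨q, hq⟩ := exists_mem_beam y
  by_cases hs : sgn (r.1 + r.2) = sgn (q.1 + q.2)
  · exact sub r q x y hr hq hx hy (Or.inl hs)
  have hrq : r.1 ≠ q.1 ∨ r.2 ≠ q.2 := by
    by_contra! h
    exact hs (by rw [h.1, h.2])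
  have far : ∀ {n k : ℤ} {t : ℝ}, n ≠ k → |t - 2 * k| ≤ 1 → 1 ≤ |t - 2 * n| := by
    intro n k t hnk ht
    rw [abs_le] at ht
    rcases lt_or_gt_of_ne hnk with h | h
    · have : (n : ℝ) + 1 ≤ k := by exact_mod_cast h
      exact le_abs.2 (Or.inl (by linarith [ht.1]))
    · have : (k : ℝ) + 1 ≤ n := by exact_mod_cast h
      exact le_abs.2 (Or.inr (by linarith [ht.2]))
  set ℓ : ℝ → E3 := fun t => AffineMap.lineMap x y t
  have hℓ : Continuous ℓ := AffineMap.lineMap_continuous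
  have hcoord : ∀ i, Continuous fun t => ℓ t i := fun i =>
    (EuclideanSpace.proj i : E3 →L[ℝ] ℝ).continuous.comp hℓ
  obtain ⟨t, ht, hmax⟩ : ∃ t ∈ Set.Icc (0:ℝ) 1,
      max |ℓ t 0 - 2 * (r.1 : ℝ)| |ℓ t 1 - 2 * (r.2 : ℝ)| = 1 := by
    have hc : Continuous fun t => max |ℓ t 0 - 2 * (r.1 : ℝ)| |ℓ t 1 - 2 * (r.2 : ℝ)| :=
      (((hcoord 0).sub continuous_const).abs).max (((hcoord 1).sub continuous_const).abs)
    refine intermediate_value_Icc zero_le_one hc.continuousOn ⟨?_, ?_⟩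
    · simp only [ℓ, AffineMap.lineMap_apply_zero]
      exact max_le hr.1 hr.2
    · simp only [ℓ, AffineMap.lineMap_apply_one]
      rcases hrq with h | h
      · exact le_max_of_le_left (far h hq.1)
      · exact le_max_of_le_right (far h hq.2)
  have hz2 : ℓ t 2 ≤ c := by
    have : ℓ t 2 = (1 - t) * x 2 + t * y 2 := by
      simp [ℓ, AffineMap.lineMap_apply]; ring
    rw [this]
    nlinarith [ht.1, ht.2]
  have hzr : ℓ t ∈ Beam r := ⟨hmax ▸ le_max_left _ _, hmax ▸ le_max_right _ _⟩
  have hz0 : F (ℓ t) 2 = 0 := by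
    apply apply_two_eq_zero hF (r := r)
    rcases max_choice |ℓ t 0 - 2 * (r.1 : ℝ)| |ℓ t 1 - 2 * (r.2 : ℝ)| with h | h
    · left; rw [← h, hmax]
    · right; rw [← h, hmax]
  have hseg : dist x (ℓ t) + dist (ℓ t) y = dist x y := by
    simp only [ℓ]
    rw [dist_comm x, dist_lineMap_left, dist_lineMap_right, Real.norm_of_nonneg ht.1,
      Real.norm_of_nonneg (by linarith [ht.2])]
    ring
  calc dist (F x) (F y) ≤ dist (F x) (F (ℓ t)) + dist (F (ℓ t)) (F y) := dist_triangle _ _ _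
    _ ≤ K * dist x (ℓ t) + K * dist (ℓ t) y :=
      add_le_add (sub r r _ _ hr hzr hx hz2 (Or.inl rfl)) (sub r q _ _ hzr hq hz2 hy (Or.inr hz0))
    _ = K * dist x y := by rw [← hseg]; ring

theorem null_image_of_lipschitzOn {K : ℝ≥0} {s : Set E3} (hs : volume s = 0)
    (h : LipschitzOnWith K F s) : volume (F '' s) = 0 := by
  have hac : (volume : Measure E3) ≪ μH[3] ∧ μH[3] ≪ (volume : Measure E3) := by
    have h3 : (Module.finrank ℝ E3 : ℝ) = 3 := by simp
    rw [← h3]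
    exact ⟨Measure.absolutelyContinuous_isAddHaarMeasure _ _,
      Measure.absolutelyContinuous_isAddHaarMeasure _ _⟩
  refine hac.1 ?_
  have := h.hausdorffMeasure_image_le (d := 3) (by norm_num)
  rw [hac.2 hs, mul_zero] at this
  exact le_antisymm this bot_le

theorem lipschitzOnWith_of_dist_le {s : Set E3} {g : E3 → E3} {K : ℝ} (hK : 0 ≤ K)
    (h : ∀ x ∈ s, ∀ y ∈ s, dist (g x) (g y) ≤ K * dist x y) : LipschitzOnWith ⟨K, hK⟩ g s :=
  LipschitzOnWith.of_dist_le_mul h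

theorem isOpen_lt_apply_two (c : ℝ) : IsOpen {x : E3 | c < x 2} :=
  isOpen_lt continuous_const (EuclideanSpace.proj (2 : Fin 3) : E3 →L[ℝ] ℝ).continuous

theorem isOpen_apply_two_lt (c : ℝ) : IsOpen {x : E3 | x 2 < c} :=
  isOpen_lt (EuclideanSpace.proj (2 : Fin 3) : E3 →L[ℝ] ℝ).continuous continuous_const

theorem convex_lt_apply_two (c : ℝ) : Convex ℝ {x : E3 | c < x 2} :=
  convex_halfSpace_gt (EuclideanSpace.proj (2 : Fin 3) : E3 →L[ℝ] ℝ).isLinear c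

theorem convex_apply_two_lt (c : ℝ) : Convex ℝ {x : E3 | x 2 < c} :=
  convex_halfSpace_lt (EuclideanSpace.proj (2 : Fin 3) : E3 →L[ℝ] ℝ).isLinear c

theorem continuous_of_lipschitz_below {L : ℝ}
    (hL : ∀ (c : ℝ) (x y : E3), x 2 ≤ c → y 2 ≤ c →
      dist (F x) (F y) ≤ L * Real.exp c * dist x y) (hL0 : 0 ≤ L) : Continuous F := by
  rw [continuous_iff_continuousAt]
  intro x
  have h1 : LipschitzOnWith ⟨L * Real.exp (x 2 + 1), by positivity⟩ F {y | y 2 < x 2 + 1} :=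
    lipschitzOnWith_of_dist_le _ fun y hy z hz => hL _ y z (le_of_lt hy) (le_of_lt hz)
  exact h1.continuousOn.continuousAt ((isOpen_apply_two_lt _).mem_nhds (by simp))

/-- The mean value inequality holds on the open half-space; moving both points slightly downwards
reaches the boundary. -/
theorem dist_le_of_ae_below {L : ℝ}
    (hL : ∀ (c : ℝ) (x y : E3), x 2 ≤ c → y 2 ≤ c →
      dist (F x) (F y) ≤ L * Real.exp c * dist x y) (hL0 : 0 ≤ L) {α m : ℝ}
    (hm : ∀ᵐ x : E3, x 2 ≤ m → ‖fderiv ℝ F x‖ ≤ α) {x y : E3} (hx : x 2 ≤ m) (hy : y 2 ≤ m) :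
    dist (F x) (F y) ≤ α * dist x y := by
  have hopen : ∀ u v : E3, u 2 < m → v 2 < m → dist (F u) (F v) ≤ α * dist u v := by
    intro u v hu hv
    have := norm_sub_le_of_ae_norm_fderiv_le (isOpen_apply_two_lt m) (convex_apply_two_lt m)
      (lipschitzOnWith_of_dist_le (K := L * Real.exp m) (by positivity)
        fun y hy z hz => hL _ y z (le_of_lt hy) (le_of_lt hz))
      (hm.mono fun x hx hxm => hx (le_of_lt hxm)) hv hu
    simpa [dist_eq_norm] using this
  have hc := continuous_of_lipschitz_below hL hL0
  set e : ℝ → E3 → E3 := fun t x => x - t • !₂[0, 0, 1]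
  have he : ∀ x, Continuous fun t => e t x := fun x => by fun_prop
  have h1 : Tendsto (fun t => dist (F (e t x)) (F (e t y))) (𝓝[>] 0) (𝓝 (dist (F x) (F y))) := by
    have : Continuous fun t => dist (F (e t x)) (F (e t y)) :=
      (hc.comp (he x)).dist (hc.comp (he y))
    simpa [e] using (this.tendsto 0).mono_left nhdsWithin_le_nhds
  have h2 : Tendsto (fun t => α * dist (e t x) (e t y)) (𝓝[>] 0) (𝓝 (α * dist x y)) := by
    simp [e]
  refine le_of_tendsto_of_tendsto h1 h2 ?_
  filter_upwards [self_mem_nhdsWithin] with t ht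
  have ht' : 0 < t := ht
  exact hopen _ _ (by simp [e]; linarith) (by simp [e]; linarith)

theorem ae_differentiableAt_of_lipschitz_below {L : ℝ}
    (hL : ∀ (c : ℝ) (x y : E3), x 2 ≤ c → y 2 ≤ c →
      dist (F x) (F y) ≤ L * Real.exp c * dist x y) (hL0 : 0 ≤ L) :
    ∀ᵐ x : E3, DifferentiableAt ℝ F x := by
  have : ∀ n : ℕ, ∀ᵐ x : E3, x ∈ {x : E3 | x 2 < n} →
      DifferentiableWithinAt ℝ F {x : E3 | x 2 < n} x := fun n =>
    (lipschitzOnWith_of_dist_le (K := L * Real.exp n) (by positivity)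
        fun y hy z hz => hL _ y z (le_of_lt hy) (le_of_lt hz)).ae_differentiableWithinAt_of_mem
  filter_upwards [ae_all_iff.2 this] with x hx
  obtain ⟨n, hn⟩ := exists_nat_gt (x 2)
  exact (hx n hn).differentiableAt ((isOpen_apply_two_lt _).mem_nhds hn)

theorem null_preimage_below {L : ℝ}
    (hL : ∀ (c : ℝ) (x y : E3), x 2 ≤ c → y 2 ≤ c →
      dist (F x) (F y) ≤ L * Real.exp c * dist x y) (hL0 : 0 ≤ L) {N : Set E3}
    (hN : volume N = 0) : volume (F '' N) = 0 := by
  have e : F '' N ⊆ ⋃ n : ℕ, F '' (N ∩ {x | x 2 < n}) := by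
    rintro _ ⟨x, hx, rfl⟩
    obtain ⟨n, hn⟩ := exists_nat_gt (x 2)
    exact Set.mem_iUnion.2 ⟨n, x, ⟨hx, hn⟩, rfl⟩
  refine measure_mono_null e (measure_iUnion_null fun n => ?_)
  exact null_image_of_lipschitzOn (measure_mono_null Set.inter_subset_left hN)
    (lipschitzOnWith_of_dist_le (K := L * Real.exp n) (by positivity)
        fun y hy z hz => hL _ y z (le_of_lt hy.2) (le_of_lt hz.2))

/-- A continuous section of `F` over a half-space contracts if `DF` expands on its image. -/
theorem dist_section_le {L : ℝ}
    (hL : ∀ (c : ℝ) (x y : E3), x 2 ≤ c → y 2 ≤ c →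
      dist (F x) (F y) ≤ L * Real.exp c * dist x y) (hL0 : 0 ≤ L) {α M b : ℝ} (hα : 0 < α)
    (hM : ∀ᵐ x : E3, M ≤ x 2 → ∀ v : E3, ‖v‖ = 1 → 1 / α ≤ ‖fderiv ℝ F x v‖)
    {g : E3 → E3} {K : ℝ≥0} (hg : LipschitzOnWith K g {y | b < y 2})
    (hFg : ∀ y : E3, b < y 2 → F (g y) = y ∧ M ≤ g y 2) {x y : E3} (hx : b < x 2) (hy : b < y 2) :
    dist (g x) (g y) ≤ α * dist x y := by
  have hD := isOpen_lt_apply_two b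
  set N : Set E3 := {z | ¬ (DifferentiableAt ℝ F z ∧
    (M ≤ z 2 → ∀ v : E3, ‖v‖ = 1 → 1 / α ≤ ‖fderiv ℝ F z v‖))}
  have hN : volume N = 0 := (ae_differentiableAt_of_lipschitz_below hL hL0).and hM
  have hgN : ∀ᵐ y : E3, y ∉ F '' N := measure_eq_zero_iff_ae_notMem.1 (null_preimage_below hL hL0 hN)
  have key : ∀ᵐ y : E3, y ∈ {y : E3 | b < y 2} → ‖fderiv ℝ g y‖ ≤ α := by
    filter_upwards [hgN, hg.ae_differentiableWithinAt_of_mem] with y hyN hyd hyD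
    have hgd : DifferentiableAt ℝ g y := (hyd hyD).differentiableAt (hD.mem_nhds hyD)
    have hy1 := hFg y hyD
    have hgy : g y ∉ N := fun h => hyN ⟨g y, h, hy1.1⟩
    obtain ⟨hFd, hexp⟩ := not_not.1 hgy
    have hcomp : fderiv ℝ (F ∘ g) y = ContinuousLinearMap.id ℝ E3 := by
      have : F ∘ g =ᶠ[𝓝 y] id := by
        filter_upwards [hD.mem_nhds hyD] with w hw using (hFg w hw).1
      rw [this.fderiv_eq, fderiv_id]
    rw [fderiv_comp y hFd hgd] at hcomp
    refine ContinuousLinearMap.opNorm_le_bound _ hα.le fun v => ?_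
    set w := fderiv ℝ g y v with hw
    have hFw : fderiv ℝ F (g y) w = v := by
      have := congrArg (fun A : E3 →L[ℝ] E3 => A v) hcomp
      simpa using this
    rcases eq_or_ne w 0 with h0 | h0
    · rw [h0, norm_zero]; positivity
    · have hn : 0 < ‖w‖ := norm_pos_iff.2 h0
      have h1 := hexp hy1.2 (‖w‖⁻¹ • w) (by rw [norm_smul]; simp [hn.ne'])
      rw [map_smul, norm_smul, hFw, norm_inv, norm_norm, ← div_eq_inv_mul,
        div_le_div_iff₀ hα hn] at h1
      linarith
  have := norm_sub_le_of_ae_norm_fderiv_le hD (convex_lt_apply_two b) hg key hy hx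
  simpa [dist_eq_norm] using this

theorem IsZorichMap.beamMap (hF : IsZorichMap F) {α m M : ℝ} (hα0 : 0 < α) (hα1 : α < 1)
    (hmM : m < M) (hm : ∀ᵐ x : E3, x 2 ≤ m → ‖fderiv ℝ F x‖ ≤ α)
    (hM : ∀ᵐ x : E3, M ≤ x 2 → ∀ v : E3, ‖v‖ = 1 → 1 / α ≤ ‖fderiv ℝ F x v‖)
    {a : ℝ} (ha : Real.exp M - m ≤ a) : ∃ C, BeamMap (shiftedMap F a) a m M α C := by
  obtain ⟨L, hL1, hnn, hsurj, hup, hlow⟩ := exists_base_bounds hF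
  have hL0 : 0 ≤ L := by linarith
  have hLF : ∀ (c : ℝ) (x y : E3), x 2 ≤ c → y 2 ≤ c →
      dist (F x) (F y) ≤ L * Real.exp c * dist x y := fun c x y hx hy =>
    dist_le_of_base hF (by positivity) (hup c) hx hy
  have hcont := continuous_of_lipschitz_below hLF hL0
  have hdist : ∀ x y, dist (shiftedMap F a x) (shiftedMap F a y) = dist (F x) (F y) :=
    fun x y => dist_sub_right _ _ _
  have hf2 : ∀ x, shiftedMap F a x 2 = F x 2 - a := fun x => by simp [shiftedMap]
  have hbeam : ∀ x, 0 < F x 2 → ∃ r ∈ S, |x 0 - 2 * (r.1 : ℝ)| < 1 ∧ |x 1 - 2 * (r.2 : ℝ)| < 1 := by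
    intro x hx
    obtain ⟨r, hr⟩ := exists_mem_beam x
    refine ⟨r, ?_, lt_of_le_of_ne hr.1 fun h => ?_, lt_of_le_of_ne hr.2 fun h => ?_⟩
    · by_contra hodd
      have hs : sgn (r.1 + r.2) = -1 := by
        rcases sgn_cases (r.1 + r.2) with h | h
        · exact absurd h.1 hodd
        · exact h.2
      rw [eq_flip_fold hF r x] at hx
      have h0 := (hnn _ (fold_mem hr)).2
      have hx' : 0 < sgn (r.1 + r.2) * F (fold r x) 2 := hx
      rw [hs] at hx'; linarith
    · rw [apply_two_eq_zero hF (Or.inl h)] at hx; exact lt_irrefl _ hx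
    · rw [apply_two_eq_zero hF (Or.inr h)] at hx; exact lt_irrefl _ hx
  have hTb : ∀ r, ∀ x ∈ T M r, x ∈ Beam r := fun r x hx => ⟨hx.1.le, hx.2.1.le⟩
  have hlowS : ∀ r ∈ S, ∀ x ∈ Beam r, ∀ y ∈ Beam r, ∀ c, c ≤ x 2 → c ≤ y 2 →
      dist x y ≤ L * Real.exp (-c) * dist (F x) (F y) := by
    intro r hr x hx y hy c hcx hcy
    rw [eq_fold_of_mem_S hF hr x, eq_fold_of_mem_S hF hr y, ← dist_fold r]
    exact hlow c _ (fold_mem hx) _ (fold_mem hy) hcx hcy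
  have hlog : ∀ y : E3, Real.exp M < y 2 → ∀ x, F x = y → M < x 2 := by
    intro y hy x hxy
    rw [← Real.exp_lt_exp, ← norm_apply_eq hF, hxy]
    exact hy.trans_le ((le_abs_self _).trans (abs_apply_le y 2))
  have hex : ∀ y : E3, Real.exp M < y 2 → ∃ x ∈ Beam 0, F x = y := by
    intro y hy
    have hy0 : 0 < y 2 := (Real.exp_pos M).trans hy
    exact hsurj y (fun h => by simp [h] at hy0) hy0.le
  -- `g` is the inverse branch into the base beam; the other beams of `S` are reduced to it by
  -- `fold`.
  choose! g hgB hFg using hex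
  have hgM : ∀ y : E3, Real.exp M < y 2 → M ≤ g y 2 := fun y hy => (hlog y hy _ (hFg y hy)).le
  have hgLip : LipschitzOnWith ⟨L * Real.exp (-M), by positivity⟩ g {y | Real.exp M < y 2} := by
    refine lipschitzOnWith_of_dist_le _ fun y hy z hz => ?_
    have := hlow M _ (hgB y hy) _ (hgB z hz) (hgM y hy) (hgM z hz)
    rwa [hFg y hy, hFg z hz] at this
  have hgα : ∀ y z : E3, Real.exp M < y 2 → Real.exp M < z 2 → dist (g y) (g z) ≤ α * dist y z :=
    fun y z hy hz => dist_section_le hLF hL0 hα0 hM hgLip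
      (fun w hw => ⟨hFg w hw, hgM w hw⟩) hy hz
  have hg_unique : ∀ x ∈ Beam 0, Real.exp M < F x 2 → g (F x) = x := by
    intro x hx hFx
    have h1 := hlow M _ (hgB _ hFx) x hx (hgM _ hFx) (hlog _ hFx x rfl).le
    rw [hFg _ hFx, dist_self, mul_zero] at h1
    exact dist_le_zero.1 h1
  -- This is where `a ≥ exp M - m` and `m < M` are combined: a point with image above `M` has its
  -- F-image above the ball of radius `exp M`, in the domain of `g`.
  have hbig : ∀ y : ℝ, M < y - a → Real.exp M < y := fun y hy => by linarith
  refine ⟨L, ?_, hα0, hα1, hmM, ha, by linarith, ?_, ?_, ?_, ?_, ?_, ?_, ?_⟩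
  · exact hcont.sub continuous_const
  · intro x
    rw [shiftedMap, sub_add_cancel, norm_apply_eq hF]
  · intro x y hx hy
    rw [hdist]
    exact dist_le_of_ae_below hLF hL0 hm hx hy
  · intro x hx
    apply hbeam
    rw [hf2] at hx
    have := Real.exp_pos M
    linarith
  · intro r hr y hy
    set Y : E3 := y + !₂[0, 0, a] with hYdef
    have hY2 : Y 2 = y 2 + a := by simp [Y]
    have hY : Real.exp M < Y 2 := hbig _ (by rw [hY2]; linarith)
    set x : E3 := !₂[2 * r.1 + sgn r.1 * g Y 0, 2 * r.2 + sgn r.2 * g Y 1, g Y 2] with hx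
    have hfold : fold r x = g Y := by
      ext i
      fin_cases i <;> simp [fold, x, ← mul_assoc, sgn_mul_self]
    have hFx : F x = Y := by rw [eq_fold_of_mem_S hF hr, hfold, hFg Y hY]
    have hx2 : M < x 2 := hlog Y hY x hFx
    have hxB : x ∈ Beam r := by
      have := hgB Y hY
      simpa [Beam, x, abs_mul, abs_sgn] using this
    refine ⟨x, ⟨lt_of_le_of_ne hxB.1 fun h => ?_, lt_of_le_of_ne hxB.2 fun h => ?_, hx2⟩, ?_⟩
    · have h0 := apply_two_eq_zero hF (Or.inl h)
      rw [hFx] at h0; have := Real.exp_pos M; linarith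
    · have h0 := apply_two_eq_zero hF (Or.inr h)
      rw [hFx] at h0; have := Real.exp_pos M; linarith
    · rw [shiftedMap, hFx, hYdef, add_sub_cancel_right]
  · intro r hr x hx y hy hfx hfy
    rw [hf2] at hfx hfy
    rw [hdist, eq_fold_of_mem_S hF hr x, eq_fold_of_mem_S hF hr y, ← dist_fold r]
    rw [eq_fold_of_mem_S hF hr] at hfx hfy
    have h1 := hgα _ _ (hbig _ hfx) (hbig _ hfy)
    rwa [hg_unique _ (fold_mem (hTb r x hx)) (hbig _ hfx),
      hg_unique _ (fold_mem (hTb r y hy)) (hbig _ hfy)] at h1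
  · intro r hr x hx y hy c hcx hcy
    rw [hdist]
    exact hlowS r hr x (hTb r x hx) y (hTb r y hy) c hcx hcy
  · intro c x y hx hy
    rw [hdist]
    exact hLF c x y hx hy

end Geometry

end Zorich

namespace Zorich

/-! ### Growth of the iterates of `E` -/

section IteratedExponential

theorem E_strictMono : StrictMono E := fun s t h => by
  have := Real.exp_lt_exp.2 h
  simp only [E]; linarith

theorem E_continuous : Continuous E := by unfold E; fun_prop

theorem E_zero : E 0 = 0 := by simp [E]

theorem iterate_E_strictMono (k : ℕ) : StrictMono E^[k] := E_strictMono.iterate k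

theorem iterate_E_zero (k : ℕ) : E^[k] 0 = 0 := Function.iterate_fixed E_zero k

theorem iterate_E_nonneg {t : ℝ} (ht : 0 ≤ t) (k : ℕ) : 0 ≤ E^[k] t := by
  rw [← iterate_E_zero k]; exact (iterate_E_strictMono k).monotone ht

theorem le_E (t : ℝ) : t ≤ E t := by
  have := Real.add_one_le_exp t
  simp only [E]; linarith

theorem le_iterate_E (t : ℝ) (k : ℕ) : t ≤ E^[k] t := by
  induction k with
  | zero => exact le_rfl
  | succ k ih => rw [Function.iterate_succ_apply']; exact ih.trans (le_E _)

theorem iterate_E_surj {v : ℝ} (hv : 0 ≤ v) (k : ℕ) : ∃ t, 0 ≤ t ∧ E^[k] t = v := by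
  have := intermediate_value_Icc hv (E_continuous.iterate k).continuousOn
  obtain ⟨t, ht, h⟩ := this ⟨by rw [iterate_E_zero]; exact hv, le_iterate_E v k⟩
  exact ⟨t, ht.1, h⟩

theorem tendsto_iterate_E {t : ℝ} (ht : 0 < t) : Tendsto (fun k => E^[k] t) atTop atTop := by
  have h : ∀ k : ℕ, t + k * (t ^ 2 / 2) ≤ E^[k] t := by
    intro k
    induction k with
    | zero => simp
    | succ k ih =>
      rw [Function.iterate_succ_apply']
      have h1 := le_iterate_E t k
      have h2 := Real.quadratic_le_exp_of_nonneg (ht.le.trans h1)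
      have h3 : t ^ 2 ≤ (E^[k] t) ^ 2 := by gcongr
      simp only [E] at *
      push_cast
      linarith
  refine tendsto_atTop_mono h (tendsto_atTop_add_const_left _ _ ?_)
  exact tendsto_natCast_atTop_atTop.atTop_mul_const (by positivity)

/-- `E` is superadditive on nonnegative numbers, since `exp q - exp p = exp p * E (q - p)`. -/
theorem iterate_E_sub_le {s t : ℝ} (hs : 0 ≤ s) (hst : s ≤ t) (k : ℕ) :
    E^[k] (t - s) ≤ E^[k] t - E^[k] s := by
  induction k with
  | zero => exact le_rfl
  | succ k ih =>
    rw [Function.iterate_succ_apply', Function.iterate_succ_apply', Function.iterate_succ_apply']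
    refine (E_strictMono.monotone ih).trans ?_
    have h1 := iterate_E_nonneg hs k
    have h2 := (iterate_E_strictMono k).monotone hst
    generalize E^[k] s = p at *
    generalize E^[k] t = q at *
    simp only [E]
    have h3 : Real.exp q = Real.exp (q - p) * Real.exp p := by rw [← Real.exp_add]; congr 1; ring
    have h4 : 1 ≤ Real.exp p := Real.one_le_exp h1
    have h5 : 1 ≤ Real.exp (q - p) := Real.one_le_exp (by linarith)
    nlinarith

theorem tendsto_iterate_E_sub {s t : ℝ} (hs : 0 ≤ s) (hst : s < t) :
    Tendsto (fun k => E^[k] t - E^[k] s) atTop atTop :=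
  tendsto_atTop_mono (iterate_E_sub_le hs hst.le) (tendsto_iterate_E (sub_pos.2 hst))

/-- One step of `E` turns the diverging difference of the iterates into a diverging ratio. -/
theorem eventually_mul_iterate_E_le {s t : ℝ} (hs : 0 ≤ s) (hst : s < t) (B : ℝ) :
    ∀ᶠ k in atTop, B * E^[k] s ≤ E^[k] t := by
  have h := (Real.tendsto_exp_atTop.comp (tendsto_iterate_E_sub hs hst)).eventually_ge_atTop B
  obtain ⟨N, hN⟩ := eventually_atTop.1 h
  refine eventually_atTop.2 ⟨N + 1, fun n hn => ?_⟩
  obtain ⟨k, rfl⟩ := Nat.exists_eq_add_of_le' (Nat.one_le_of_lt hn)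
  have hk := hN k (by omega)
  have h1 := iterate_E_nonneg hs k
  have h2 := (iterate_E_strictMono k).monotone hst.le
  rw [Function.iterate_succ_apply', Function.iterate_succ_apply']
  simp only [Function.comp_apply] at hk
  generalize E^[k] s = p at *
  generalize E^[k] t = q at *
  simp only [E]
  have h3 : Real.exp q = Real.exp (q - p) * Real.exp p := by rw [← Real.exp_add]; congr 1; ring
  have h4 : 1 ≤ Real.exp p := Real.one_le_exp h1
  have h5 : 1 ≤ Real.exp (q - p) := Real.one_le_exp (by linarith)
  nlinarith

end IteratedExponential

namespace BeamMap

variable {f : E3 → E3} {a m M α C : ℝ}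

/-! ### The attracting half-space -/

section Basic

theorem one_lt_a (hf : BeamMap f a m M α C) : 1 < a := by
  linarith [hf.le_a, hf.m_lt, Real.add_one_le_exp M]

theorem add_a_pos (hf : BeamMap f a m M α C) : 0 < M + a := by
  linarith [hf.le_a, hf.m_lt, Real.exp_pos M]

theorem apply_two_le (hf : BeamMap f a m M α C) (x : E3) : f x 2 + a ≤ Real.exp (x 2) := by
  rw [← hf.norm_eq x]
  have := (le_abs_self _).trans (abs_apply_le (f x + !₂[0, 0, a]) 2)
  simpa using this

theorem abs_zero_le (hf : BeamMap f a m M α C) (x : E3) : |f x 0| ≤ Real.exp (x 2) := by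
  rw [← hf.norm_eq x]
  simpa using abs_apply_le (f x + !₂[0, 0, a]) 0

theorem abs_one_le (hf : BeamMap f a m M α C) (x : E3) : |f x 1| ≤ Real.exp (x 2) := by
  rw [← hf.norm_eq x]
  simpa using abs_apply_le (f x + !₂[0, 0, a]) 1

theorem exp_le (hf : BeamMap f a m M α C) (x : E3) :
    Real.exp (x 2) ≤ |f x 0| + |f x 1| + |f x 2 + a| := by
  rw [← hf.norm_eq x]
  simpa using norm_le_sum (f x + !₂[0, 0, a])

theorem apply_two_le_m (hf : BeamMap f a m M α C) {x : E3} (hx : x 2 ≤ M) : f x 2 ≤ m := by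
  have h1 := hf.apply_two_le x
  have h2 : Real.exp (x 2) ≤ Real.exp M := Real.exp_le_exp.2 hx
  linarith [hf.le_a]

theorem exists_fixedPoint (hf : BeamMap f a m M α C) : ∃ ξ : E3, (f ξ = ξ ∧ ξ 2 ≤ m) ∧
    (∀ y : E3, f y = y → y 2 ≤ m → y = ξ) ∧
    ∀ x : E3, x 2 ≤ m → Tendsto (fun k => f^[k] x) atTop (𝓝 ξ) := by
  set s : Set E3 := {x | x 2 ≤ m}
  have hs : IsClosed s := isClosed_le
    (EuclideanSpace.proj (2 : Fin 3) : E3 →L[ℝ] ℝ).continuous continuous_const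
  have hmaps : Set.MapsTo f s s := fun x hx => hf.apply_two_le_m (le_trans hx hf.m_lt.le)
  have huniq : ∀ x ∈ s, ∀ y ∈ s, f x = x → f y = y → x = y := by
    intro x hx y hy hfx hfy
    have h := hf.contract x y hx hy
    rw [hfx, hfy] at h
    have h0 : 0 ≤ dist x y := dist_nonneg
    exact dist_le_zero.1 (by nlinarith [hf.α_lt])
  have hcon : ContractingWith ⟨α, hf.α_pos.le⟩ (hmaps.restrict f s s) :=
    ⟨hf.α_lt, LipschitzWith.of_dist_le_mul fun x y => hf.contract x y x.2 y.2⟩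
  have key : ∀ x ∈ s, ∃ y ∈ s, f y = y ∧ Tendsto (fun k => f^[k] x) atTop (𝓝 y) := by
    intro x hx
    obtain ⟨y, hy, hfy, ht, -⟩ := hcon.exists_fixedPoint' hs.isComplete hmaps hx (edist_ne_top _ _)
    exact ⟨y, hy, hfy, ht⟩
  obtain ⟨ξ, hξ, hfξ, -⟩ := key !₂[0, 0, m] (by simp [s])
  refine ⟨ξ, ⟨hfξ, hξ⟩, fun y hy hym => huniq y hym ξ hξ hy hfξ, fun x hx => ?_⟩
  obtain ⟨y, hy, hfy, ht⟩ := key x hx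
  rwa [huniq y hy ξ hξ hfy hfξ] at ht

theorem mem_nonConvergenceSet_iff (hf : BeamMap f a m M α C) {ξ : E3} (hξ : ξ 2 ≤ m)
    (hconv : ∀ x : E3, x 2 ≤ m → Tendsto (fun k => f^[k] x) atTop (𝓝 ξ)) {x : E3} :
    x ∈ nonConvergenceSet f ξ ↔ ∀ k, M < f^[k] x 2 := by
  constructor
  · intro hx k
    by_contra! h
    apply hx
    have h1 := hconv (f^[k + 1] x) (by
      rw [Function.iterate_succ_apply']; exact hf.apply_two_le_m h)
    simp only [← Function.iterate_add_apply] at h1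
    exact (tendsto_add_atTop_iff_nat (f := fun n => f^[n] x) (k + 1)).1 h1
  · intro hx ht
    have h1 : Tendsto (fun k => f^[k] x 2) atTop (𝓝 (ξ 2)) :=
      ((EuclideanSpace.proj (2 : Fin 3) : E3 →L[ℝ] ℝ).continuous.tendsto ξ).comp ht
    have h2 := h1.eventually_lt_const (lt_of_le_of_lt hξ hf.m_lt)
    obtain ⟨k, hk⟩ := h2.exists
    exact lt_asymm hk (hx k)

end Basic

/-- The points whose orbit follows the itinerary `s`. -/
def itin (f : E3 → E3) (M : ℝ) (s : ℕ → ℤ × ℤ) : Set E3 := {x | ∀ k, f^[k] x ∈ T M (s k)}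

/-- The points whose orbit stays above height `M`. -/
def high (f : E3 → E3) (M : ℝ) : Set E3 := {x | ∀ k, M < f^[k] x 2}

theorem itin_subset_high (s : ℕ → ℤ × ℤ) : itin f M s ⊆ high f M := fun _ hx k => (hx k).2.2

theorem high_apply {x : E3} (hx : x ∈ high f M) (k : ℕ) : f^[k] x ∈ high f M := fun n => by
  rw [← Function.iterate_add_apply]; exact hx (n + k)

/-! ### The potential, or speed of escape -/

section Potential

/-- An additive constant absorbing the error terms. -/
noncomputable def shift (M : ℝ) : ℝ := 1 + 2 * Real.exp (-M)

theorem one_le_shift (M : ℝ) : 1 ≤ shift M := by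
  have := Real.exp_pos (-M)
  simp only [shift]; linarith

theorem add_shift_pos {t : ℝ} (ht : M < t) : 0 < t + shift M := by
  have := Real.exp_pos (-M)
  have := Real.add_one_le_exp (-M)
  simp only [shift]; linarith

/-- Adding `shift M` to heights makes `E` an exact majorant of the height growth. The quadratic term
of `exp (shift M)` pays for the constant on the left because `exp (x 2) * shift M ≥ 2`, and `a > 1`
pays for the -1 in `E`. -/
theorem dom_step (hf : BeamMap f a m M α C) {x : E3} (hx : M < x 2) :
    f x 2 + shift M ≤ E (x 2 + shift M) := by
  have h1 := hf.apply_two_le x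
  have h2 := hf.one_lt_a
  set c := shift M with hc
  have hc1 : 1 ≤ c := one_le_shift M
  have h3 := Real.quadratic_le_exp_of_nonneg (by linarith : 0 ≤ c)
  have h4 : Real.exp M * Real.exp (-M) = 1 := by rw [← Real.exp_add]; simp
  have h5 : Real.exp M ≤ Real.exp (x 2) := Real.exp_le_exp.2 hx.le
  have h6 : 2 * Real.exp (-M) ≤ c := by simp only [hc, shift]; linarith
  have h7 : 2 ≤ Real.exp (x 2) * c := by
    calc (2:ℝ) = Real.exp M * (2 * Real.exp (-M)) := by linarith
      _ ≤ Real.exp (x 2) * c := by gcongr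
  have h8 : c ≤ Real.exp (x 2) * (c ^ 2 / 2) := by nlinarith
  simp only [E, Real.exp_add]
  nlinarith [Real.exp_pos (x 2)]

/-- The potential of a point: the limit of the heights of its iterates pulled back by `E`. -/
noncomputable def pot (f : E3 → E3) (M : ℝ) (x : E3) : ℝ :=
  sInf {t | 0 ≤ t ∧ ∃ k : ℕ, f^[k] x 2 + shift M ≤ E^[k] t}

theorem dom_mono (hf : BeamMap f a m M α C) {x : E3} (hx : x ∈ high f M) {t : ℝ} {k n : ℕ}
    (hkn : k ≤ n) (h : f^[k] x 2 + shift M ≤ E^[k] t) : f^[n] x 2 + shift M ≤ E^[n] t := by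
  induction n, hkn using Nat.le_induction with
  | base => exact h
  | succ n _ ih =>
    rw [Function.iterate_succ_apply', Function.iterate_succ_apply']
    exact (hf.dom_step (hx n)).trans (E_strictMono.monotone ih)

theorem pot_le {x : E3} {t : ℝ} (ht : 0 ≤ t) {k : ℕ} (h : f^[k] x 2 + shift M ≤ E^[k] t) :
    pot f M x ≤ t :=
  csInf_le ⟨0, fun _ hs => hs.1⟩ ⟨ht, k, h⟩

theorem pot_set_nonempty {x : E3} (hx : x ∈ high f M) :
    {t | 0 ≤ t ∧ ∃ k : ℕ, f^[k] x 2 + shift M ≤ E^[k] t}.Nonempty :=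
  ⟨x 2 + shift M, (add_shift_pos (hx 0)).le, 0, le_rfl⟩

theorem pot_nonneg {x : E3} (hx : x ∈ high f M) : 0 ≤ pot f M x :=
  le_csInf (pot_set_nonempty hx) fun _ hs => hs.1

theorem exists_dom_of_pot_lt {x : E3} (hx : x ∈ high f M) {t : ℝ} (h : pot f M x < t) :
    ∃ k : ℕ, f^[k] x 2 + shift M < E^[k] t := by
  obtain ⟨t', ⟨-, k, hk⟩, ht'⟩ := exists_lt_of_csInf_lt (pot_set_nonempty hx) h
  exact ⟨k, hk.trans_lt (iterate_E_strictMono k ht')⟩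

/-- Upper comparison persists under iteration by `dom_mono`, so a larger lower comparison valid at
all late times contradicts it. -/
theorem le_pot (hf : BeamMap f a m M α C) {x : E3} (hx : x ∈ high f M) {t : ℝ} {k₀ : ℕ}
    (h : ∀ k ≥ k₀, E^[k] t ≤ f^[k] x 2 + shift M) : t ≤ pot f M x := by
  refine le_csInf (pot_set_nonempty hx) ?_
  rintro b ⟨-, k, hk⟩
  by_contra! hbt
  have h1 := hf.dom_mono hx (le_max_left k k₀) hk
  have h2 := h _ (le_max_right k k₀)
  exact lt_irrefl _ ((h2.trans h1).trans_lt (iterate_E_strictMono _ hbt))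

theorem eventually_dom (hf : BeamMap f a m M α C) {x : E3} (hx : x ∈ high f M) {t : ℝ}
    (h : pot f M x < t) : ∀ᶠ k in atTop, f^[k] x 2 + shift M ≤ E^[k] t := by
  obtain ⟨k, hk⟩ := exists_dom_of_pot_lt hx h
  filter_upwards [eventually_ge_atTop k] with n hn using hf.dom_mono hx hn hk.le

end Potential

/-! ### The order on points with a common itinerary -/

section Order

/-- The height difference from which on the order of two points on a hair persists. -/
noncomputable def gap (M : ℝ) : ℝ := shift M + 2

/-- The height from which on the order of two points on a hair persists. -/
noncomputable def bar (a M : ℝ) : ℝ := 4 * (gap M + 5 + a)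

/-- `x` is far above `y`. -/
def Above (a M : ℝ) (x y : E3) : Prop := y 2 + gap M ≤ x 2 ∧ bar a M ≤ x 2

/-- The images differ horizontally by at most 2 in each coordinate, and those of the lower point are
at most `exp (y 2) ≤ exp (x 2) / 8`. So most of the norm `exp (x 2)` of `f x + (0, 0, a)` is
vertical; this keeps `x` above and gives the lower counterpart of `dom_step`. -/
theorem above_step (hf : BeamMap f a m M α C) {x y : E3} (hfx : M < f x 2)
    (h0 : |f x 0 - f y 0| ≤ 2) (h1 : |f x 1 - f y 1| ≤ 2) (h : Above a M x y) :
    Above a M (f x) (f y) ∧ E (x 2 - 1) ≤ f x 2 - 1 ∧ Real.exp (x 2) / 2 ≤ f x 2 := by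
  obtain ⟨hg, hb⟩ := h
  have hgap : 3 ≤ gap M := by have := one_le_shift M; simp only [gap]; linarith
  have ha := hf.one_lt_a
  have hx := hf.exp_le x
  have hy := hf.apply_two_le y
  have hy0 := hf.abs_zero_le y
  have hy1 := hf.abs_one_le y
  have hx0 : |f x 0| ≤ Real.exp (y 2) + 2 := by
    have := abs_sub_abs_le_abs_sub (f x 0) (f y 0); linarith
  have hx1 : |f x 1| ≤ Real.exp (y 2) + 2 := by
    have := abs_sub_abs_le_abs_sub (f x 1) (f y 1); linarith
  rw [abs_of_pos (by linarith [hf.add_a_pos] : 0 < f x 2 + a)] at hx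
  have hX : bar a M + 1 ≤ Real.exp (x 2) := by linarith [Real.add_one_le_exp (x 2)]
  have hY : 8 * Real.exp (y 2) ≤ Real.exp (x 2) := by
    have e : Real.exp (x 2) = Real.exp (y 2) * Real.exp (x 2 - y 2) := by
      rw [← Real.exp_add]; congr 1; ring
    have h3 : Real.exp 3 ≤ Real.exp (x 2 - y 2) := Real.exp_le_exp.2 (by linarith)
    have h4 := Real.quadratic_le_exp_of_nonneg (by norm_num : (0:ℝ) ≤ 3)
    rw [e]
    nlinarith [Real.exp_pos (y 2)]
  have hE : Real.exp (x 2 - 1) ≤ Real.exp (x 2) / 2 := by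
    have e : Real.exp (x 2) = Real.exp (x 2 - 1) * Real.exp 1 := by
      rw [← Real.exp_add]; congr 1; ring
    have := Real.add_one_le_exp (1:ℝ)
    rw [e]
    nlinarith [Real.exp_pos (x 2 - 1)]
  have hbar : bar a M = 4 * (gap M + 5 + a) := rfl
  have hE2 : E (x 2 - 1) ≤ f x 2 - 1 := by simp only [E]; linarith
  refine ⟨⟨by linarith, ?_⟩, hE2, by linarith⟩
  have := le_E (x 2 - 1)
  linarith

theorem abs_sub_le_two_of_mem_T {r : ℤ × ℤ} {x y : E3} (hx : x ∈ T M r) (hy : y ∈ T M r) :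
    |x 0 - y 0| ≤ 2 ∧ |x 1 - y 1| ≤ 2 := by
  have h1 := abs_lt.1 hx.1
  have h2 := abs_lt.1 hx.2.1
  have h3 := abs_lt.1 hy.1
  have h4 := abs_lt.1 hy.2.1
  constructor <;> rw [abs_le] <;> constructor <;> linarith [h1.1, h1.2, h2.1, h2.2, h3.1, h3.2, h4.1, h4.2]

variable {s : ℕ → ℤ × ℤ}

theorem above_iterate (hf : BeamMap f a m M α C) {x y : E3} (hx : x ∈ itin f M s)
    (hy : y ∈ itin f M s) {k : ℕ} (h : Above a M (f^[k] x) (f^[k] y)) (j : ℕ) :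
    Above a M (f^[k + j] x) (f^[k + j] y) ∧ E^[j] (f^[k] x 2 - 1) ≤ f^[k + j] x 2 - 1 := by
  induction j with
  | zero => exact ⟨h, le_rfl⟩
  | succ j ih =>
    have hT := abs_sub_le_two_of_mem_T (hx (k + j + 1)) (hy (k + j + 1))
    have hM := (hx (k + j + 1)).2.2
    rw [← add_assoc]
    rw [Function.iterate_succ_apply'] at hT hM ⊢
    rw [Function.iterate_succ_apply'] at hT ⊢
    obtain ⟨h1, h2, -⟩ := hf.above_step hM hT.1 hT.2 ih.1
    refine ⟨h1, ?_⟩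
    rw [Function.iterate_succ_apply']
    exact (E_strictMono.monotone ih.2).trans h2

theorem le_pot_of_above (hf : BeamMap f a m M α C) {x y : E3} (hx : x ∈ itin f M s)
    (hy : y ∈ itin f M s) {k : ℕ} (h : Above a M (f^[k] x) (f^[k] y)) {t : ℝ}
    (ht : E^[k] t ≤ f^[k] x 2 - 1) : t ≤ pot f M x := by
  refine hf.le_pot (itin_subset_high s hx) (k₀ := k) fun n hn => ?_
  obtain ⟨j, rfl⟩ := Nat.exists_eq_add_of_le hn
  have h1 := (hf.above_iterate hx hy h j).2
  have h2 := (iterate_E_strictMono j).monotone ht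
  rw [← Function.iterate_add_apply, add_comm j k] at h2
  linarith [one_le_shift M]

theorem pot_lt_of_above (hf : BeamMap f a m M α C) {x y : E3} (hx : x ∈ itin f M s)
    (hy : y ∈ itin f M s) {k : ℕ} (h : Above a M (f^[k] x) (f^[k] y)) :
    pot f M y < pot f M x := by
  have hv := add_shift_pos (itin_subset_high s hy k)
  obtain ⟨t, ht, hEt⟩ := iterate_E_surj hv.le k
  -- The term 2 in `gap M` leaves room between the upper comparison for `y` (height plus `shift M`)
  -- and the lower one for `x` (height minus 1).
  have hlt : f^[k] y 2 + shift M < f^[k] x 2 - 1 := by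
    have := h.1
    simp only [gap] at this
    linarith
  obtain ⟨t', ht', hEt'⟩ := iterate_E_surj (hv.le.trans hlt.le) k
  have h1 : pot f M y ≤ t := pot_le ht hEt.ge
  have h2 : t < t' := (iterate_E_strictMono k).lt_iff_lt.1 (by rw [hEt, hEt']; exact hlt)
  exact h1.trans_lt (h2.trans_le (hf.le_pot_of_above hx hy h hEt'.le))

theorem dist_le_pow_mul (hf : BeamMap f a m M α C) (hs : ∀ k, s k ∈ S) {x y : E3}
    (hx : x ∈ itin f M s) (hy : y ∈ itin f M s) (k : ℕ) :
    dist x y ≤ α ^ k * dist (f^[k] x) (f^[k] y) := by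
  induction k with
  | zero => simp
  | succ k ih =>
    have h1 := (hx (k + 1)).2.2
    have h2 := (hy (k + 1)).2.2
    rw [Function.iterate_succ_apply'] at h1 h2
    have := hf.expand _ (hs k) _ (hx k) _ (hy k) h1 h2
    rw [Function.iterate_succ_apply', Function.iterate_succ_apply', pow_succ, mul_assoc]
    exact ih.trans (mul_le_mul_of_nonneg_left this (pow_nonneg hf.α_pos.le _))

/-- Expansion makes the distance grow exponentially, and points of one half-beam differ horizontally
by at most 2 in each coordinate, so the growth must be vertical. -/
theorem tendsto_height_diff (hf : BeamMap f a m M α C) (hs : ∀ k, s k ∈ S) {x y : E3}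
    (hx : x ∈ itin f M s) (hy : y ∈ itin f M s) (hxy : x ≠ y) :
    Tendsto (fun k => |f^[k] x 2 - f^[k] y 2|) atTop atTop := by
  have hd : 0 < dist x y := dist_pos.2 hxy
  have h : ∀ k, dist x y * α⁻¹ ^ k + (-4) ≤ |f^[k] x 2 - f^[k] y 2| := by
    intro k
    have h1 := hf.dist_le_pow_mul hs hx hy k
    have h2 := dist_le_sum (f^[k] x) (f^[k] y)
    have h3 := abs_sub_le_two_of_mem_T (hx k) (hy k)
    have h4 : dist x y * α⁻¹ ^ k ≤ dist (f^[k] x) (f^[k] y) := by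
      rw [inv_pow, ← div_eq_mul_inv, div_le_iff₀ (pow_pos hf.α_pos k)]
      linarith
    linarith [h3.1, h3.2]
  refine tendsto_atTop_mono h (tendsto_atTop_add_const_right _ _ ?_)
  exact (tendsto_pow_atTop_atTop_of_one_lt ((one_lt_inv₀ hf.α_pos).2 hf.α_lt)).const_mul_atTop hd

theorem exists_above_or (hf : BeamMap f a m M α C) (hs : ∀ k, s k ∈ S) {x y : E3}
    (hx : x ∈ itin f M s) (hy : y ∈ itin f M s) (hxy : x ≠ y) :
    ∃ k, Above a M (f^[k] x) (f^[k] y) ∨ Above a M (f^[k] y) (f^[k] x) := by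
  -- The lower point lies above `M`, so this difference also lifts the upper one to `bar a M`.
  obtain ⟨k, hk⟩ := ((hf.tendsto_height_diff hs hx hy hxy).eventually_ge_atTop
    (gap M + |bar a M - M|)).exists
  have h1 := (hx k).2.2
  have h2 := (hy k).2.2
  have h3 : 0 < gap M := by have := one_le_shift M; simp only [gap]; linarith
  have h4 := abs_nonneg (bar a M - M)
  have h5 := le_abs_self (bar a M - M)
  refine ⟨k, ?_⟩
  rcases le_abs.1 hk with h | h
  · left; constructor <;> linarith
  · right; constructor <;> linarith

theorem pot_injOn (hf : BeamMap f a m M α C) (hs : ∀ k, s k ∈ S) :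
    Set.InjOn (pot f M) (itin f M s) := by
  intro x hx y hy h
  by_contra hxy
  obtain ⟨k, hk | hk⟩ := hf.exists_above_or hs hx hy hxy
  · exact (hf.pot_lt_of_above hx hy hk).ne' h
  · exact (hf.pot_lt_of_above hy hx hk).ne h

theorem eventually_above_of_pot_lt (hf : BeamMap f a m M α C) (hs : ∀ k, s k ∈ S) {x y : E3}
    (hx : x ∈ itin f M s) (hy : y ∈ itin f M s) (h : pot f M y < pot f M x) :
    ∀ᶠ k in atTop, Above a M (f^[k] x) (f^[k] y) := by
  have hxy : x ≠ y := by rintro rfl; exact lt_irrefl _ h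
  obtain ⟨k, hk | hk⟩ := hf.exists_above_or hs hx hy hxy
  · filter_upwards [eventually_ge_atTop k] with n hn
    obtain ⟨j, rfl⟩ := Nat.exists_eq_add_of_le hn
    exact (hf.above_iterate hx hy hk j).1
  · exact absurd (hf.pot_lt_of_above hy hx hk) h.le.not_gt

theorem tendsto_height_sub (hf : BeamMap f a m M α C) (hs : ∀ k, s k ∈ S) {x y : E3}
    (hx : x ∈ itin f M s) (hy : y ∈ itin f M s) (h : pot f M y < pot f M x) :
    Tendsto (fun k => f^[k] x 2 - f^[k] y 2) atTop atTop := by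
  have hxy : x ≠ y := by rintro rfl; exact lt_irrefl _ h
  refine (hf.tendsto_height_diff hs hx hy hxy).congr' ?_
  filter_upwards [hf.eventually_above_of_pot_lt hs hx hy h] with k hk
  have h3 : 0 < gap M := by have := one_le_shift M; simp only [gap]; linarith
  exact abs_of_pos (by linarith [hk.1])

end Order

end BeamMap

end Zorich

/-! ### Itinerary sets are hairs -/

namespace Zorich

theorem continuous_apply_two : Continuous fun x : E3 => x 2 :=
  (EuclideanSpace.proj (2 : Fin 3) : E3 →L[ℝ] ℝ).continuous

theorem isClosed_beam (r : ℤ × ℤ) : IsClosed (Beam r) := by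
  have h : ∀ i : Fin 3, Continuous fun x : E3 => x i := fun i =>
    (EuclideanSpace.proj i : E3 →L[ℝ] ℝ).continuous
  exact (isClosed_le (((h 0).sub continuous_const).abs) continuous_const).inter
    (isClosed_le (((h 1).sub continuous_const).abs) continuous_const)

theorem norm_le_of_mem_beam {r : ℤ × ℤ} {x : E3} (hx : x ∈ Beam r) :
    ‖x‖ ≤ |2 * (r.1 : ℝ)| + |2 * (r.2 : ℝ)| + 2 + |x 2| := by
  have h0 := abs_sub_abs_le_abs_sub (x 0) (2 * (r.1 : ℝ))
  have h1 := abs_sub_abs_le_abs_sub (x 1) (2 * (r.2 : ℝ))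
  linarith [norm_le_sum x, hx.1, hx.2]

namespace BeamMap

variable {f : E3 → E3} {a m M α C : ℝ} {s : ℕ → ℤ × ℤ}

/-- If the next iterate has height at least `M > m`, the current point lies strictly inside some
beam and strictly above `M`; hence closed conditions already imply the open ones. This makes
itinerary sets closed and allows limits of orbits. -/
theorem mem_itin_of_closed (hf : BeamMap f a m M α C) {x : E3}
    (h : ∀ k, f^[k] x ∈ Beam (s k) ∧ M ≤ f^[k] x 2) : x ∈ itin f M s := by
  intro k
  have h1 := (h (k + 1)).2
  rw [Function.iterate_succ_apply'] at h1
  obtain ⟨r, hr, hx0, hx1⟩ := hf.mem_beam (f^[k] x) (hf.m_lt.trans_le h1)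
  have hM : M < f^[k] x 2 := by
    by_contra! hle
    linarith [hf.apply_two_le_m hle, hf.m_lt]
  have aux : ∀ (t : ℝ) (n q : ℤ), |t - 2 * n| < 1 → |t - 2 * q| ≤ 1 → n = q := by
    intro t n q h1 h2
    rw [abs_lt] at h1
    rw [abs_le] at h2
    have h3 : (n : ℝ) < q + 1 := by linarith [h1.1, h2.2]
    have h4 : (q : ℝ) < n + 1 := by linarith [h1.2, h2.1]
    have h3' : n < q + 1 := by exact_mod_cast h3
    have h4' : q < n + 1 := by exact_mod_cast h4
    omega
  have e1 := aux _ _ _ hx0 (h k).1.1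
  have e2 := aux _ _ _ hx1 (h k).1.2
  exact ⟨by rw [← e1]; exact hx0, by rw [← e2]; exact hx1, hM⟩

theorem isClosed_itin (hf : BeamMap f a m M α C) : IsClosed (itin f M s) := by
  have e : itin f M s = ⋂ k, f^[k] ⁻¹' (Beam (s k) ∩ {x | M ≤ x 2}) := by
    ext x
    simp only [Set.mem_iInter]
    refine ⟨fun hx k => ⟨⟨(hx k).1.le, (hx k).2.1.le⟩, (hx k).2.2.le⟩,
      fun hx => hf.mem_itin_of_closed hx⟩
  rw [e]
  exact isClosed_iInter fun k => ((isClosed_beam _).inter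
    (isClosed_le continuous_const continuous_apply_two)).preimage (hf.cont.iterate k)

/-- Upper semicontinuity is immediate, since the potential is an infimum over conditions that are
open once t is increased slightly. Lower semicontinuity is trivial at a minimum; elsewhere a fixed
slower point `y` of the same hair serves as comparison, being still far below every nearby point at
a suitable time. -/
theorem continuousOn_pot (hf : BeamMap f a m M α C) (hs : ∀ k, s k ∈ S) :
    ContinuousOn (pot f M) (itin f M s) := by
  intro x hx
  have hc : ∀ k, Continuous fun z => f^[k] z 2 := fun k =>
    continuous_apply_two.comp (hf.cont.iterate k)
  have hx' := itin_subset_high s hx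
  refine tendsto_order.2 ⟨fun t ht => ?_, fun t ht => ?_⟩
  · by_cases hmin : ∃ y ∈ itin f M s, pot f M y < pot f M x
    · obtain ⟨y, hy, hlt⟩ := hmin
      -- Two intermediate values are needed: `t₁` bounds the heights of `x` from below, and the
      -- divergence of `E^[k] t₁ - E^[k] t₂` absorbs all additive constants.
      obtain ⟨t₂, ht₂, ht₂'⟩ := exists_between (max_lt ht (lt_of_le_of_lt (pot_nonneg
        (itin_subset_high s hy)) hlt))
      obtain ⟨t₁, ht₁, ht₁'⟩ := exists_between ht₂'
      have ht20 : 0 ≤ t₂ := (le_max_right _ _).trans ht₂.le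
      have hnd : ∀ k, E^[k] t₁ < f^[k] x 2 + shift M := by
        intro k
        by_contra! h
        exact absurd (pot_le (ht20.trans ht₁.le) h) (not_le.2 ht₁')
      have h1 := hf.tendsto_height_sub hs hx hy hlt
      obtain ⟨k, hk1, hk2, hk3⟩ := ((h1.eventually_ge_atTop (gap M + 1)).and
        ((h1.eventually_ge_atTop (bar a M + 1 - M)).and
        ((tendsto_iterate_E_sub ht20 ht₁).eventually_ge_atTop (shift M + 2)))).exists
      have hvM := (hy k).2.2
      have hnear : ∀ᶠ z in 𝓝[itin f M s] x, f^[k] x 2 - 1 < f^[k] z 2 :=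
        ((hc k).continuousAt.eventually (lt_mem_nhds (by linarith))).filter_mono
          nhdsWithin_le_nhds
      filter_upwards [hnear, self_mem_nhdsWithin] with z hz hzs
      have habove : Above a M (f^[k] z) (f^[k] y) := ⟨by linarith, by linarith⟩
      refine lt_of_lt_of_le (lt_of_le_of_lt (le_max_left _ _) ht₂)
        (hf.le_pot_of_above hzs hy habove ?_)
      linarith [hnd k]
    · push Not at hmin
      filter_upwards [self_mem_nhdsWithin] with z hz using ht.trans_le (hmin z hz)
  · obtain ⟨t', ht', ht't⟩ := exists_between ht
    obtain ⟨k, hk⟩ := exists_dom_of_pot_lt hx' ht'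
    have : ∀ᶠ z in 𝓝 x, f^[k] z 2 + shift M < E^[k] t' :=
      ((hc k).add continuous_const).continuousAt.eventually (gt_mem_nhds hk)
    filter_upwards [this.filter_mono nhdsWithin_le_nhds] with z hz
    exact (pot_le ((pot_nonneg hx').trans ht'.le) hz.le).trans_lt ht't

theorem isBounded_pot_le (hf : BeamMap f a m M α C) (t : ℝ) :
    Bornology.IsBounded {x | x ∈ itin f M s ∧ pot f M x ≤ t} := by
  rcases (itin f M s).eq_empty_or_nonempty with h | ⟨y, hy⟩
  · simp [h]
  rw [isBounded_iff_forall_norm_le]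
  refine ⟨|2 * ((s 0).1 : ℝ)| + |2 * ((s 0).2 : ℝ)| + 2 +
    max |M| |max (max (y 2 + gap M) (bar a M)) (t + 1)|, fun x hx => ?_⟩
  have hxT : x ∈ T M (s 0) := hx.1 0
  refine (norm_le_of_mem_beam ⟨hxT.1.le, hxT.2.1.le⟩).trans ?_
  gcongr
  have hle : x 2 ≤ max (max (y 2 + gap M) (bar a M)) (t + 1) := by
    by_contra! h
    rw [max_lt_iff, max_lt_iff] at h
    have h1 := hf.le_pot_of_above (k := 0) (t := x 2 - 1) hx.1 hy ⟨h.1.1.le, h.1.2.le⟩ le_rfl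
    linarith [hx.2, h.2]
  rw [abs_le]
  constructor
  · have h1 := hxT.2.2
    have h2 := neg_abs_le M
    have h3 := le_max_left |M| |max (max (y 2 + gap M) (bar a M)) (t + 1)|
    linarith
  · exact hle.trans ((le_abs_self _).trans (le_max_right _ _))

theorem exists_itin_iterate_eq (hf : BeamMap f a m M α C) (hs : ∀ k, s k ∈ S) (k : ℕ) {y : E3}
    (hy : y ∈ itin f M fun n => s (n + k)) : ∃ x ∈ itin f M s, f^[k] x = y := by
  induction k generalizing y with
  | zero => exact ⟨y, hy, rfl⟩
  | succ k ih =>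
    obtain ⟨x, hx, hfx⟩ := hf.surj (s k) (hs k) y (hy 0).2.2
    have hx' : x ∈ itin f M fun n => s (n + k) := by
      intro n
      cases n with
      | zero => simpa using hx
      | succ n =>
        rw [Function.iterate_succ_apply, hfx]
        have := hy n
        simpa [add_assoc, add_comm, add_left_comm] using this
    obtain ⟨z, hz, hfz⟩ := ih hx'
    exact ⟨z, hz, by rw [Function.iterate_succ_apply', hfz, hfx]⟩

/-- Backward stability: the norm of `f x + (0, 0, a)` is `exp u` up to a factor less than `exp 1`,
because the horizontal part is small against `exp u`. Taking logarithms, an error of one in the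
image gives again an error of at most one. -/
theorem abs_sub_height_le (hf : BeamMap f a m M α C) {x : E3} {r : ℤ × ℤ} {u u' : ℝ}
    (hr1 : |2 * (r.1 : ℝ)| ≤ E u' + 2) (hr2 : |2 * (r.2 : ℝ)| ≤ E u' + 2) (hu' : u' ≤ u - 2)
    (hu : 4 + a ≤ u) (hfx : f x ∈ Beam r) (h2 : |f x 2 - E u| ≤ 1) : |x 2 - u| ≤ 1 := by
  have ha := hf.one_lt_a
  rw [abs_le] at h2
  have hx := hf.exp_le x
  have hxl := hf.apply_two_le x
  have h0 : |f x 0| ≤ E u' + 3 := by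
    have := abs_sub_abs_le_abs_sub (f x 0) (2 * (r.1 : ℝ)); linarith [hfx.1]
  have h1 : |f x 1| ≤ E u' + 3 := by
    have := abs_sub_abs_le_abs_sub (f x 1) (2 * (r.2 : ℝ)); linarith [hfx.2]
  have hU := Real.add_one_le_exp u
  simp only [E] at *
  rw [abs_of_pos (by linarith : 0 < f x 2 + a)] at hx
  have e1 : Real.exp u = Real.exp (u - 1) * Real.exp 1 := by
    rw [← Real.exp_add]; congr 1; ring
  have e2 : Real.exp (u + 1) = Real.exp u * Real.exp 1 := Real.exp_add _ _
  have e3 : Real.exp u = Real.exp (u - 2) * Real.exp 2 := by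
    rw [← Real.exp_add]; congr 1; ring
  have q1 := Real.quadratic_le_exp_of_nonneg (by norm_num : (0:ℝ) ≤ 1)
  have q2 := Real.quadratic_le_exp_of_nonneg (by norm_num : (0:ℝ) ≤ 2)
  have hu'' : Real.exp u' ≤ Real.exp (u - 2) := Real.exp_le_exp.2 hu'
  have p1 := Real.exp_pos (u - 1)
  have p2 := Real.exp_pos (u - 2)
  rw [abs_le]
  constructor
  · have : u - 1 ≤ x 2 := Real.exp_le_exp.1 (by nlinarith)
    linarith
  · have : x 2 ≤ u + 1 := Real.exp_le_exp.1 (by nlinarith)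
    linarith

/-- An orbit is constructed whose heights stay within 1 of `E^[k] t` from some time on. Finite orbit
segments are built backwards through the inverse branches, the error being controlled by
`abs_sub_height_le`; compactness gives an infinite one, which is pulled back to time zero. -/
theorem exists_pot_eq (hf : BeamMap f a m M α C) (hs : ∀ k, s k ∈ S) {t' t : ℝ} (ht' : 0 ≤ t')
    (htt : t' < t)
    (hB : ∀ᶠ k in atTop, |2 * ((s k).1 : ℝ)| ≤ E^[k] t' + 2 ∧ |2 * ((s k).2 : ℝ)| ≤ E^[k] t' + 2) :
    ∃ x ∈ itin f M s, pot f M x = t := by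
  have ht : 0 < t := ht'.trans_lt htt
  obtain ⟨N, hN⟩ := eventually_atTop.1 (hB.and
    (((tendsto_iterate_E ht).eventually_ge_atTop (4 + a)).and
    (((tendsto_iterate_E ht).eventually_gt_atTop (M + 1)).and
    ((tendsto_iterate_E_sub ht' htt).eventually_ge_atTop 2))))
  set A : ℕ → Set E3 := fun k => {x | x ∈ Beam (s k) ∧ |x 2 - E^[k] t| ≤ 1} with hA
  have hclosed : ∀ k, IsClosed (A k) := fun k => (isClosed_beam _).inter
    (isClosed_le ((continuous_apply_two.sub continuous_const).abs) continuous_const)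
  have hcompact : IsCompact (A N) := by
    refine Metric.isCompact_of_isClosed_isBounded (hclosed N) ?_
    rw [isBounded_iff_forall_norm_le]
    refine ⟨|2 * ((s N).1 : ℝ)| + |2 * ((s N).2 : ℝ)| + 2 + (|E^[N] t| + 1), fun x hx => ?_⟩
    refine (norm_le_of_mem_beam hx.1).trans ?_
    have := abs_sub_abs_le_abs_sub (x 2) (E^[N] t)
    linarith [hx.2]
  have hAM : ∀ k ≥ N, ∀ x ∈ A k, M < x 2 := by
    intro k hk x hx
    have := (abs_le.1 hx.2).1
    linarith [(hN k hk).2.2.1]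
  have hne : ∀ n k, N ≤ k → ∃ x, ∀ j ≤ n, f^[j] x ∈ A (k + j) := by
    intro n
    induction n with
    | zero =>
      intro k hk
      refine ⟨!₂[2 * ((s k).1 : ℝ), 2 * ((s k).2 : ℝ), E^[k] t], fun j hj => ?_⟩
      obtain rfl : j = 0 := by omega
      simp [hA, Beam]
    | succ n ih =>
      intro k hk
      obtain ⟨y, hy⟩ := ih (k + 1) (by omega)
      have hy0 : y ∈ A (k + 1) := hy 0 (by omega)
      obtain ⟨x, hx, hfx⟩ := hf.surj (s k) (hs k) y (hAM _ (by omega) _ hy0)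
      refine ⟨x, fun j hj => ?_⟩
      cases j with
      | zero =>
        refine ⟨⟨hx.1.le, hx.2.1.le⟩, ?_⟩
        change |x 2 - E^[k] t| ≤ 1
        have hk1 := (hN (k + 1) (by omega)).1
        have hk0 := hN k hk
        have h2 := hy0.2
        rw [← hfx] at hy0 h2
        simp only [Function.iterate_succ_apply'] at hk1 h2
        exact hf.abs_sub_height_le hk1.1 hk1.2 (by linarith [hk0.2.2.2]) hk0.2.1 hy0.1 h2
      | succ j =>
        rw [Function.iterate_succ_apply, hfx]
        have := hy j (by omega)
        rwa [show k + (j + 1) = k + 1 + j by ring]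
  set X : ℕ → Set E3 := fun n => {x | ∀ j ≤ n, f^[j] x ∈ A (N + j)} with hX
  have hXcl : ∀ n, IsClosed (X n) := by
    intro n
    have : X n = ⋂ j, ⋂ (_ : j ≤ n), f^[j] ⁻¹' A (N + j) := by ext; simp [hX]
    rw [this]
    exact isClosed_iInter fun j => isClosed_iInter fun _ => (hclosed _).preimage (hf.cont.iterate j)
  obtain ⟨y, hy⟩ := IsCompact.nonempty_iInter_of_sequence_nonempty_isCompact_isClosed X
    (fun n x hx j hj => hx j (by omega)) (fun n => hne n N le_rfl)
    (hcompact.of_isClosed_subset (hXcl 0) fun x hx => hx 0 le_rfl) hXcl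
  have hyA : ∀ j, f^[j] y ∈ A (N + j) := fun j => Set.mem_iInter.1 hy j j le_rfl
  have hyit : y ∈ itin f M fun n => s (n + N) := by
    refine hf.mem_itin_of_closed fun k => ?_
    have h1 := hyA k
    refine ⟨?_, (hAM _ (by omega) _ h1).le⟩
    rw [add_comm k N]; exact h1.1
  obtain ⟨x, hx, hfx⟩ := hf.exists_itin_iterate_eq hs N hyit
  have hxA : ∀ k ≥ N, |f^[k] x 2 - E^[k] t| ≤ 1 := by
    intro k hk
    obtain ⟨j, rfl⟩ := Nat.exists_eq_add_of_le hk
    rw [add_comm N j, Function.iterate_add_apply f, hfx, add_comm j N]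
    exact (hyA j).2
  have hxh := itin_subset_high s hx
  refine ⟨x, hx, le_antisymm ?_ ?_⟩
  · refine le_of_forall_gt_imp_ge_of_dense fun t₁ ht₁ => ?_
    obtain ⟨k, hk, hkN⟩ := (((tendsto_iterate_E_sub ht.le ht₁).eventually_ge_atTop
      (shift M + 1)).and (eventually_ge_atTop N)).exists
    refine pot_le (ht.le.trans ht₁.le) (k := k) ?_
    linarith [(abs_le.1 (hxA k hkN)).2]
  · refine hf.le_pot hxh (k₀ := N) fun k hk => ?_
    linarith [(abs_le.1 (hxA k hk)).1, one_le_shift M]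

theorem abs_index_le (hf : BeamMap f a m M α C) {x : E3} (hx : x ∈ itin f M s) (k : ℕ) :
    |2 * ((s (k + 1)).1 : ℝ)| ≤ Real.exp (f^[k] x 2) + 1 ∧
    |2 * ((s (k + 1)).2 : ℝ)| ≤ Real.exp (f^[k] x 2) + 1 := by
  have h := hx (k + 1)
  rw [Function.iterate_succ_apply'] at h
  have h0 := hf.abs_zero_le (f^[k] x)
  have h1 := hf.abs_one_le (f^[k] x)
  have h2 := abs_sub_abs_le_abs_sub (2 * ((s (k + 1)).1 : ℝ)) (f (f^[k] x) 0)
  have h3 := abs_sub_abs_le_abs_sub (2 * ((s (k + 1)).2 : ℝ)) (f (f^[k] x) 1)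
  rw [abs_sub_comm] at h2 h3
  constructor <;> linarith [h.1, h.2.1]

/-- The image of a point of height u lies within horizontal distance `exp u` of the axis, so an
itinerary cannot grow faster than the potential of a point following it. This yields both
admissibility and the input of `exists_pot_eq`. -/
theorem eventually_abs_index_le (hf : BeamMap f a m M α C) {x : E3} (hx : x ∈ itin f M s) {t : ℝ}
    (ht : pot f M x < t) : ∀ᶠ k in atTop,
      |2 * ((s k).1 : ℝ)| ≤ E^[k] t + 2 ∧ |2 * ((s k).2 : ℝ)| ≤ E^[k] t + 2 := by
  obtain ⟨N, hN⟩ := eventually_atTop.1 (hf.eventually_dom (itin_subset_high s hx) ht)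
  refine eventually_atTop.2 ⟨N + 1, fun n hn => ?_⟩
  obtain ⟨k, rfl⟩ := Nat.exists_eq_add_of_le' (Nat.one_le_of_lt hn)
  have h1 := hf.abs_index_le hx k
  have h2 := hN k (by omega)
  have h3 : Real.exp (f^[k] x 2) ≤ Real.exp (E^[k] t) :=
    Real.exp_le_exp.2 (by linarith [one_le_shift M])
  rw [Function.iterate_succ_apply']
  simp only [E] at *
  constructor <;> linarith [h1.1, h1.2]

theorem itin_nonempty (hf : BeamMap f a m M α C) (hs : Admissible s) :
    (itin f M s).Nonempty := by
  obtain ⟨hS, t, ht, B, hB⟩ := hs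
  rw [eventually_map] at hB
  have h := eventually_mul_iterate_E_le ht.le (lt_add_one t) (2 * B)
  obtain ⟨x, hx, -⟩ := hf.exists_pot_eq hS (t' := t + 1) (t := t + 2) (by linarith) (by linarith) (by
    filter_upwards [hB, h] with k hk1 hk2
    have hpos : 0 < E^[k] t := ht.trans_le (le_iterate_E t k)
    rw [div_le_iff₀ hpos] at hk1
    have h1 : |((s k).1 : ℝ)| ≤ √(((s k).1 : ℝ) ^ 2 + ((s k).2 : ℝ) ^ 2) :=
      Real.abs_le_sqrt (by nlinarith [sq_nonneg ((s k).2 : ℝ)])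
    have h2 : |((s k).2 : ℝ)| ≤ √(((s k).1 : ℝ) ^ 2 + ((s k).2 : ℝ) ^ 2) :=
      Real.abs_le_sqrt (by nlinarith [sq_nonneg ((s k).1 : ℝ)])
    rw [abs_mul, abs_mul, abs_two]
    constructor <;> linarith)
  exact ⟨x, hx⟩

theorem admissible_of_mem_itin (hf : BeamMap f a m M α C) (hs : ∀ k, s k ∈ S) {x : E3}
    (hx : x ∈ itin f M s) : Admissible s := by
  have h0 := pot_nonneg (itin_subset_high s hx)
  refine ⟨hs, pot f M x + 2, by linarith, 6, ?_⟩
  rw [eventually_map]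
  filter_upwards [hf.eventually_abs_index_le hx (t := pot f M x + 2) (by linarith)] with k hk
  have h2 := le_iterate_E (pot f M x + 2) k
  have hpos : 0 < E^[k] (pot f M x + 2) := by linarith
  rw [div_le_iff₀ hpos]
  rw [abs_mul, abs_mul, abs_two] at hk
  refine Real.sqrt_le_iff.2 ⟨by positivity, ?_⟩
  rw [← sq_abs ((s k).1 : ℝ), ← sq_abs ((s k).2 : ℝ)]
  nlinarith [hk.1, hk.2, abs_nonneg ((s k).1 : ℝ), abs_nonneg ((s k).2 : ℝ)]

theorem mem_high_iff (hf : BeamMap f a m M α C) {x : E3} :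
    x ∈ high f M ↔ ∃ s, Admissible s ∧ x ∈ itin f M s := by
  constructor
  · intro hx
    have : ∀ k, ∃ r ∈ S, f^[k] x ∈ T M r := by
      intro k
      have h1 := hx (k + 1)
      rw [Function.iterate_succ_apply'] at h1
      obtain ⟨r, hr, h2, h3⟩ := hf.mem_beam _ (hf.m_lt.trans h1)
      exact ⟨r, hr, h2, h3, hx k⟩
    choose s hs hT using this
    exact ⟨s, hf.admissible_of_mem_itin hs hT, hT⟩
  · rintro ⟨s, -, hx⟩
    exact itin_subset_high s hx

theorem disjoint_itin {s' : ℕ → ℤ × ℤ} (h : s ≠ s') : Disjoint (itin f M s) (itin f M s') := by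
  rw [Set.disjoint_left]
  intro x hx hx'
  apply h
  funext k
  have aux : ∀ (t : ℝ) (n q : ℤ), |t - 2 * n| < 1 → |t - 2 * q| < 1 → n = q := by
    intro t n q h1 h2
    rw [abs_lt] at h1 h2
    have h3 : (n : ℝ) < q + 1 := by linarith [h1.1, h2.2]
    have h4 : (q : ℝ) < n + 1 := by linarith [h1.2, h2.1]
    have h3' : n < q + 1 := by exact_mod_cast h3
    have h4' : q < n + 1 := by exact_mod_cast h4
    omega
  exact Prod.ext (aux _ _ _ (hx k).1 (hx' k).1) (aux _ _ _ (hx k).2.1 (hx' k).2.1)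

/-- The homeomorphism between a closed half-line and `[0, ∞)`. -/
noncomputable def iciHomeomorph (t₀ : ℝ) : Set.Ici t₀ ≃ₜ ℝ≥0 where
  toFun t := ⟨t - t₀, sub_nonneg.2 t.2⟩
  invFun u := ⟨u + t₀, by simp⟩
  left_inv t := Subtype.ext (sub_add_cancel _ _)
  right_inv u := NNReal.eq (add_sub_cancel_right _ _)
  continuous_toFun := by fun_prop
  continuous_invFun := by fun_prop

theorem exists_hairParam (hf : BeamMap f a m M α C) (hs : Admissible s) :
    ∃ γ : ℝ≥0 ≃ₜ itin f M s, IsHairParam (itin f M s) γ ∧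
      ∀ t, pot f M (γ t) = t + pot f M (γ 0) := by
  set φ : itin f M s → ℝ := fun x => pot f M x with hφ
  have hcont : ContinuousOn (pot f M) (itin f M s) := hf.continuousOn_pot hs.1
  have hφc : Continuous φ := continuousOn_iff_continuous_domRestrict.1 hcont
  -- Continuity, injectivity and properness make the potential a closed embedding into the line.
  have hproper : IsProperMap φ := by
    rw [isProperMap_iff_isCompact_preimage]
    refine ⟨hφc, fun K hK => ?_⟩
    rw [Subtype.isCompact_iff]
    have e : Subtype.val '' (φ ⁻¹' K) = itin f M s ∩ pot f M ⁻¹' K := by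
      ext x; simp [hφ, and_comm]
    rw [e]
    refine Metric.isCompact_of_isClosed_isBounded
      (hcont.preimage_isClosed_of_isClosed hf.isClosed_itin hK.isClosed) ?_
    obtain ⟨B, hB⟩ := hK.bddAbove
    exact (hf.isBounded_pot_le B).subset fun x hx => ⟨hx.1, hB hx.2⟩
  have hinj : Function.Injective φ := fun x y h => Subtype.ext (hf.pot_injOn hs.1 x.2 y.2 h)
  have hemb := Topology.IsClosedEmbedding.of_continuous_injective_isClosedMap hφc hinj
    hproper.isClosedMap
  obtain ⟨x₀, hx₀⟩ := hf.itin_nonempty hs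
  have hbdd : BddBelow (Set.range φ) := ⟨0, by
    rintro _ ⟨x, rfl⟩; exact pot_nonneg (itin_subset_high s x.2)⟩
  have hmem : sInf (Set.range φ) ∈ Set.range φ :=
    hemb.isClosed_range.csInf_mem ⟨_, ⟨⟨x₀, hx₀⟩, rfl⟩⟩ hbdd
  set t₀ := sInf (Set.range φ)
  -- Above the minimum there is no gap: the minimal point bounds the growth of the itinerary by any
  -- `t'` above its potential, and then every `t > t'` is attained.
  have hrange : Set.range φ = Set.Ici t₀ := by
    refine Set.Subset.antisymm (fun t ht => csInf_le hbdd ht) fun t ht => ?_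
    rcases (show t₀ ≤ t from ht).eq_or_lt with h | h
    · rwa [← h]
    · obtain ⟨x, hx⟩ := hmem
      obtain ⟨t', h1, h2⟩ := exists_between h
      have h3 : pot f M x < t' := by rw [← hx] at h1; exact h1
      obtain ⟨z, hz, hzt⟩ := hf.exists_pot_eq hs.1
        ((pot_nonneg (itin_subset_high s x.2)).trans h3.le) h2
        (hf.eventually_abs_index_le x.2 h3)
      exact ⟨⟨z, hz⟩, hzt⟩
  set ψ : itin f M s ≃ₜ ℝ≥0 :=
    (hemb.isEmbedding.toHomeomorph.trans (Homeomorph.setCongr hrange)).trans (iciHomeomorph t₀)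
  have hψ : ∀ x : itin f M s, (ψ x : ℝ) = pot f M x - t₀ := fun x => rfl
  have hval : ∀ t : ℝ≥0, pot f M (ψ.symm t) = t + t₀ := fun t => by
    have := hψ (ψ.symm t)
    rw [Homeomorph.apply_symm_apply] at this
    linarith
  refine ⟨ψ.symm, ?_, fun t => by rw [hval, hval]; simp⟩
  have hlow : ∀ t : ℝ≥0, (t : ℝ) + (t₀ - shift M) ≤ ‖(ψ.symm t : E3)‖ := by
    intro t
    have hx := itin_subset_high s (ψ.symm t).2
    have h1 : pot f M (ψ.symm t) ≤ (ψ.symm t : E3) 2 + shift M :=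
      pot_le (add_shift_pos (hx 0)).le (k := 0) le_rfl
    have h2 := (le_abs_self _).trans (abs_apply_le (ψ.symm t : E3) 2)
    rw [hval] at h1
    linarith
  refine tendsto_atTop_mono hlow (tendsto_atTop_add_const_right _ _ ?_)
  exact NNReal.tendsto_coe_atTop.2 tendsto_id

/-- A homeomorphism of `[0, ∞)` onto itself fixes `0`. -/
theorem homeomorph_nnreal_zero (e : ℝ≥0 ≃ₜ ℝ≥0) : e 0 = 0 := by
  rcases e.continuous.strictMono_of_inj e.injective with h | h
  · obtain ⟨t, ht⟩ := e.surjective 0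
    have h1 := h.monotone (zero_le : 0 ≤ t)
    rw [ht] at h1
    exact le_antisymm h1 zero_le
  · exfalso
    obtain ⟨t, ht⟩ := e.surjective (e 0 + 1)
    have := h.antitone (zero_le : 0 ≤ t)
    rw [ht] at this
    exact absurd this (by simp)

/-- The endpoint does not depend on the parametrisation, since two parametrisations differ by a
self-homeomorphism of the half-line. -/
theorem isEndpoint_iff {H : Set E3} {γ : ℝ≥0 ≃ₜ H} (hγ : IsHairParam H γ) {p : E3} :
    IsEndpoint H p ↔ p = γ 0 := by
  constructor
  · rintro ⟨γ', -, rfl⟩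
    have := homeomorph_nnreal_zero (γ'.trans γ.symm)
    simp only [Homeomorph.trans_apply] at this
    rw [← γ.apply_symm_apply (γ' 0), this]
  · rintro rfl
    exact ⟨γ, hγ, rfl⟩

end BeamMap

end Zorich

/-! ### Hairs without endpoints: dimension at most one -/

namespace Zorich

/-- The distance from `x` is a Lipschitz function whose image contains an interval. -/
theorem one_le_dimH_of_isPreconnected {X : Type*} [MetricSpace X] {A : Set X}
    (hA : IsPreconnected A) {x y : X} (hx : x ∈ A) (hy : y ∈ A) (hxy : x ≠ y) : 1 ≤ dimH A := by
  have h1 : Set.Icc 0 (dist x y) ⊆ dist x '' A := by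
    have := (hA.image (dist x) (by fun_prop)).ordConnected.out ⟨x, hx, dist_self x⟩ ⟨y, hy, rfl⟩
    exact this
  have h2 : dimH (Set.Icc 0 (dist x y)) = 1 := by
    rw [Real.dimH_of_nonempty_interior]
    · simp
    · rw [interior_Icc]; exact Set.nonempty_Ioo.2 (dist_pos.2 hxy)
  rw [← h2]
  exact (dimH_mono h1).trans ((LipschitzWith.dist_right x).dimH_image_le A)

theorem dimH_le_of_expanding {X Y : Type*} [MetricSpace X] [MetricSpace Y] {A : Set X} {B : Set Y}
    {f : X → Y} {K : ℝ≥0} (hmaps : Set.MapsTo f A B)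
    (h : ∀ x ∈ A, ∀ y ∈ A, dist x y ≤ K * dist (f x) (f y)) : dimH A ≤ dimH B := by
  have h1 : AntilipschitzWith K (A.domRestrict f) := AntilipschitzWith.of_le_mul_dist
    fun x y => h x x.2 y y.2
  have h2 := h1.le_dimH_image Set.univ
  rw [← (isometry_subtype_coe (s := A)).dimH_image, Set.image_univ, Subtype.range_coe] at h2
  refine h2.trans (dimH_mono ?_)
  rintro _ ⟨x, -, rfl⟩
  exact hmaps x.2

namespace BeamMap

variable {f : E3 → E3} {a m M α C : ℝ} {s : ℕ → ℤ × ℤ}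

/-- The points whose orbit stays above height `R` and close to the vertical axis. -/
def steep (f : E3 → E3) (M ε R : ℝ) : Set E3 :=
  {x | x ∈ high f M ∧ ∀ k, R ≤ f^[k] x 2 ∧ |f^[k + 1] x 0| ≤ Real.exp (ε * f^[k] x 2) ∧
    |f^[k + 1] x 1| ≤ Real.exp (ε * f^[k] x 2)}

/-- The part of a beam between the heights `j` and `j + 1`. -/
def cell (M : ℝ) (r : ℤ × ℤ) (j : ℕ) : Set E3 := {x | x ∈ T M r ∧ (j : ℝ) ≤ x 2 ∧ x 2 < j + 1}

theorem steep_apply {ε R : ℝ} {x : E3} (hx : x ∈ steep f M ε R) : f x ∈ steep f M ε R := by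
  refine ⟨high_apply hx.1 1, fun k => ?_⟩
  have := hx.2 (k + 1)
  simpa only [Function.iterate_succ_apply] using this

theorem exists_cell (hf : BeamMap f a m M α C) {ε R : ℝ} (hR : 0 ≤ R) {x : E3}
    (hx : x ∈ steep f M ε R) : ∃ r ∈ S, x ∈ cell M r ⌊x 2⌋₊ := by
  obtain ⟨r, hr, h1, h2⟩ := hf.mem_beam x (hf.m_lt.trans (hx.1 1))
  have h0 : 0 ≤ x 2 := hR.trans (hx.2 0).1
  exact ⟨r, hr, ⟨h1, h2, hx.1 0⟩, Nat.floor_le h0, Nat.lt_floor_add_one _⟩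

theorem content_cell_le {d : ℝ} (hd : 0 < d) (r : ℤ × ℤ) (j : ℕ) (G : Set E3) :
    content E3 d hd (G ∩ cell M r j) ≤ 5 ^ d := by
  refine (content_le_ediam hd _).trans (ENNReal.rpow_le_rpow ?_ hd.le)
  refine Metric.ediam_le fun x hx y hy => ?_
  have h1 := abs_sub_le_two_of_mem_T hx.2.1 hy.2.1
  have h2 : |x 2 - y 2| ≤ 1 := by
    rw [abs_le]; constructor <;> linarith [hx.2.2.1, hx.2.2.2, hy.2.2.1, hy.2.2.2]
  have h3 : dist x y ≤ 5 := (dist_le_sum x y).trans (by linarith)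
  rw [edist_dist]
  exact (ENNReal.ofReal_le_ofReal h3).trans (by simp)

/-- The indices of the cells that meet the image of a cell of height `j` in steep points. -/
noncomputable def children (ε : ℝ) (j : ℕ) : Finset ((ℤ × ℤ) × ℕ) :=
  (Finset.Icc (-⌊Real.exp (ε * (j + 1))⌋) ⌊Real.exp (ε * (j + 1))⌋ ×ˢ
    Finset.Icc (-⌊Real.exp (ε * (j + 1))⌋) ⌊Real.exp (ε * (j + 1))⌋) ×ˢ
    Finset.range (⌊Real.exp (j + 1)⌋₊ + 1)

theorem card_children_le {ε : ℝ} (hε : 0 ≤ ε) (j : ℕ) :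
    ((children ε j).card : ℝ) ≤ 18 * Real.exp ((1 + 2 * ε) * (j + 1)) := by
  have h1 : 1 ≤ Real.exp (ε * (j + 1)) := Real.one_le_exp (by positivity)
  have h2 : 1 ≤ Real.exp ((j : ℝ) + 1) := Real.one_le_exp (by positivity)
  have h3 : 0 ≤ ⌊Real.exp (ε * (j + 1))⌋ := Int.floor_nonneg.2 (by linarith)
  have h4 := Int.floor_le (Real.exp (ε * (j + 1)))
  have h5 := Nat.floor_le (by linarith : 0 ≤ Real.exp ((j : ℝ) + 1))
  rw [children, Finset.card_product, Finset.card_product, Finset.card_range, Int.card_Icc]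
  set n := ⌊Real.exp (ε * (j + 1))⌋
  have h6 : (((n + 1 - -n).toNat : ℕ) : ℝ) = 2 * n + 1 := by
    have : (((n + 1 - -n).toNat : ℕ) : ℤ) = 2 * n + 1 := by
      rw [Int.toNat_of_nonneg (by omega)]; ring
    exact_mod_cast this
  push_cast
  rw [h6]
  have h3' : (0 : ℝ) ≤ n := by exact_mod_cast h3
  have e : Real.exp ((1 + 2 * ε) * (j + 1)) =
      Real.exp (ε * (j + 1)) * Real.exp (ε * (j + 1)) * Real.exp (j + 1) := by
    rw [← Real.exp_add, ← Real.exp_add]; congr 1; ring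
  rw [e]
  calc (2 * (n : ℝ) + 1) * (2 * n + 1) * (⌊Real.exp ((j : ℝ) + 1)⌋₊ + 1)
      ≤ (3 * Real.exp (ε * (j + 1))) * (3 * Real.exp (ε * (j + 1))) * (2 * Real.exp (j + 1)) := by
        gcongr <;> linarith
    _ = _ := by ring

theorem exists_child (hf : BeamMap f a m M α C) {ε R : ℝ} (hε : 0 ≤ ε) (hR : 0 ≤ R) {x : E3}
    (hx : x ∈ steep f M ε R) {r : ℤ × ℤ} {j : ℕ} (hxr : x ∈ cell M r j) :
    ∃ q ∈ children ε j, q.1 ∈ S ∧ R < q.2 + 1 ∧ f x ∈ cell M q.1 q.2 := by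
  have hfx := steep_apply hx
  obtain ⟨r', hr', h⟩ := hf.exists_cell hR hfx
  refine ⟨(r', ⌊f x 2⌋₊), ?_, hr', ?_, h⟩
  · have h0 := (hx.2 0).2
    simp only [Function.iterate_zero, zero_add, Function.iterate_one, id] at h0
    have hexp : Real.exp (ε * x 2) ≤ Real.exp (ε * (j + 1)) :=
      Real.exp_le_exp.2 (mul_le_mul_of_nonneg_left hxr.2.2.le hε)
    have h1 : 1 ≤ Real.exp (ε * (j + 1)) := Real.one_le_exp (by positivity)
    have aux : ∀ (n : ℤ) (t : ℝ), |t - 2 * n| < 1 → |t| ≤ Real.exp (ε * x 2) →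
        n ∈ Finset.Icc (-⌊Real.exp (ε * (j + 1))⌋) ⌊Real.exp (ε * (j + 1))⌋ := by
      intro n t h2 h3
      rw [abs_lt] at h2
      rw [abs_le] at h3
      rw [Finset.mem_Icc, neg_le, Int.le_floor, Int.le_floor]
      push_cast
      constructor <;> linarith [h2.1, h2.2, h3.1, h3.2]
    refine Finset.mem_product.2 ⟨Finset.mem_product.2
      ⟨aux _ _ h.1.1 h0.1, aux _ _ h.1.2.1 h0.2⟩, ?_⟩
    rw [Finset.mem_range, Nat.lt_succ_iff]
    refine Nat.floor_le_floor ?_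
    have h4 := hf.apply_two_le x
    have h5 : Real.exp (x 2) ≤ Real.exp (j + 1) := Real.exp_le_exp.2 hxr.2.2.le
    linarith [hf.one_lt_a]
  · exact lt_of_le_of_lt ((hfx.2 0).1) h.2.2

open Classical in
-- A self-improving estimate: a bound on all high cells returns multiplied by the number of child
-- cells times the contraction factor of the inverse branch to the power `d`.
theorem content_steep_cell_le (hf : BeamMap f a m M α C) {d ε : ℝ} (hd : 0 < d) (hε : 0 ≤ ε)
    {N : ℕ} {B : ENNReal}
    (hB : ∀ r ∈ S, ∀ j ≥ N, content E3 d hd (steep f M ε N ∩ cell M r j) ≤ B)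
    {r : ℤ × ℤ} (hr : r ∈ S) (j : ℕ) :
    content E3 d hd (steep f M ε N ∩ cell M r j) ≤
      ENNReal.ofReal (18 * Real.exp ((1 + 2 * ε) * (j + 1)) * (C * Real.exp (-j)) ^ d) * B := by
  set G := steep f M ε N
  have hCp : 0 < C * Real.exp (-j) := mul_pos hf.C_pos (Real.exp_pos _)
  set I := (children ε j).filter fun q => q.1 ∈ S ∧ N ≤ q.2 with hI
  have hsub : G ∩ cell M r j ⊆ ⋃ q ∈ I, (cell M r j ∩ f ⁻¹' (G ∩ cell M q.1 q.2)) := by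
    rintro x ⟨hxG, hxr⟩
    obtain ⟨q, hq, hqS, hqN, hfx⟩ := hf.exists_child hε N.cast_nonneg hxG hxr
    refine Set.mem_biUnion (Finset.mem_filter.2 ⟨hq, hqS, ?_⟩) ⟨hxr, steep_apply hxG, hfx⟩
    exact Nat.lt_succ_iff.1 (by exact_mod_cast hqN)
  obtain ⟨K, hK⟩ : ∃ K : ℝ≥0, (K : ℝ) = C * Real.exp (-j) := ⟨⟨_, hCp.le⟩, rfl⟩
  have hKe : (K : ENNReal) = ENNReal.ofReal (C * Real.exp (-j)) := by
    rw [← hK, ENNReal.ofReal_coe_nnreal]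
  have hpiece : ∀ q ∈ I, content E3 d hd (cell M r j ∩ f ⁻¹' (G ∩ cell M q.1 q.2)) ≤
      ENNReal.ofReal ((C * Real.exp (-j)) ^ d) * B := by
    intro q hq
    obtain ⟨-, hqS, hqN⟩ := Finset.mem_filter.1 hq
    have h1 := content_le_of_expanding hd (A := cell M r j ∩ f ⁻¹' (G ∩ cell M q.1 q.2)) f
      (K := K) (by exact_mod_cast hK ▸ hCp) (by
        intro x hx y hy
        have := hf.lower r hr x hx.1.1 y hy.1.1 j hx.1.2.1 hy.1.2.1
        rw [edist_dist, edist_dist, hKe, ← ENNReal.ofReal_mul hCp.le]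
        exact ENNReal.ofReal_le_ofReal this)
    refine h1.trans ?_
    rw [hKe, ENNReal.ofReal_rpow_of_pos hCp]
    gcongr
    refine (measure_mono ?_).trans (hB q.1 hqS q.2 hqN)
    rintro _ ⟨x, hx, rfl⟩
    exact hx.2
  calc content E3 d hd (G ∩ cell M r j)
      ≤ ∑ q ∈ I, content E3 d hd (cell M r j ∩ f ⁻¹' (G ∩ cell M q.1 q.2)) :=
        (measure_mono hsub).trans (measure_biUnion_finset_le _ _)
    _ ≤ ∑ q ∈ I, ENNReal.ofReal ((C * Real.exp (-j)) ^ d) * B := Finset.sum_le_sum hpiece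
    _ = (I.card : ENNReal) * (ENNReal.ofReal ((C * Real.exp (-j)) ^ d) * B) := by
        rw [Finset.sum_const, nsmul_eq_mul]
    _ ≤ ENNReal.ofReal (18 * Real.exp ((1 + 2 * ε) * (j + 1))) *
        (ENNReal.ofReal ((C * Real.exp (-j)) ^ d) * B) := by
        gcongr
        rw [← ENNReal.ofReal_natCast]
        refine ENNReal.ofReal_le_ofReal (le_trans ?_ (card_children_le hε j))
        exact_mod_cast Finset.card_filter_le _ _
    _ = _ := by rw [← mul_assoc, ← ENNReal.ofReal_mul (by positivity)]

theorem exists_dimH_steep_le (hf : BeamMap f a m M α C) {d : ℝ≥0} (hd : 1 < d) :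
    ∃ ε > 0, ∃ N : ℕ, dimH (steep f M ε N) ≤ d := by
  have hd' : (1 : ℝ) < d := by exact_mod_cast hd
  have hd0 : (0 : ℝ) < d := by linarith
  -- Then `1 + 2 * ε - d = -(d - 1) / 2`, so the factor of the self-improving estimate decays with
  -- the height.
  set ε : ℝ := (d - 1) / 4 with hε
  have hε0 : 0 < ε := by simp only [hε]; linarith
  set A : ℝ := 18 * Real.exp (1 + 2 * ε) * C ^ (d : ℝ) with hA
  have hform : ∀ j : ℕ, 18 * Real.exp ((1 + 2 * ε) * (j + 1)) * (C * Real.exp (-j)) ^ (d : ℝ) =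
      A * Real.exp (-((d - 1) / 2 * j)) := by
    intro j
    rw [Real.mul_rpow hf.C_pos.le (Real.exp_pos _).le, ← Real.exp_mul, hA]
    have e : Real.exp ((1 + 2 * ε) * (j + 1)) * Real.exp (-j * d) =
        Real.exp (1 + 2 * ε) * Real.exp (-((d - 1) / 2 * j)) := by
      rw [← Real.exp_add, ← Real.exp_add]; congr 1; simp only [hε]; ring
    calc _ = 18 * (Real.exp ((1 + 2 * ε) * (j + 1)) * Real.exp (-j * d)) * C ^ (d : ℝ) := by ring
      _ = _ := by rw [e]; ring
  have hlim : Tendsto (fun j : ℕ => A * Real.exp (-((d - 1) / 2 * j))) atTop (𝓝 0) := by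
    have h1 : Tendsto (fun j : ℕ => ((d : ℝ) - 1) / 2 * j) atTop atTop :=
      tendsto_natCast_atTop_atTop.const_mul_atTop (by linarith)
    have := (Real.tendsto_exp_neg_atTop_nhds_zero.comp h1).const_mul A
    simpa using this
  obtain ⟨N, hN⟩ := eventually_atTop.1 (hlim.eventually_le_const (by norm_num : (0:ℝ) < 1 / 2))
  refine ⟨ε, hε0, N, ?_⟩
  set B : ENNReal := ⨆ (r ∈ S) (j ≥ N), content E3 d hd0 (steep f M ε N ∩ cell M r j)
  have hBtop : B ≠ ⊤ := by
    refine ne_top_of_le_ne_top (b := 5 ^ (d : ℝ)) (ENNReal.rpow_ne_top_of_nonneg hd0.le (by simp)) ?_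
    exact iSup₂_le fun r _ => iSup₂_le fun j _ => content_cell_le hd0 r j _
  have hle : ∀ r ∈ S, ∀ j ≥ N, content E3 d hd0 (steep f M ε N ∩ cell M r j) ≤ B :=
    fun r hr j hj => le_iSup₂_of_le r hr (le_iSup₂_of_le j hj le_rfl)
  -- B is finite because cells have bounded diameter, so this inequality forces B = 0.
  have hhalf : B ≤ 2⁻¹ * B := by
    refine iSup₂_le fun r hr => iSup₂_le fun j hj => ?_
    refine (hf.content_steep_cell_le hd0 hε0.le hle hr j).trans ?_
    gcongr
    rw [hform]
    refine (ENNReal.ofReal_le_ofReal (hN j hj)).trans (le_of_eq ?_)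
    rw [one_div, ENNReal.ofReal_inv_of_pos (by norm_num)]; simp
  have hzero : B = 0 := by
    by_contra h0
    have h1 : 2⁻¹ * B = B / 2 := by rw [mul_comm, div_eq_mul_inv]
    rw [h1] at hhalf
    exact absurd (ENNReal.half_lt_self h0 hBtop) hhalf.not_gt
  have hG : content E3 d hd0 (steep f M ε N) = 0 := by
    have hsub : steep f M ε N ⊆ ⋃ q : {q : (ℤ × ℤ) × ℕ // q.1 ∈ S ∧ N ≤ q.2},
        steep f M ε N ∩ cell M q.1.1 q.1.2 := by
      intro x hx
      obtain ⟨r, hr, hxr⟩ := hf.exists_cell N.cast_nonneg hx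
      have hle : N ≤ ⌊x 2⌋₊ := Nat.le_floor (hx.2 0).1
      exact Set.mem_iUnion.2 ⟨⟨(r, ⌊x 2⌋₊), hr, hle⟩, hx, hxr⟩
    refine measure_mono_null hsub (measure_iUnion_null fun q => ?_)
    exact le_antisymm (hzero ▸ hle q.1.1 q.2.1 q.1.2 q.2.2) bot_le
  refine dimH_le_of_hausdorffMeasure_ne_top ?_
  rw [hausdorffMeasure_eq_zero_of_content hd0 hG]
  simp

/-- The map expands on each of the countably many half-beams, so preimages do not gain dimension. -/
theorem dimH_preimage_iterate_le (hf : BeamMap f a m M α C) {A : Set E3} (k : ℕ) :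
    dimH {x | x ∈ high f M ∧ f^[k] x ∈ A} ≤ dimH A := by
  induction k with
  | zero => exact dimH_mono fun x hx => hx.2
  | succ k ih =>
    have hsub : {x | x ∈ high f M ∧ f^[k + 1] x ∈ A} ⊆ ⋃ r : {r // r ∈ S},
        {x | x ∈ T M r ∧ f x ∈ {x | x ∈ high f M ∧ f^[k] x ∈ A}} := by
      rintro x ⟨hx, hxA⟩
      obtain ⟨r, hr, h1, h2⟩ := hf.mem_beam x (hf.m_lt.trans (hx 1))
      exact Set.mem_iUnion.2 ⟨⟨r, hr⟩, ⟨h1, h2, hx 0⟩, high_apply hx 1, hxA⟩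
    refine (dimH_mono hsub).trans ?_
    rw [dimH_iUnion]
    refine iSup_le fun r => le_trans ?_ ih
    exact dimH_le_of_expanding (f := f) (K := ⟨α, hf.α_pos.le⟩) (fun x hx => hx.2)
      fun x hx y hy => hf.expand r r.2 x hx.1 y hy.1 (hx.2.1 0) (hy.2.1 0)

/-- The horizontal coordinates of `x` follow those of the slower point `y` up to 2 and so are
bounded through the exponential of the previous height of `y`. As the height difference diverges,
one further step makes the height of `y` at most `ε / 2` times that of `x`. -/
theorem eventually_mem_steep (hf : BeamMap f a m M α C) (hs : ∀ k, s k ∈ S) {x y : E3}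
    (hx : x ∈ itin f M s) (hy : y ∈ itin f M s) (h : pot f M y < pot f M x) {ε : ℝ} (hε : 0 < ε)
    (R : ℝ) : ∃ k, f^[k] x ∈ steep f M ε R := by
  have hdiff := hf.tendsto_height_sub hs hx hy h
  have hu : Tendsto (fun k => f^[k] x 2) atTop atTop := by
    refine tendsto_atTop_mono (f := fun k => (f^[k] x 2 - f^[k] y 2) + M) (fun k => ?_)
      (tendsto_atTop_add_const_right _ _ hdiff)
    linarith [(hy k).2.2]
  -- The value `Real.log (4 / ε)` gives the ratio `ε / 2` at the next time, since the height of `x`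
  -- becomes at least half its exponential; height at least `4 / ε` then absorbs the additive 2.
  obtain ⟨K, hK⟩ := eventually_atTop.1 ((hf.eventually_above_of_pot_lt hs hx hy h).and
    ((hdiff.eventually_ge_atTop (Real.log (4 / ε))).and
    ((hu.eventually_ge_atTop R).and (hu.eventually_ge_atTop (4 / ε)))))
  have hbound : ∀ k ≥ K + 1, Real.exp (f^[k] y 2) + 2 ≤ Real.exp (ε * f^[k] x 2) := by
    intro n hn
    obtain ⟨k, rfl⟩ := Nat.exists_eq_add_of_le' (Nat.one_le_of_lt hn)
    obtain ⟨h1, h2, h3, h4⟩ := hK k (by omega)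
    obtain ⟨-, -, -, h4'⟩ := hK (k + 1) (by omega)
    have hT := abs_sub_le_two_of_mem_T (hx (k + 1)) (hy (k + 1))
    have hM := (hx (k + 1)).2.2
    have hv := hf.apply_two_le (f^[k] y)
    rw [Function.iterate_succ_apply'] at hT hM h4' ⊢
    rw [Function.iterate_succ_apply'] at hT ⊢
    have h5 := (hf.above_step hM hT.1 hT.2 h1).2.2
    have h6 : 4 / ε * Real.exp (f^[k] y 2) ≤ Real.exp (f^[k] x 2) := by
      have e : Real.exp (f^[k] x 2) =
          Real.exp (f^[k] x 2 - f^[k] y 2) * Real.exp (f^[k] y 2) := by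
        rw [← Real.exp_add]; congr 1; ring
      rw [e]
      gcongr
      rw [← Real.exp_log (by positivity : 0 < 4 / ε)]
      exact Real.exp_le_exp.2 h2
    have h7 : 4 * Real.exp (f^[k] y 2) ≤ ε * Real.exp (f^[k] x 2) := by
      rw [div_mul_eq_mul_div, div_le_iff₀ hε] at h6
      linarith
    have h8 : 4 ≤ ε * f (f^[k] x) 2 := by
      rw [div_le_iff₀ hε] at h4'; linarith
    set u := ε * f (f^[k] x) 2 with hu
    have h9 : f (f^[k] y) 2 ≤ u / 2 := by
      have : ε * Real.exp (f^[k] x 2) / 2 ≤ u := by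
        simp only [hu]
        rw [mul_div_assoc]
        exact mul_le_mul_of_nonneg_left h5 hε.le
      linarith [hf.one_lt_a]
    have h10 : Real.exp (f (f^[k] y) 2) ≤ Real.exp (u / 2) := Real.exp_le_exp.2 h9
    have h11 : Real.exp u = Real.exp (u / 2) * Real.exp (u / 2) := by
      rw [← Real.exp_add]; congr 1; ring
    have h12 := Real.add_one_le_exp (u / 2)
    nlinarith
  refine ⟨K + 1, high_apply (itin_subset_high s hx) _, fun k => ?_⟩
  simp only [← Function.iterate_add_apply]
  have h1 := hbound (k + (K + 1)) (by omega)
  have hT := abs_sub_le_two_of_mem_T (hx (k + (K + 1) + 1)) (hy (k + (K + 1) + 1))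
  have hy0 := hf.abs_zero_le (f^[k + (K + 1)] y)
  have hy1 := hf.abs_one_le (f^[k + (K + 1)] y)
  rw [← Function.iterate_succ_apply' f] at hy0 hy1
  rw [show k + 1 + (K + 1) = k + (K + 1) + 1 by ring]
  refine ⟨(hK _ (by omega)).2.2.1, ?_, ?_⟩
  · have := abs_sub_abs_le_abs_sub (f^[k + (K + 1) + 1] x 0) (f^[k + (K + 1) + 1] y 0)
    linarith [hT.1]
  · have := abs_sub_abs_le_abs_sub (f^[k + (K + 1) + 1] x 1) (f^[k + (K + 1) + 1] y 1)
    linarith [hT.2]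

/-- The points of the hairs that are not endpoints have Hausdorff dimension at most one. -/
theorem dimH_nonminimal_le (hf : BeamMap f a m M α C) :
    dimH {x | ∃ s, Admissible s ∧ x ∈ itin f M s ∧ ∃ y ∈ itin f M s, pot f M y < pot f M x} ≤ 1 := by
  refine ENNReal.le_of_forall_pos_le_add fun δ hδ _ => ?_
  obtain ⟨ε, hε, N, hN⟩ := hf.exists_dimH_steep_le (d := 1 + δ) (by simpa using hδ)
  have hsub : {x | ∃ s, Admissible s ∧ x ∈ itin f M s ∧ ∃ y ∈ itin f M s, pot f M y < pot f M x} ⊆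
      ⋃ k : ℕ, {x | x ∈ high f M ∧ f^[k] x ∈ steep f M ε N} := by
    rintro x ⟨s, hs, hx, y, hy, h⟩
    obtain ⟨k, hk⟩ := hf.eventually_mem_steep hs.1 hx hy h hε N
    exact Set.mem_iUnion.2 ⟨k, itin_subset_high s hx, hk⟩
  refine (dimH_mono hsub).trans ?_
  rw [dimH_iUnion]
  refine iSup_le fun k => (hf.dimH_preimage_iterate_le k).trans (hN.trans ?_)
  simp

end BeamMap

end Zorich

namespace Zorich

/-! ### Lower bounds for content -/

section ContentLowerBounds

theorem exists_open_ediam_rpow_le {X : Type*} [MetricSpace X] {d : ℝ} (hd : 0 < d) (t : Set X)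
    {η : ENNReal} (hη : 0 < η) :
    ∃ U, IsOpen U ∧ t ⊆ U ∧ Metric.ediam U ^ d ≤ Metric.ediam t ^ d + η := by
  rcases eq_or_ne (Metric.ediam t) ⊤ with h | h
  · exact ⟨Set.univ, isOpen_univ, Set.subset_univ _, by rw [h, ENNReal.top_rpow_of_pos hd]; simp⟩
  have hlim : Tendsto (fun ε : ℝ≥0 => (Metric.ediam t + 2 * ε) ^ d) (𝓝[>] 0)
      (𝓝 (Metric.ediam t ^ d)) := by
    have h1 : Tendsto (fun ε : ℝ≥0 => Metric.ediam t + 2 * (ε : ENNReal)) (𝓝 0)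
        (𝓝 (Metric.ediam t + 2 * ((0 : ℝ≥0) : ENNReal))) := by
      refine tendsto_const_nhds.add (ENNReal.Tendsto.const_mul ?_ (Or.inr (by simp)))
      exact ENNReal.tendsto_coe.2 tendsto_id
    simp only [ENNReal.coe_zero, mul_zero, add_zero] at h1
    exact ((ENNReal.continuous_rpow_const.tendsto _).comp h1).mono_left nhdsWithin_le_nhds
  have hlt : Metric.ediam t ^ d < Metric.ediam t ^ d + η :=
    ENNReal.lt_add_right (ENNReal.rpow_ne_top_of_nonneg hd.le h) hη.ne'
  obtain ⟨ε, hε, hε0⟩ := ((hlim.eventually_lt_const hlt).and self_mem_nhdsWithin).exists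
  refine ⟨Metric.thickening ε t, Metric.isOpen_thickening,
    Metric.self_subset_thickening (by exact_mod_cast hε0) t, le_trans ?_ hε.le⟩
  exact ENNReal.rpow_le_rpow (Metric.ediam_thickening_le ε) hd.le

/-- Covering sets can be enlarged to open sets at arbitrarily small total cost, and an open cover of
the intersection already covers some `V n` by compactness. -/
theorem le_content_iInter {X : Type*} [MetricSpace X] {d : ℝ} (hd : 0 < d) {V : ℕ → Set X}
    (hV : Antitone V) (hc : ∀ n, IsCompact (V n)) {c : ENNReal}
    (h : ∀ n, c ≤ content X d hd (V n)) : c ≤ content X d hd (⋂ n, V n) := by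
  rw [content_apply]
  refine le_iInf₂ fun t ht => ?_
  refine ENNReal.le_of_forall_pos_le_add fun η hη _ => ?_
  obtain ⟨η', hη', hsum⟩ := ENNReal.exists_pos_sum_of_countable
    (ε := (η : ENNReal)) (by exact_mod_cast hη.ne') ℕ
  choose U hUo htU hUd using fun i => exists_open_ediam_rpow_le hd (t i)
    (η := (η' i : ENNReal)) (by exact_mod_cast hη' i)
  obtain ⟨n, hn⟩ := exists_subset_nhds_of_isCompact' (V := V) (U := ⋃ i, U i)
    hV.directed_ge hc (fun i => (hc i).isClosed) (fun x hx => by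
      refine (isOpen_iUnion hUo).mem_nhds ?_
      obtain ⟨i, hi⟩ := Set.mem_iUnion.1 (ht hx)
      exact Set.mem_iUnion.2 ⟨i, htU i hi⟩)
  calc c ≤ content X d hd (V n) := h n
    _ ≤ ∑' i, Metric.ediam (U i) ^ d := by
        rw [content_apply]; exact iInf₂_le U hn
    _ ≤ ∑' i, (Metric.ediam (t i) ^ d + η' i) := ENNReal.tsum_le_tsum hUd
    _ = (∑' i, Metric.ediam (t i) ^ d) + ∑' i, (η' i : ENNReal) := ENNReal.tsum_add
    _ ≤ _ := by gcongr

theorem content_image_le {X Y : Type*} [MetricSpace X] [MetricSpace Y] {d : ℝ} (hd : 0 < d)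
    {A : Set X} (f : X → Y) {K : ℝ≥0} (hK0 : 0 < K)
    (h : ∀ x ∈ A, ∀ y ∈ A, edist (f x) (f y) ≤ K * edist x y) :
    content Y d hd (f '' A) ≤ (K : ENNReal) ^ d * content X d hd A := by
  rcases A.eq_empty_or_nonempty with rfl | ⟨x₀, hx₀⟩
  · simp
  have : Nonempty X := ⟨x₀⟩
  set g := Function.invFunOn f A
  have hgA : ∀ y ∈ f '' A, g y ∈ A := fun y hy => Function.invFunOn_mem hy
  have hfg : ∀ y ∈ f '' A, f (g y) = y := fun y hy => Function.invFunOn_eq hy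
  refine (content_le_of_expanding hd g hK0 fun y hy z hz => ?_).trans ?_
  · conv_lhs => rw [← hfg y hy, ← hfg z hz]
    exact h _ (hgA y hy) _ (hgA z hz)
  · gcongr
    rintro _ ⟨y, hy, rfl⟩
    exact hgA y hy

theorem content_le_tsum_meeting {X : Type*} [MetricSpace X] {d : ℝ} (hd : 0 < d)
    {A : Set X} {t : ℕ → Set X} (ht : A ⊆ ⋃ i, t i) [DecidablePred fun i => (t i ∩ A).Nonempty] :
    content X d hd A ≤ ∑' i, if (t i ∩ A).Nonempty then Metric.ediam (t i) ^ d else 0 := by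
  rw [content_apply]
  refine (iInf₂_le (fun i => t i ∩ A) fun x hx => ?_).trans (ENNReal.tsum_le_tsum fun i => ?_)
  · obtain ⟨i, hi⟩ := Set.mem_iUnion.1 (ht hx)
    exact Set.mem_iUnion.2 ⟨i, hi, hx⟩
  · split_ifs with h
    · exact ENNReal.rpow_le_rpow (Metric.ediam_mono Set.inter_subset_left) hd.le
    · simp [Set.not_nonempty_iff_eq_empty.1 h, hd]

/-- A lower bound for the size of a cover of a set with many pieces, when a set of large diameter
meets few pieces and a set of small diameter meets at most one piece. -/
theorem card_le_mul_tsum {X ι : Type*} [MetricSpace X] {d : ℝ} (hd : 0 < d) {I : Finset ι}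
    {P : ι → Set X} {t : ℕ → Set X} (ht : ∀ q ∈ I, P q ⊆ ⋃ i, t i) {θ A : ENNReal}
    (hθ : 0 < θ) (hθ' : θ ≠ ⊤) (hP : ∀ q ∈ I, θ ≤ content X d hd (P q)) (large : Set ℕ)
    [∀ i, DecidablePred fun q => (t i ∩ P q).Nonempty]
    (hlarge : ∀ i ∈ large, ((I.filter fun q => (t i ∩ P q).Nonempty).card : ENNReal) ≤
      A * Metric.ediam (t i) ^ d)
    (hsmall : ∀ i ∉ large, (I.filter fun q => (t i ∩ P q).Nonempty).card ≤ 1) :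
    (I.card : ENNReal) ≤ (A + θ⁻¹) * ∑' i, Metric.ediam (t i) ^ d := by
  classical
  -- Double counting: every piece receives total weight at least 1, either from one large set
  -- meeting it or, if only small sets meet it, from its content bound `θ`.
  set w : ℕ → ENNReal := fun i => if i ∈ large then 1 else θ⁻¹ * Metric.ediam (t i) ^ d with hw
  have h1 : ∀ q ∈ I, 1 ≤ ∑' i, if (t i ∩ P q).Nonempty then w i else 0 := by
    intro q hq
    by_cases hex : ∃ i ∈ large, (t i ∩ P q).Nonempty
    · obtain ⟨i, hi, hne⟩ := hex
      refine le_trans ?_ (ENNReal.le_tsum i)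
      simp [hne, hw, hi]
    · push Not at hex
      calc (1 : ENNReal) = θ⁻¹ * θ := (ENNReal.inv_mul_cancel hθ.ne' hθ').symm
        _ ≤ θ⁻¹ * ∑' i, if (t i ∩ P q).Nonempty then Metric.ediam (t i) ^ d else 0 := by
          gcongr
          exact (hP q hq).trans (content_le_tsum_meeting hd (ht q hq))
        _ = ∑' i, θ⁻¹ * if (t i ∩ P q).Nonempty then Metric.ediam (t i) ^ d else 0 :=
          ENNReal.tsum_mul_left.symm
        _ ≤ _ := by
          refine ENNReal.tsum_le_tsum fun i => ?_
          split_ifs with h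
          · have hi : i ∉ large := fun hi => by
              have := hex i hi
              rw [this] at h; exact Set.not_nonempty_empty h
            simp [hw, hi]
          · simp
  have h2 : ∀ i, (∑ q ∈ I, if (t i ∩ P q).Nonempty then w i else 0) ≤
      (A + θ⁻¹) * Metric.ediam (t i) ^ d := by
    intro i
    rw [← Finset.sum_filter, Finset.sum_const, nsmul_eq_mul, add_mul]
    by_cases hi : i ∈ large
    · simp only [hw, hi, if_true, mul_one]
      exact (hlarge i hi).trans le_self_add
    · simp only [hw, hi, if_false]
      refine le_trans ?_ le_add_self
      have := hsmall i hi
      calc _ ≤ (1 : ENNReal) * (θ⁻¹ * Metric.ediam (t i) ^ d) := by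
            gcongr; exact_mod_cast this
        _ = _ := one_mul _
  calc (I.card : ENNReal) = ∑ q ∈ I, 1 := by simp
    _ ≤ ∑ q ∈ I, ∑' i, if (t i ∩ P q).Nonempty then w i else 0 := Finset.sum_le_sum h1
    _ = ∑' i, ∑ q ∈ I, if (t i ∩ P q).Nonempty then w i else 0 :=
      (Summable.tsum_finsetSum fun _ _ => ENNReal.summable).symm
    _ ≤ ∑' i, (A + θ⁻¹) * Metric.ediam (t i) ^ d := ENNReal.tsum_le_tsum h2
    _ = _ := ENNReal.tsum_mul_left

theorem card_le_of_abs_sub_le {s : Finset ℕ} {D : ℝ} (hD : 1 ≤ D)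
    (h : ∀ p ∈ s, ∀ q ∈ s, |(p : ℝ) - q| ≤ D) : (s.card : ℝ) ≤ 2 * D := by
  rcases s.eq_empty_or_nonempty with rfl | hs
  · simp; linarith
  have hsub : s ⊆ Finset.Icc (s.min' hs) (s.min' hs + ⌊D⌋₊) := by
    intro p hp
    rw [Finset.mem_Icc]
    refine ⟨s.min'_le p hp, ?_⟩
    have h1 := (abs_le.1 (h p hp _ (s.min'_mem hs))).2
    have h2 : p - s.min' hs ≤ ⌊D⌋₊ := by
      refine Nat.le_floor ?_
      rw [Nat.cast_sub (s.min'_le p hp)]; exact h1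
    omega
  have h3 := Finset.card_le_card hsub
  rw [Nat.card_Icc] at h3
  have h4 : s.card ≤ ⌊D⌋₊ + 1 := by omega
  have h5 : (s.card : ℝ) ≤ ⌊D⌋₊ + 1 := by exact_mod_cast h4
  linarith [Nat.floor_le (by linarith : 0 ≤ D)]

theorem card_triple_le {s : Finset (ℕ × ℕ × ℕ)} {D : ℝ} (hD : 1 ≤ D)
    (h : ∀ p ∈ s, ∀ q ∈ s, |(p.1 : ℝ) - q.1| ≤ D ∧ |(p.2.1 : ℝ) - q.2.1| ≤ D ∧
      |(p.2.2 : ℝ) - q.2.2| ≤ D) : (s.card : ℝ) ≤ 8 * D ^ 3 := by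
  classical
  have hsub : s ⊆ s.image (fun p => p.1) ×ˢ s.image (fun p => p.2.1) ×ˢ s.image fun p => p.2.2 := by
    intro p hp
    simp only [Finset.mem_product]
    exact ⟨Finset.mem_image_of_mem _ hp, Finset.mem_image_of_mem (fun p => p.2.1) hp,
      Finset.mem_image_of_mem (fun p => p.2.2) hp⟩
  have h0 := Finset.card_le_card hsub
  rw [Finset.card_product, Finset.card_product] at h0
  have h1 : ((s.image fun p => p.1).card : ℝ) ≤ 2 * D := by
    refine card_le_of_abs_sub_le hD fun p hp q hq => ?_
    obtain ⟨p', hp', rfl⟩ := Finset.mem_image.1 hp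
    obtain ⟨q', hq', rfl⟩ := Finset.mem_image.1 hq
    exact (h p' hp' q' hq').1
  have h2 : ((s.image fun p => p.2.1).card : ℝ) ≤ 2 * D := by
    refine card_le_of_abs_sub_le hD fun p hp q hq => ?_
    obtain ⟨p', hp', rfl⟩ := Finset.mem_image.1 hp
    obtain ⟨q', hq', rfl⟩ := Finset.mem_image.1 hq
    exact (h p' hp' q' hq').2.1
  have h3 : ((s.image fun p => p.2.2).card : ℝ) ≤ 2 * D := by
    refine card_le_of_abs_sub_le hD fun p hp q hq => ?_
    obtain ⟨p', hp', rfl⟩ := Finset.mem_image.1 hp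
    obtain ⟨q', hq', rfl⟩ := Finset.mem_image.1 hq
    exact (h p' hp' q' hq').2.2
  calc (s.card : ℝ) ≤ ((s.image fun p => p.1).card : ℝ) *
        (((s.image fun p => p.2.1).card : ℝ) * ((s.image fun p => p.2.2).card : ℝ)) := by
        exact_mod_cast h0
    _ ≤ (2 * D) * ((2 * D) * (2 * D)) := by gcongr
    _ = 8 * D ^ 3 := by ring

end ContentLowerBounds

/-! ### Content of unit cubes -/

section Cubes

/-- The closed cube of height one in the beam with index `r`, based at height `j`. -/
def cube (r : ℤ × ℤ) (j : ℕ) : Set E3 := {x | x ∈ Beam r ∧ (j : ℝ) ≤ x 2 ∧ x 2 ≤ j + 1}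

theorem isCompact_cube (r : ℤ × ℤ) (j : ℕ) : IsCompact (cube r j) := by
  refine Metric.isCompact_of_isClosed_isBounded ?_ ?_
  · exact (isClosed_beam r).inter ((isClosed_le continuous_const continuous_apply_two).inter
      (isClosed_le continuous_apply_two continuous_const))
  · rw [isBounded_iff_forall_norm_le]
    refine ⟨|2 * (r.1 : ℝ)| + |2 * (r.2 : ℝ)| + 2 + (j + 1), fun x hx => ?_⟩
    refine (norm_le_of_mem_beam hx.1).trans ?_
    have h0 : (0 : ℝ) ≤ x 2 := j.cast_nonneg.trans hx.2.1
    rw [abs_of_nonneg h0]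
    linarith [hx.2.2]

theorem volume_cube (r : ℤ × ℤ) (j : ℕ) : volume (cube r j) = volume (cube 0 0) := by
  set v : E3 := !₂[2 * r.1, 2 * r.2, (j : ℝ)]
  have : cube 0 0 = (fun x => v + x) ⁻¹' cube r j := by
    ext x
    simp [cube, Beam, v, add_comm]
  rw [this, measure_preimage_add]

theorem volume_cube_pos : 0 < volume (cube 0 0) := by
  have h : ∀ i : Fin 3, Continuous fun x : E3 => x i := fun i =>
    (EuclideanSpace.proj i : E3 →L[ℝ] ℝ).continuous
  have hopen : IsOpen {x : E3 | |x 0| < 1 ∧ |x 1| < 1 ∧ 0 < x 2 ∧ x 2 < 1} :=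
    (isOpen_lt (h 0).abs continuous_const).inter ((isOpen_lt (h 1).abs continuous_const).inter
      ((isOpen_lt continuous_const (h 2)).inter (isOpen_lt (h 2) continuous_const)))
  refine (hopen.measure_pos volume ⟨!₂[0, 0, 1 / 2], ?_⟩).trans_le (measure_mono ?_)
  · simp; norm_num
  · rintro x ⟨h0, h1, h2, h3⟩
    simp only [cube, Beam]
    simp
    exact ⟨⟨h0.le, h1.le⟩, h2.le, h3.le⟩

theorem volume_le_ediam_pow (t : Set E3) (ht : Metric.ediam t ≠ ⊤) :
    volume t ≤ Metric.ediam t ^ 3 * volume (Metric.ball (0 : E3) 1) := by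
  rcases t.eq_empty_or_nonempty with rfl | ⟨x, hx⟩
  · simp
  have hsub : t ⊆ Metric.closedBall x (Metric.diam t) := fun y hy =>
    Metric.dist_le_diam_of_mem' ht hy hx
  refine (measure_mono hsub).trans ?_
  rw [Measure.addHaar_closedBall _ _ Metric.diam_nonneg, ENNReal.ofReal_pow Metric.diam_nonneg]
  simp [Metric.diam, ENNReal.ofReal_toReal ht]

theorem exists_le_content_cube : ∃ c : ENNReal, 0 < c ∧ ∀ (d : ℝ) (hd : 0 < d), d ≤ 3 →
    ∀ r j, c ≤ content E3 d hd (cube r j) := by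
  set B := volume (Metric.ball (0 : E3) 1)
  have hB : B ≠ ⊤ := measure_ball_lt_top.ne
  refine ⟨min 1 (volume (cube 0 0) / B), lt_min one_pos
    (ENNReal.div_pos volume_cube_pos.ne' hB), fun d hd hd3 r j => ?_⟩
  rw [content_apply]
  refine le_iInf₂ fun t ht => ?_
  rcases le_or_gt 1 (∑' i, Metric.ediam (t i) ^ d) with h | h
  · exact (min_le_left _ _).trans h
  refine (min_le_right _ _).trans ?_
  -- Once all diameters are at most 1, the d-th power dominates the cube, so comparison with volume
  -- gives a constant independent of `d ≤ 3`.
  have h1 : ∀ i, Metric.ediam (t i) ≤ 1 := fun i => by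
    have := (ENNReal.le_tsum (f := fun i => Metric.ediam (t i) ^ d) i).trans h.le
    by_contra! h1
    exact absurd (ENNReal.one_lt_rpow h1 hd) this.not_gt
  refine ENNReal.div_le_of_le_mul ?_
  calc volume (cube 0 0) = volume (cube r j) := (volume_cube r j).symm
    _ ≤ ∑' i, volume (t i) := (measure_mono ht).trans (measure_iUnion_le t)
    _ ≤ ∑' i, Metric.ediam (t i) ^ d * B := by
      refine ENNReal.tsum_le_tsum fun i => ?_
      refine (volume_le_ediam_pow _ (ne_top_of_le_ne_top ENNReal.one_ne_top (h1 i))).trans ?_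
      gcongr
      rw [← ENNReal.rpow_ofNat]
      exact ENNReal.rpow_le_rpow_of_exponent_ge (h1 i) hd3
    _ = _ := ENNReal.tsum_mul_right

end Cubes

end Zorich

/-! ### A nested construction of dimension three -/

namespace Zorich

namespace BeamMap

variable {f : E3 → E3} {a m M α C : ℝ}

/-- The indices of the chosen cubes in the image of a cube of height `j`. -/
noncomputable def sub (j : ℕ) : Finset (ℕ × ℕ × ℕ) :=
  Finset.range ⌊Real.exp j / 10⌋₊ ×ˢ Finset.range ⌊Real.exp j / 10⌋₊ ×ˢ
    Finset.range ⌊Real.exp j / 10⌋₊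

/-- The beam of the chosen cube with index `q`. -/
def subBeam (q : ℕ × ℕ × ℕ) : ℤ × ℤ := (2 * (q.1 : ℤ), 2 * (q.2.1 : ℤ))

/-- The height of the chosen cube with index `q`. -/
noncomputable def subHeight (j : ℕ) (q : ℕ × ℕ × ℕ) : ℕ := ⌈Real.exp j⌉₊ + 2 * q.2.2

/-- The points of a cube whose first `n` iterates lie in chosen cubes. -/
noncomputable def nest (f : E3 → E3) : ℕ → ℤ × ℤ → ℕ → Set E3
  | 0, r, j => cube r j
  | n + 1, r, j => ⋃ q ∈ sub j, cube r j ∩ f ⁻¹' nest f n (subBeam q) (subHeight j q)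

theorem subBeam_mem (q : ℕ × ℕ × ℕ) : subBeam q ∈ S := by
  simp [subBeam, S, Int.even_add]

theorem le_subHeight (j : ℕ) (q : ℕ × ℕ × ℕ) : j ≤ subHeight j q := by
  have h1 : (j : ℝ) ≤ ⌈Real.exp j⌉₊ := by
    have := Nat.le_ceil (Real.exp j)
    linarith [Real.add_one_le_exp (j : ℝ)]
  have h2 : j ≤ ⌈Real.exp j⌉₊ := by exact_mod_cast h1
  simp only [subHeight]; omega

theorem nest_subset_cube (n : ℕ) (r : ℤ × ℤ) (j : ℕ) : nest f n r j ⊆ cube r j := by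
  cases n with
  | zero => exact subset_rfl
  | succ n => exact Set.iUnion₂_subset fun q _ => Set.inter_subset_left

theorem nest_antitone (r : ℤ × ℤ) (j : ℕ) : Antitone fun n => nest f n r j := by
  refine antitone_nat_of_succ_le fun n => ?_
  change nest f (n + 1) r j ⊆ nest f n r j
  induction n generalizing r j with
  | zero => exact nest_subset_cube 1 r j
  | succ n ih =>
    rw [nest]
    conv_rhs => rw [nest]
    exact Set.iUnion₂_mono fun q _ => Set.inter_subset_inter_right _ (Set.preimage_mono (ih _ _))

theorem isCompact_nest (hf : BeamMap f a m M α C) (n : ℕ) (r : ℤ × ℤ) (j : ℕ) :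
    IsCompact (nest f n r j) := by
  induction n generalizing r j with
  | zero => exact isCompact_cube r j
  | succ n ih =>
    rw [nest]
    exact (sub j).isCompact_biUnion fun q _ =>
      (isCompact_cube r j).inter_right ((ih _ _).isClosed.preimage hf.cont)

theorem le_height_of_mem_nest {N : ℕ} {n : ℕ} {r : ℤ × ℤ} {j : ℕ} (hj : N ≤ j) {x : E3}
    (hx : x ∈ nest f n r j) : (N : ℝ) ≤ f^[n] x 2 := by
  induction n generalizing r j x with
  | zero =>
    have h : (j : ℝ) ≤ x 2 := hx.2.1
    exact le_trans (by exact_mod_cast hj) h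
  | succ n ih =>
    rw [nest] at hx
    obtain ⟨q, -, hx⟩ := Set.mem_iUnion₂.1 hx
    exact ih (hj.trans (le_subHeight j q)) hx.2

theorem iInter_nest_subset_high {N : ℕ} (hN : M < N) {r : ℤ × ℤ} {j : ℕ} (hj : N ≤ j) :
    ⋂ n, nest f n r j ⊆ high f M := fun _ hx n =>
  hN.trans_le (le_height_of_mem_nest hj (Set.mem_iInter.1 hx n))

/-- Chosen cubes start at height at least `exp j`, so preimages have height at least `j`. The box of
side about `exp j / 10` keeps the sum of the absolute coordinates below `(5 / 2) * exp j`, including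
`a ≤ exp j / 2`, and `5 / 2 ≤ exp 1` then bounds the preimage height by `j + 1`. -/
theorem exists_mem_cube (hf : BeamMap f a m M α C) {r : ℤ × ℤ} (hr : r ∈ S) {j : ℕ} (hMj : M < j)
    (hj : 2 * a ≤ Real.exp j) {q : ℕ × ℕ × ℕ} (hq : q ∈ sub j) {y : E3}
    (hy : y ∈ cube (subBeam q) (subHeight j q)) : ∃ x ∈ cube r j, f x = y := by
  have hexp := Real.add_one_le_exp (j : ℝ)
  have ha := hf.one_lt_a
  have hc1 := Nat.le_ceil (Real.exp j)
  have hc2 := Nat.ceil_lt_add_one (Real.exp_pos j).le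
  have hfl := Nat.floor_le (by positivity : 0 ≤ Real.exp j / 10)
  obtain ⟨hq1, hq2⟩ := Finset.mem_product.1 hq
  obtain ⟨hq2, hq3⟩ := Finset.mem_product.1 hq2
  rw [Finset.mem_range] at hq1 hq2 hq3
  have hq1' : (q.1 : ℝ) + 1 ≤ ⌊Real.exp j / 10⌋₊ := by exact_mod_cast hq1
  have hq2' : (q.2.1 : ℝ) + 1 ≤ ⌊Real.exp j / 10⌋₊ := by exact_mod_cast hq2
  have hq3' : (q.2.2 : ℝ) + 1 ≤ ⌊Real.exp j / 10⌋₊ := by exact_mod_cast hq3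
  obtain ⟨⟨hy0, hy1⟩, hyl, hyu⟩ := hy
  simp only [subBeam, subHeight] at hy0 hy1 hyl hyu
  push_cast at hy0 hy1 hyl hyu
  obtain ⟨x, hx, hfx⟩ := hf.surj r hr y (by
    have : (0 : ℝ) ≤ q.2.2 := Nat.cast_nonneg _
    linarith)
  refine ⟨x, ⟨⟨hx.1.le, hx.2.1.le⟩, ?_, ?_⟩, hfx⟩
  · have h1 := hf.apply_two_le x
    rw [hfx] at h1
    have : (0 : ℝ) ≤ q.2.2 := Nat.cast_nonneg _
    exact Real.exp_le_exp.1 (by linarith)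
  · have h1 := hf.exp_le x
    have h2 := hf.apply_two_le x
    rw [hfx] at h1 h2
    have p1 : (0 : ℝ) ≤ q.1 := Nat.cast_nonneg _
    have p2 : (0 : ℝ) ≤ q.2.1 := Nat.cast_nonneg _
    have p3 : (0 : ℝ) ≤ q.2.2 := Nat.cast_nonneg _
    have h3 : |y 0| ≤ 4 * q.1 + 1 := by
      rw [abs_le] at hy0 ⊢; constructor <;> linarith [hy0.1, hy0.2]
    have h4 : |y 1| ≤ 4 * q.2.1 + 1 := by
      rw [abs_le] at hy1 ⊢; constructor <;> linarith [hy1.1, hy1.2]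
    rw [abs_of_pos (by linarith [Real.exp_pos (j : ℝ)] : 0 < y 2 + a)] at h1
    have q1 := Real.quadratic_le_exp_of_nonneg (by norm_num : (0:ℝ) ≤ 1)
    have e : Real.exp (j + 1) = Real.exp j * Real.exp 1 := Real.exp_add _ _
    refine Real.exp_le_exp.1 ?_
    rw [e]
    nlinarith [Real.exp_pos (j : ℝ)]

/-- Every second cube is taken in each direction, so a distance less than 1 between points of chosen
cubes forces equal indices. -/
theorem index_diff {j : ℕ} {p q : ℕ × ℕ × ℕ} {x y : E3}
    (hx : x ∈ cube (subBeam p) (subHeight j p)) (hy : y ∈ cube (subBeam q) (subHeight j q)) :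
    4 * |(p.1 : ℝ) - q.1| ≤ dist x y + 2 ∧ 4 * |(p.2.1 : ℝ) - q.2.1| ≤ dist x y + 2 ∧
      2 * |(p.2.2 : ℝ) - q.2.2| ≤ dist x y + 1 := by
  have h0 := abs_le.1 (abs_sub_le_dist x y 0)
  have h1 := abs_le.1 (abs_sub_le_dist x y 1)
  have h2 := abs_le.1 (abs_sub_le_dist x y 2)
  obtain ⟨⟨hx0, hx1⟩, hxl, hxu⟩ := hx
  obtain ⟨⟨hy0, hy1⟩, hyl, hyu⟩ := hy
  simp only [subBeam, subHeight] at *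
  push_cast at *
  rw [abs_le] at hx0 hx1 hy0 hy1
  have aux : ∀ c u v : ℝ, 0 < c → c * u ≤ v → -v ≤ c * u → c * |u| ≤ v := by
    intro c u v hc h1 h2
    have e : c * |u| = |c * u| := by rw [abs_mul, abs_of_pos hc]
    rw [e, abs_le]
    exact ⟨h2, h1⟩
  refine ⟨aux _ _ _ (by norm_num) ?_ ?_, aux _ _ _ (by norm_num) ?_ ?_,
    aux _ _ _ (by norm_num) ?_ ?_⟩ <;>
    linarith [h0.1, h0.2, h1.1, h1.2, h2.1, h2.2, hx0.1, hx0.2, hx1.1, hx1.2, hy0.1, hy0.2,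
      hy1.1, hy1.2]

open Classical in
theorem card_meeting_le (hf : BeamMap f a m M α C) {r : ℤ × ℤ} {j : ℕ} {t : Set E3}
    (ht : Metric.ediam t ≠ ⊤) (n : ℕ) :
    let I := (sub j).filter fun q =>
      (t ∩ (cube r j ∩ f ⁻¹' nest f n (subBeam q) (subHeight j q))).Nonempty
    let D := C * Real.exp (j + 1) * Metric.diam t
    (1 ≤ D → (I.card : ℝ) ≤ 8 * D ^ 3) ∧ (D < 1 → I.card ≤ 1) := by
  intro I D
  have hpt : ∀ p ∈ I, ∀ q ∈ I, ∃ x ∈ cube (subBeam p) (subHeight j p),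
      ∃ y ∈ cube (subBeam q) (subHeight j q), dist x y ≤ D := by
    intro p hp q hq
    obtain ⟨-, x, hxt, hxc, hx⟩ := Finset.mem_filter.1 hp
    obtain ⟨-, y, hyt, hyc, hy⟩ := Finset.mem_filter.1 hq
    refine ⟨f x, nest_subset_cube _ _ _ hx, f y, nest_subset_cube _ _ _ hy, ?_⟩
    refine (hf.upper (j + 1) x y hxc.2.2 hyc.2.2).trans ?_
    exact mul_le_mul_of_nonneg_left (Metric.dist_le_diam_of_mem' ht hxt hyt)
      (mul_nonneg hf.C_pos.le (Real.exp_pos _).le)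
  constructor
  · intro hD
    refine card_triple_le hD fun p hp q hq => ?_
    obtain ⟨x, hx, y, hy, hxy⟩ := hpt p hp q hq
    obtain ⟨h1, h2, h3⟩ := index_diff hx hy
    refine ⟨?_, ?_, ?_⟩ <;> linarith
  · intro hD
    refine Finset.card_le_one.2 fun p hp q hq => ?_
    obtain ⟨x, hx, y, hy, hxy⟩ := hpt p hp q hq
    obtain ⟨h1, h2, h3⟩ := index_diff hx hy
    have aux : ∀ u v : ℕ, |(u : ℝ) - v| < 1 → u = v := by
      intro u v h
      have : |(u : ℤ) - v| < 1 := by exact_mod_cast h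
      rw [Int.abs_lt_one_iff] at this
      omega
    exact Prod.ext (aux _ _ (by linarith)) (Prod.ext (aux _ _ (by linarith)) (aux _ _ (by linarith)))

open Classical in
-- The bound `c` reproduces itself. Each piece has content at least `c / K ^ d`, where `K` is the
-- Lipschitz constant on the cube. A cover of total size less than `c` would, by `card_le_mul_tsum`,
-- leave room for at most `8 * K ^ 3 * c + K ^ d` pieces, fewer than there are.
theorem le_content_nest (hf : BeamMap f a m M α C) {d : ℝ} (hd : 0 < d) (hd3 : d ≤ 3) {c : ENNReal}
    (hc0 : 0 < c) (hc1 : c ≤ 1) (hbase : ∀ r j, c ≤ content E3 d hd (cube r j)) {N : ℕ}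
    (hMN : M < N) (hN : ∀ j ≥ N, 2 * a ≤ Real.exp j ∧
      8 * ENNReal.ofReal (C * Real.exp (j + 1)) ^ 3 * c + ENNReal.ofReal (C * Real.exp (j + 1)) ^ d
        < (sub j).card) (n : ℕ) {r : ℤ × ℤ} (hr : r ∈ S) {j : ℕ} (hj : N ≤ j) :
    c ≤ content E3 d hd (nest f n r j) := by
  induction n generalizing r j with
  | zero => exact hbase r j
  | succ n ih =>
    have hctop : c ≠ ⊤ := ne_top_of_le_ne_top ENNReal.one_ne_top hc1
    have hMj : M < j := hMN.trans_le (by exact_mod_cast hj)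
    obtain ⟨hja, hcount⟩ := hN j hj
    have hKp : 0 < C * Real.exp (j + 1) := mul_pos hf.C_pos (Real.exp_pos _)
    obtain ⟨K, hK⟩ : ∃ K : ℝ≥0, (K : ℝ) = C * Real.exp (j + 1) := ⟨⟨_, hKp.le⟩, rfl⟩
    have hKe : (K : ENNReal) = ENNReal.ofReal (C * Real.exp (j + 1)) := by
      rw [← hK, ENNReal.ofReal_coe_nnreal]
    have hK0 : 0 < K := by exact_mod_cast hK ▸ hKp
    have hKd0 : (K : ENNReal) ^ d ≠ 0 := (ENNReal.rpow_pos (by simpa using hK0) (by simp)).ne'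
    have hKdt : (K : ENNReal) ^ d ≠ ⊤ := ENNReal.rpow_ne_top_of_nonneg hd.le (by simp)
    set P : ℕ × ℕ × ℕ → Set E3 := fun q =>
      cube r j ∩ f ⁻¹' nest f n (subBeam q) (subHeight j q) with hP
    have hPc : ∀ q ∈ sub j, ((K : ENNReal) ^ d)⁻¹ * c ≤ content E3 d hd (P q) := by
      intro q hq
      rw [ENNReal.inv_mul_le_iff hKd0 hKdt]
      have h1 : nest f n (subBeam q) (subHeight j q) ⊆ f '' P q := by
        intro y hy
        obtain ⟨x, hx, hfx⟩ := hf.exists_mem_cube hr hMj hja hq (nest_subset_cube _ _ _ hy)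
        exact ⟨x, ⟨hx, by rw [Set.mem_preimage, hfx]; exact hy⟩, hfx⟩
      refine (ih (subBeam_mem q) (hj.trans (le_subHeight j q))).trans ((measure_mono h1).trans ?_)
      refine content_image_le hd f hK0 fun x hx y hy => ?_
      rw [edist_dist, edist_dist, hKe, ← ENNReal.ofReal_mul hKp.le]
      exact ENNReal.ofReal_le_ofReal (hf.upper (j + 1) x y hx.1.2.2 hy.1.2.2)
    rw [content_apply]
    refine le_iInf₂ fun t ht => ?_
    by_contra! hlt
    have hd1 : ∀ i, Metric.ediam (t i) ≤ 1 := fun i => by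
      have := (ENNReal.le_tsum (f := fun i => Metric.ediam (t i) ^ d) i).trans (hlt.le.trans hc1)
      by_contra! h1
      exact absurd (ENNReal.one_lt_rpow h1 hd) this.not_gt
    have hdt : ∀ i, Metric.ediam (t i) ≠ ⊤ := fun i =>
      ne_top_of_le_ne_top ENNReal.one_ne_top (hd1 i)
    have hmain := card_le_mul_tsum hd (I := sub j) (P := P) (t := t) (A := 8 * (K : ENNReal) ^ 3)
      (θ := ((K : ENNReal) ^ d)⁻¹ * c)
      (fun q hq => Set.Subset.trans (Set.subset_biUnion_of_mem (u := P) hq) ht)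
      (ENNReal.mul_pos (ENNReal.inv_ne_zero.2 hKdt) hc0.ne')
      (ENNReal.mul_ne_top (ENNReal.inv_ne_top.2 hKd0) hctop) hPc
      {i | 1 ≤ C * Real.exp (j + 1) * Metric.diam (t i)}
      (fun i hi => by
        have h1 := (hf.card_meeting_le (r := r) (j := j) (hdt i) n).1 hi
        have h2 : (((sub j).filter fun q => (t i ∩ P q).Nonempty).card : ENNReal) ≤
            ENNReal.ofReal (8 * (C * Real.exp (j + 1) * Metric.diam (t i)) ^ 3) := by
          rw [← ENNReal.ofReal_natCast]
          exact ENNReal.ofReal_le_ofReal h1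
        refine h2.trans ?_
        rw [ENNReal.ofReal_mul (by norm_num), ENNReal.ofReal_pow (by positivity),
          ENNReal.ofReal_mul hKp.le, ← hKe, mul_pow, Metric.diam, ENNReal.ofReal_toReal (hdt i),
          ENNReal.ofReal_ofNat, ← mul_assoc]
        gcongr
        rw [← ENNReal.rpow_ofNat]
        exact ENNReal.rpow_le_rpow_of_exponent_ge (hd1 i) hd3)
      (fun i hi => (hf.card_meeting_le (r := r) (j := j) (hdt i) n).2 (not_le.1 hi))
    rw [← hKe] at hcount
    refine absurd (hmain.trans ?_) hcount.not_ge
    calc _ ≤ (8 * (K : ENNReal) ^ 3 + (((K : ENNReal) ^ d)⁻¹ * c)⁻¹) * c := by gcongr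
      _ = _ := by
        rw [add_mul, ENNReal.mul_inv (Or.inr hctop) (Or.inr hc0.ne'), inv_inv, mul_assoc,
          mul_assoc ((K : ENNReal) ^ d), ENNReal.inv_mul_cancel hc0.ne' hctop, mul_one, ← mul_assoc]

theorem le_card_sub {j : ℕ} (hj : 20 ≤ Real.exp j) : Real.exp j ^ 3 / 8000 ≤ (sub j).card := by
  have h : Real.exp j / 20 ≤ ⌊Real.exp j / 10⌋₊ := by
    linarith [Nat.lt_floor_add_one (Real.exp j / 10)]
  rw [sub, Finset.card_product, Finset.card_product, Finset.card_range]
  push_cast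
  calc Real.exp j ^ 3 / 8000 = Real.exp j / 20 * (Real.exp j / 20 * (Real.exp j / 20)) := by ring
    _ ≤ _ := by gcongr

/-- The points whose orbit stays high have Hausdorff dimension at least three. -/
theorem three_le_dimH_high (hf : BeamMap f a m M α C) : 3 ≤ dimH (high f M) := by
  refine ENNReal.le_of_forall_nnreal_lt fun d hd3 => ?_
  rcases eq_or_ne d 0 with rfl | hd0
  · simp
  have hd3' : (d : ℝ) < 3 := by exact_mod_cast hd3
  have hd : (0 : ℝ) < d := by exact_mod_cast pos_iff_ne_zero.2 hd0
  obtain ⟨c₀, hc₀, hbase⟩ := exists_le_content_cube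
  have hCp := hf.C_pos
  obtain ⟨L, hL⟩ : ∃ L : ℝ, L = C * Real.exp 1 := ⟨_, rfl⟩
  have hLp : 0 < L := hL ▸ mul_pos hCp (Real.exp_pos _)
  have hKL : ∀ j : ℕ, C * Real.exp (j + 1) = L * Real.exp j := fun j => by
    rw [hL, add_comm, Real.exp_add, mul_assoc]
  -- There are at least `exp j ^ 3 / 8000` pieces. This choice makes `8 * K ^ 3 * c` at most `exp j
  -- ^ 3 / 32000` for `K = L * exp j`, and `K ^ d` obeys the same bound for large `j` because `d <
  -- 3`.
  set c : ENNReal := min (min 1 c₀) (ENNReal.ofReal (1 / (256000 * L ^ 3))) with hc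
  have hc0 : 0 < c := lt_min (lt_min one_pos hc₀) (ENNReal.ofReal_pos.2 (by positivity))
  have hc1 : c ≤ 1 := (min_le_left _ _).trans (min_le_left _ _)
  have hexp : Tendsto (fun j : ℕ => Real.exp j) atTop atTop :=
    Real.tendsto_exp_atTop.comp tendsto_natCast_atTop_atTop
  have hexp2 : Tendsto (fun j : ℕ => Real.exp ((3 - d) * j)) atTop atTop :=
    Real.tendsto_exp_atTop.comp (tendsto_natCast_atTop_atTop.const_mul_atTop (by linarith))
  obtain ⟨N, hN⟩ := eventually_atTop.1 ((hexp.eventually_ge_atTop (max 20 (2 * a))).and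
    ((hexp2.eventually_ge_atTop (32000 * L ^ (d : ℝ))).and
    (tendsto_natCast_atTop_atTop (R := ℝ) |>.eventually_gt_atTop M)))
  have hcount : ∀ j ≥ N, 2 * a ≤ Real.exp j ∧
      8 * ENNReal.ofReal (C * Real.exp (j + 1)) ^ 3 * c +
        ENNReal.ofReal (C * Real.exp (j + 1)) ^ (d : ℝ) < (sub j).card := by
    intro j hj
    obtain ⟨h1, h2, -⟩ := hN j hj
    refine ⟨(le_max_right _ _).trans h1, ?_⟩
    have h3 := le_card_sub ((le_max_left _ _).trans h1)
    have hEp := Real.exp_pos (j : ℝ)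
    have h4 : (L * Real.exp j) ^ (d : ℝ) ≤ Real.exp j ^ 3 / 32000 := by
      rw [Real.mul_rpow hLp.le hEp.le, ← Real.exp_mul, le_div_iff₀ (by norm_num)]
      calc L ^ (d : ℝ) * Real.exp (j * d) * 32000 = (32000 * L ^ (d : ℝ)) * Real.exp (j * d) := by
            ring
        _ ≤ Real.exp ((3 - d) * j) * Real.exp (j * d) := by gcongr
        _ = Real.exp j ^ 3 := by
            rw [← Real.exp_add, ← Real.exp_nat_mul]; congr 1; push_cast; ring
    have h5 : 8 * (L * Real.exp j) ^ 3 * (1 / (256000 * L ^ 3)) = Real.exp j ^ 3 / 32000 := by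
      field_simp; norm_num
    rw [hKL]
    calc _ ≤ 8 * ENNReal.ofReal (L * Real.exp j) ^ 3 * ENNReal.ofReal (1 / (256000 * L ^ 3)) +
          ENNReal.ofReal (L * Real.exp j) ^ (d : ℝ) := by gcongr; exact min_le_right _ _
      _ = ENNReal.ofReal (8 * (L * Real.exp j) ^ 3 * (1 / (256000 * L ^ 3)) +
          (L * Real.exp j) ^ (d : ℝ)) := by
          have e : ∀ X Y : ℝ, 0 ≤ X → ENNReal.ofReal (8 * X ^ 3 * Y) =
              8 * ENNReal.ofReal X ^ 3 * ENNReal.ofReal Y := fun X Y hX => by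
            rw [ENNReal.ofReal_mul (by positivity), ENNReal.ofReal_mul (by norm_num),
              ENNReal.ofReal_pow hX, ENNReal.ofReal_ofNat]
          rw [ENNReal.ofReal_add (by positivity) (by positivity), e _ _ (by positivity),
            ENNReal.ofReal_rpow_of_pos (by positivity)]
      _ < ENNReal.ofReal ((sub j).card : ℝ) := by
          rw [ENNReal.ofReal_lt_ofReal_iff_of_nonneg (by positivity), h5]
          have : 0 < Real.exp j ^ 3 := by positivity
          linarith
      _ = _ := ENNReal.ofReal_natCast _
  have hMN : M < N := (hN N le_rfl).2.2
  have hle := le_content_iInter hd (nest_antitone (f := f) 0 N) (fun n => hf.isCompact_nest n 0 N)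
    fun n => hf.le_content_nest hd hd3'.le hc0 hc1
      (fun r j => ((min_le_left _ _).trans (min_le_right _ _)).trans (hbase d hd hd3'.le r j)) hMN
      hcount n (r := 0) (by simp [S]) le_rfl
  refine le_trans ?_ (dimH_mono (iInter_nest_subset_high (f := f) (r := 0) (j := N) hMN le_rfl))
  refine le_dimH_of_hausdorffMeasure_ne_zero ?_
  exact (hc0.trans_le (hle.trans (content_le_hausdorffMeasure hd _))).ne'

end BeamMap

end Zorich

/-! ### Assembly of the result -/

theorem theorem1 (F : Zorich.E3 → Zorich.E3) (hF : Zorich.IsZorichMap F)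
    (α m M : ℝ) (hα0 : 0 < α) (hα1 : α < 1) (hmM : m < M)
    (hm : ∀ᵐ x : Zorich.E3, x 2 ≤ m → ‖fderiv ℝ F x‖ ≤ α)
    (hM : ∀ᵐ x : Zorich.E3, M ≤ x 2 → ∀ v : Zorich.E3, ‖v‖ = 1 → 1 / α ≤ ‖fderiv ℝ F x v‖)
    (a : ℝ) (ha : Real.exp M - m ≤ a)
    (f : Zorich.E3 → Zorich.E3) (hf : f = Zorich.shiftedMap F a) :
    ∃ ξ : Zorich.E3,
      -- `ξ` is the unique fixed point in the half-space `x₃ ≤ m`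
      (f ξ = ξ ∧ ξ 2 ≤ m) ∧
      (∀ y : Zorich.E3, f y = y → y 2 ≤ m → y = ξ) ∧
      -- the non-convergence set is the disjoint union of hairs, one for each admissible itinerary
      Zorich.nonConvergenceSet f ξ =
        ⋃ s ∈ {s | Zorich.Admissible s}, Zorich.itinerarySet f ξ M s ∧
      (∀ s, Zorich.Admissible s → Zorich.IsHair (Zorich.itinerarySet f ξ M s)) ∧
      (∀ s s', Zorich.Admissible s → Zorich.Admissible s' → s ≠ s' →
        Disjoint (Zorich.itinerarySet f ξ M s) (Zorich.itinerarySet f ξ M s')) ∧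
      -- there are uncountably many hairs
      ¬ (Zorich.itinerarySet f ξ M '' {s | Zorich.Admissible s}).Countable ∧
      -- the dimensions
      dimH (Zorich.endpointSet f ξ M) = 3 ∧
      dimH (Zorich.nonConvergenceSet f ξ \ Zorich.endpointSet f ξ M) = 1 := by
  open Zorich BeamMap in
  obtain ⟨C, hB⟩ := hF.beamMap hα0 hα1 hmM hm hM ha
  rw [← hf] at hB
  obtain ⟨ξ, hξ, huniq, hconv⟩ := hB.exists_fixedPoint
  have hJ : nonConvergenceSet f ξ = high f M :=
    Set.ext fun x => hB.mem_nonConvergenceSet_iff hξ.2 hconv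
  have hJs : ∀ s, itinerarySet f ξ M s = itin f M s := fun s => by
    refine Set.Subset.antisymm (fun x hx => hx.2) fun x hx => ⟨?_, hx⟩
    rw [hJ]; exact itin_subset_high s hx
  have hunion : nonConvergenceSet f ξ = ⋃ s ∈ {s | Admissible s}, itinerarySet f ξ M s := by
    ext x
    rw [hJ, hB.mem_high_iff]
    simp [hJs]
  have hdisj : ∀ s s', Admissible s → Admissible s' → s ≠ s' →
      Disjoint (itinerarySet f ξ M s) (itinerarySet f ξ M s') := fun s s' _ _ h => by
    rw [hJs, hJs]; exact disjoint_itin h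
  -- Endpoints are exactly the points of least potential, so the complement of C is the set treated
  -- by `dimH_nonminimal_le`.
  have hend : ∀ s, Admissible s → ∀ p, IsEndpoint (itinerarySet f ξ M s) p ↔
      p ∈ itin f M s ∧ ∀ y ∈ itin f M s, pot f M p ≤ pot f M y := by
    intro s hs p
    rw [hJs]
    obtain ⟨γ, hγ, hpot⟩ := hB.exists_hairParam hs
    have hmin : ∀ y ∈ itin f M s, pot f M (γ 0) ≤ pot f M y := by
      intro y hy
      have := hpot (γ.symm ⟨y, hy⟩)
      rw [γ.apply_symm_apply] at this
      rw [this]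
      simp
    rw [isEndpoint_iff hγ]
    constructor
    · rintro rfl
      exact ⟨(γ 0).2, hmin⟩
    · rintro ⟨hp, hle⟩
      exact hB.pot_injOn hs.1 hp (γ 0).2 ((hle _ (γ 0).2).antisymm (hmin p hp))
  have hdiff : nonConvergenceSet f ξ \ endpointSet f ξ M = {x | ∃ s, Admissible s ∧
      x ∈ itin f M s ∧ ∃ y ∈ itin f M s, pot f M y < pot f M x} := by
    ext x
    rw [hJ, Set.mem_sdiff, hB.mem_high_iff]
    constructor
    · rintro ⟨⟨s, hs, hx⟩, hnot⟩
      refine ⟨s, hs, hx, ?_⟩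
      by_contra! h
      exact hnot ⟨s, hs, (hend s hs x).2 ⟨hx, h⟩⟩
    · rintro ⟨s, hs, hx, y, hy, hlt⟩
      refine ⟨⟨s, hs, hx⟩, ?_⟩
      rintro ⟨s', hs', he⟩
      obtain ⟨hx', hmin⟩ := (hend s' hs' x).1 he
      have hss : s = s' := by
        by_contra hne
        exact Set.disjoint_left.1 (disjoint_itin (f := f) (M := M) hne) hx hx'
      subst hss
      exact (hmin y hy).not_gt hlt
  have hle1 : dimH (nonConvergenceSet f ξ \ endpointSet f ξ M) ≤ 1 := by
    rw [hdiff]; exact hB.dimH_nonminimal_le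
  have hzero : Admissible fun _ => 0 := by
    refine ⟨fun _ => by simp [S], 1, one_pos, 0, ?_⟩
    rw [Filter.eventually_map]
    exact Filter.Eventually.of_forall fun k => by simp
  refine ⟨ξ, hξ, huniq, hunion, ?_, hdisj, ?_, ?_, le_antisymm hle1 ?_⟩
  · intro s hs
    rw [hJs]
    obtain ⟨γ, hγ, -⟩ := hB.exists_hairParam hs
    exact ⟨γ, hγ⟩
  · intro hcount
    have hinj : Set.InjOn (itinerarySet f ξ M) {s | Admissible s} := by
      intro s hs s' hs' h
      by_contra hne
      obtain ⟨x, hx⟩ := hB.itin_nonempty hs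
      have hd := hdisj s s' hs hs' hne
      rw [← h, hJs] at hd
      exact Set.disjoint_left.1 hd hx hx
    have hA : {s | Admissible s}.Countable := Set.countable_of_injective_of_countable_image hinj hcount
    -- Sequences using only two indices are bounded, hence admissible, and there are uncountably
    -- many of them by the diagonal argument.
    set g : (ℕ → Bool) → ℕ → ℤ × ℤ := fun b k => if b k then (1, 1) else (0, 0)
    have hg : Function.Injective g := by
      intro b b' h
      funext k
      have := congrFun h k
      simp only [g] at this
      cases hb : b k <;> cases hb' : b' k <;> simp [hb, hb'] at this ⊢
    have hgA : ∀ b, g b ∈ {s | Admissible s} := by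
      intro b
      refine ⟨fun k => ?_, 1, one_pos, 2, ?_⟩
      · simp only [g]; split_ifs <;> simp [S]
      · rw [Filter.eventually_map]
        refine Filter.Eventually.of_forall fun k => ?_
        have hk := le_iterate_E 1 k
        change √(((g b k).1 : ℝ) ^ 2 + ((g b k).2 : ℝ) ^ 2) / E^[k] 1 ≤ 2
        rw [div_le_iff₀ (by linarith)]
        refine Real.sqrt_le_iff.2 ⟨by linarith, ?_⟩
        simp only [g]
        split_ifs
        · norm_num; nlinarith
        · simp; positivity
    have : (Set.range g).Countable := hA.mono (by rintro _ ⟨b, rfl⟩; exact hgA b)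
    rw [← Set.image_univ] at this
    have := Set.countable_univ_iff.1
      (Set.countable_of_injective_of_countable_image hg.injOn this)
    obtain ⟨e, he⟩ := exists_surjective_nat (ℕ → Bool)
    obtain ⟨k, hk⟩ := he fun n => !(e n n)
    have := congrFun hk k
    simp at this
  · refine le_antisymm ?_ ?_
    · refine (dimH_mono (Set.subset_univ _)).trans ?_
      rw [Real.dimH_univ_eq_finrank]; simp
    -- The dimension of J is the larger of those of C and its complement in J, and the latter is at
    -- most 1.
    · have h3 := hB.three_le_dimH_high
      rw [← hJ] at h3
      have hsub : nonConvergenceSet f ξ ⊆ endpointSet f ξ M ∪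
          (nonConvergenceSet f ξ \ endpointSet f ξ M) := fun x hx => by
        by_cases h : x ∈ endpointSet f ξ M
        · exact Or.inl h
        · exact Or.inr ⟨hx, h⟩
      have h4 := h3.trans (dimH_mono hsub)
      rw [dimH_union] at h4
      rcases le_max_iff.1 h4 with h | h
      · exact h
      · exact absurd (h.trans hle1) (by norm_num)
  · obtain ⟨γ, hγ, hpot⟩ := hB.exists_hairParam hzero
    have hcont : Continuous fun t : NNReal => (γ t : E3) := continuous_subtype_val.comp γ.continuous
    -- A single hair without its endpoint is connected and has more than one point.
    have hconn : IsPreconnected ((fun t : NNReal => (γ t : E3)) '' Set.Ioi 0) :=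
      isPreconnected_Ioi.image _ hcont.continuousOn
    refine (one_le_dimH_of_isPreconnected hconn (x := γ 1) (y := γ 2) ⟨1, by simp, rfl⟩
      ⟨2, by simp, rfl⟩ ?_).trans (dimH_mono ?_)
    · intro h
      exact absurd (γ.injective (Subtype.ext h)) (by norm_num)
    · rw [hdiff]
      rintro _ ⟨t, ht, rfl⟩
      refine ⟨_, hzero, (γ t).2, γ 0, (γ 0).2, ?_⟩
      simp only [hpot t]
      have : (0 : ℝ) < t := by exact_mod_cast ht
      linarith
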